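/- **Setting.** A planar tree is a rooted, locally finite planar tree $T$ (finite or infinite) whose root $i_0$ has exactly one offspring $i_1$; trees are identified up to order-preserving isomorphism. $|T|$ is the number of edges, $D_r(T)$ the set of vertices at distance $r$ from the root, $B_r(T)$ the ball of radius $r$ around the root, and $h(T)$ the maximal height (distance from the root) of a vertex. The set $\mathcal T$ of all planar trees carries the metric $\mathrm{dist}(T,T')=\inf\{1/r : r\in\{1,2,\dots\},\ B_r(T)=B_r(T')\}$ and its Borel $\sigma$-algebra; $\mathcal B_a(T_0)$ is the closed ball of radius $a$ around $T_0$ in $\mathcal T$. For $N\ge 1$ and $\mu\in\mathbb R$ let $\nu_N^{(\mu)}$ be the probability measure on the finite set $\mathcal T_N$ of trees of size $|T|=N$ given by $\nu^{(\mu)}_N(T)=e^{-\mu h(T)}/Z_N^{(\mu)}$, $Z_N^{(\mu)}=\sum_{T\in\mathcal T_N}e^{-\mu h(T)}$. Let $\rho$ be the law on $\mathcal T$ of the critical Bienaymé–Galton–Watson tree (started from $i_1$) with offspring distribution $p_n=2^{-(n+1)}$, $n\ge 0$. For $n\ge1$ let $\mu\Delta_n=\{(\mu_1,\dots,\mu_n):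 \mu_1+\dots+\mu_n=\mu,\ \mu_1,\dots,\mu_n>0\}$, and let $d\omega$ be the normalised $(n-1)$-dimensional Lebesgue measure on $\mu\Delta_n$ (a unit point mass if $n=1$). If $T_0$ is a finite tree of height $r$, grafting trees $(T_i)_{i\in D_r(T_0)}$ onto $T_0$ (identifying the root edge of $T_i$ with the edge of $T_0$ from the parent of $i$ to $i$) defines a bijection $\mathcal T^{D_r(T_0)}\to\mathcal B_{1/r}(T_0)$, by which these two spaces are identified. **Theorem.** For every $\mu>0$ the measures $\nu_N^{(\mu)}$ converge weakly on $\mathcal T$, as $N\to\infty$, to a probability measure $\nu^{(\mu)}$, and for every finite tree $T_0$ of height $r$, with $K=|D_r(T_0)|$, under the identification $\mathcal B_{1/r}(T_0)=\mathcal T^{D_r(T_0)}$, $$\nu^{(\mu)}\big|_{\mathcal B_{1/r}(T_0)}=e^{-(r-1)\mu}\,4^{-|T_0|}\,2^{K+1}\sum_{\emptyset\ne D\subseteq D_r(T_0)}\frac{\mu^{|D|-1}}{(|D|-1)!}\Big(\int_{\mu\Delta_{|D|}}d\omega\prod_{i\in D}\nu^{(\mu_i)}\Big)\times\prod_{j\in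 D_r(T_0)\setminus D}\rho_j ,\qquad \rho_j=\rho,$$ where $\int_{\mu\Delta_{|D|}}d\omega\prod_{i\in D}\nu^{(\mu_i)}$ denotes the measure $A\mapsto\int_{\mu\Delta_{|D|}}\big(\prod_{i\in D}\nu^{(\mu_i)}\big)(A)\,d\omega$ on $\mathcal T^D$. -/

import Mathlib

open MeasureTheory ProbabilityTheory Filter Topology
open scoped ENNReal

/-- A rooted planar tree, finite or infinite but locally finite, whose root `i₀` has exactly one
offspring `i₁`. The vertices other than the root are labelled in the usual way by words over `ℕ`:
the vertex `i₁` is the empty word, and the offspring of the vertex `w`, from left to right, are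
`w ++ [0]`, `w ++ [1]`, and so on up to the number of offspring of `w`. The root `i₀` and the root
edge `{i₀, i₁}` are always there, so they are not recorded. Two planar trees are equal (up to order
preserving isomorphism) if and only if they have the same set of words. -/
@[ext]
structure PlanarTree where
  /-- the vertices other than the root -/
  verts : Set (List ℕ)
  nil_mem : [] ∈ verts
  parent_mem : ∀ w k, w ++ [k] ∈ verts → w ∈ verts
  left_mem : ∀ w j k, j < k → w ++ [k] ∈ verts → w ++ [j] ∈ verts
  finite_offspring : ∀ w, {k | w ++ [k] ∈ verts}.Finite

namespace PlanarTree

/-- The height of a non-root vertex, i.e. its graph distance to the root `i₀`. -/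
def vertexHeight (w : List ℕ) : ℕ := w.length + 1

/-- `D_r(T)` for `r ≥ 1`: the set of vertices at height `r`. -/
def level (T : PlanarTree) (r : ℕ) : Set (List ℕ) := {w ∈ T.verts | vertexHeight w = r}

/-- The (non-root) vertices of the ball `B_r(T)` of radius `r` around the root. -/
def ball (T : PlanarTree) (r : ℕ) : Set (List ℕ) := {w ∈ T.verts | vertexHeight w ≤ r}

/-- `T` is a finite tree. -/
def IsFinite (T : PlanarTree) : Prop := T.verts.Finite

/-- The size `|T|` of a finite tree, i.e. the number of its edges. Every non-root vertex
corresponds to the edge that joins it to its parent. -/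
noncomputable def size (T : PlanarTree) : ℕ := T.verts.ncard

/-- The height `h(T)`: the maximal height of a vertex (`⊤` for infinite trees). -/
noncomputable def height (T : PlanarTree) : ℕ∞ := ⨆ w ∈ T.verts, (vertexHeight w : ℕ∞)

/-! ### The metric space of planar trees -/

theorem ball_eq_of_le {T T' : PlanarTree} {r s : ℕ} (h : s ≤ r) (hr : T.ball r = T'.ball r) :
    T.ball s = T'.ball s := by
  ext w
  have := Set.ext_iff.1 hr w
  simp only [ball, Set.mem_ofPred_eq] at this ⊢
  constructor
  · rintro ⟨h1, h2⟩
    exact ⟨(this.1 ⟨h1, h2.trans h⟩).1, h2⟩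
  · rintro ⟨h1, h2⟩
    exact ⟨(this.2 ⟨h1, h2.trans h⟩).1, h2⟩

theorem ball_one (T : PlanarTree) : T.ball 1 = {[]} := by
  ext w
  simp only [ball, vertexHeight, Set.mem_ofPred_eq, Set.mem_singleton_iff]
  constructor
  · rintro ⟨_, h⟩
    exact List.length_eq_zero_iff.1 (by omega)
  · rintro rfl
    exact ⟨T.nil_mem, by simp⟩

/-- The numbers `1 / r` for those `r ≥ 1` for which the balls of radius `r` of both trees agree. -/
def distSet (T T' : PlanarTree) : Set ℝ :=
  {x | ∃ r : ℕ, 1 ≤ r ∧ T.ball r = T'.ball r ∧ x = 1 / (r : ℝ)}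

theorem distSet_nonempty (T T' : PlanarTree) : (distSet T T').Nonempty :=
  ⟨1, 1, le_rfl, by rw [ball_one, ball_one], by simp⟩

theorem distSet_nonneg {T T' : PlanarTree} {x : ℝ} (hx : x ∈ distSet T T') : 0 ≤ x := by
  obtain ⟨r, _, _, rfl⟩ := hx
  positivity

theorem distSet_bddBelow (T T' : PlanarTree) : BddBelow (distSet T T') :=
  ⟨0, fun _ hx => distSet_nonneg hx⟩

theorem distSet_comm (T T' : PlanarTree) : distSet T T' = distSet T' T := by
  ext x
  simp only [distSet, Set.mem_ofPred_eq, eq_comm (a := T.ball _)]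

/-- `dist(T, T') = inf {1 / r | r ∈ {1, 2, …}, B_r(T) = B_r(T')}`. -/
noncomputable instance : MetricSpace PlanarTree where
  dist T T' := sInf (distSet T T')
  dist_self T := by
    refine le_antisymm (le_of_forall_pos_le_add fun ε hε => ?_)
      (le_csInf (distSet_nonempty T T) fun _ => distSet_nonneg)
    obtain ⟨n, hn⟩ := exists_nat_one_div_lt hε
    have : sInf (distSet T T) ≤ 1 / ((n : ℝ) + 1) :=
      csInf_le (distSet_bddBelow T T) ⟨n + 1, by omega, rfl, by push_cast; rfl⟩
    linarith
  dist_comm T T' := by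
    rw [distSet_comm]
  dist_triangle T T' T'' := by
    refine le_of_forall_pos_le_add fun ε hε => ?_
    obtain ⟨x, ⟨r, hr1, hr, rfl⟩, hx⟩ := exists_lt_of_csInf_lt (distSet_nonempty T T')
      (lt_add_of_pos_right (sInf (distSet T T')) (half_pos hε))
    obtain ⟨y, ⟨s, hs1, hs, rfl⟩, hy⟩ := exists_lt_of_csInf_lt (distSet_nonempty T' T'')
      (lt_add_of_pos_right (sInf (distSet T' T'')) (half_pos hε))
    have hr0 : (0 : ℝ) ≤ 1 / (r : ℝ) := by positivity
    have hs0 : (0 : ℝ) ≤ 1 / (s : ℝ) := by positivity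
    rcases le_total r s with h | h
    · have : sInf (distSet T T'') ≤ 1 / (r : ℝ) :=
        csInf_le (distSet_bddBelow T T'') ⟨r, hr1, hr.trans (ball_eq_of_le h hs), rfl⟩
      linarith
    · have : sInf (distSet T T'') ≤ 1 / (s : ℝ) :=
        csInf_le (distSet_bddBelow T T'') ⟨s, hs1, (ball_eq_of_le h hr).trans hs, rfl⟩
      linarith
  eq_of_dist_eq_zero {T T'} h := by
    have key : ∀ R : ℕ, T.ball (R + 1) = T'.ball (R + 1) := by
      intro R
      have h0 : sInf (distSet T T') < 1 / ((R : ℝ) + 1) := by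
        have h' : sInf (distSet T T') = 0 := h
        rw [h']; positivity
      obtain ⟨x, ⟨r, hr1, hr, rfl⟩, hx⟩ := exists_lt_of_csInf_lt (distSet_nonempty T T') h0
      refine ball_eq_of_le ?_ hr
      have hr' : (0 : ℝ) < r := by exact_mod_cast hr1
      have := (one_div_lt_one_div hr' (by positivity)).1 hx
      exact_mod_cast this.le
    ext w
    have := Set.ext_iff.1 (key w.length) w
    simpa [ball, vertexHeight] using this

noncomputable instance : MeasurableSpace PlanarTree := borel PlanarTree

instance : BorelSpace PlanarTree := ⟨rfl⟩

/-! ### Levels are finite; grafting -/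

theorem finite_level (T : PlanarTree) (r : ℕ) : (T.level r).Finite := by
  induction r with
  | zero =>
    convert Set.finite_empty
    ext w
    simp [level, vertexHeight]
  | succ r ih =>
    refine (((ih.biUnion (t := fun w => (fun k => w ++ [k]) '' {k | w ++ [k] ∈ T.verts})
      fun w _ => (T.finite_offspring w).image _)).union (Set.finite_singleton [])).subset ?_
    rintro w ⟨hw, hl⟩
    rcases List.eq_nil_or_concat' w with rfl | ⟨u, k, rfl⟩
    · right; simp
    · left
      simp only [Set.mem_iUnion]
      refine ⟨u, ⟨T.parent_mem u k hw, ?_⟩, k, hw, rfl⟩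
      simp only [vertexHeight, List.length_append, List.length_cons, List.length_nil] at hl ⊢
      omega

noncomputable instance (T : PlanarTree) (r : ℕ) : Fintype (T.level r) :=
  (T.finite_level r).fintype

/-- The tree obtained by grafting, for every vertex `i` of `T₀` at height `r`, the tree `S i` onto
`T₀` at `i`: the root edge of `S i` is identified with the edge from the parent of `i` to `i`. It is
used only with `r` the height of `T₀`, so that the vertices `i` are leaves. -/
def graft (T₀ : PlanarTree) (r : ℕ) (S : T₀.level r → PlanarTree) : PlanarTree where
  verts := T₀.verts ∪ {w | ∃ i : T₀.level r, ∃ u ∈ (S i).verts, w = i.1 ++ u}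
  nil_mem := Or.inl T₀.nil_mem
  parent_mem := by
    rintro w k (h | ⟨i, u, hu, h⟩)
    · exact Or.inl (T₀.parent_mem w k h)
    · rcases List.eq_nil_or_concat' u with rfl | ⟨v, l, rfl⟩
      · rw [List.append_nil] at h
        exact Or.inl (T₀.parent_mem w k (h ▸ i.2.1))
      · rw [← List.append_assoc] at h
        obtain ⟨rfl, _⟩ := List.append_inj' h rfl
        exact Or.inr ⟨i, v, (S i).parent_mem v l hu, rfl⟩
  left_mem := by
    rintro w j k hjk (h | ⟨i, u, hu, h⟩)
    · exact Or.inl (T₀.left_mem w j k hjk h)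
    · rcases List.eq_nil_or_concat' u with rfl | ⟨v, l, rfl⟩
      · rw [List.append_nil] at h
        exact Or.inl (T₀.left_mem w j k hjk (h ▸ i.2.1))
      · rw [← List.append_assoc] at h
        obtain ⟨rfl, hl⟩ := List.append_inj' h rfl
        obtain rfl : k = l := by simpa using hl
        exact Or.inr ⟨i, v ++ [j], (S i).left_mem v j k hjk hu, by simp⟩
  finite_offspring := by
    intro w
    refine ((T₀.finite_offspring w).union (Set.finite_iUnion fun i : T₀.level r =>
      (S i).finite_offspring (w.drop i.1.length))).subset ?_
    rintro k (h | ⟨i, u, hu, h⟩)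
    · exact Or.inl h
    · rcases List.eq_nil_or_concat' u with rfl | ⟨v, l, rfl⟩
      · rw [List.append_nil] at h
        exact Or.inl (show w ++ [k] ∈ T₀.verts from h ▸ i.2.1)
      · rw [← List.append_assoc] at h
        obtain ⟨rfl, hl⟩ := List.append_inj' h rfl
        obtain rfl : k = l := by simpa using hl
        refine Or.inr (Set.mem_iUnion.2 ⟨i, ?_⟩)
        simpa using hu

/-! ### Trees of fixed size and the finite size measures -/

/-- `𝒯_N`: the set of planar trees of size `N`. -/
def ofSize (N : ℕ) : Set PlanarTree := {T | T.IsFinite ∧ T.size = N}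

theorem take_mem (T : PlanarTree) {w : List ℕ} (hw : w ∈ T.verts) (i : ℕ) : w.take i ∈ T.verts := by
  induction w using List.reverseRecOn with
  | nil => simpa using hw
  | append_singleton u k ih =>
    rcases le_or_gt i u.length with h | h
    · rw [List.take_append_of_le_length h]
      exact ih (T.parent_mem u k hw)
    · rw [List.take_of_length_le (by simp; omega)]
      exact hw

theorem length_lt_size {T : PlanarTree} (hT : T.IsFinite) {w : List ℕ} (hw : w ∈ T.verts) :
    w.length < T.size := by
  have hsub : (fun i => w.take i) '' Set.Iio (w.length + 1) ⊆ T.verts := by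
    rintro _ ⟨i, _, rfl⟩
    exact T.take_mem hw i
  have hinj : Set.InjOn (fun i => w.take i) (Set.Iio (w.length + 1)) := by
    intro i hi j hj hij
    have := congrArg List.length hij
    simp only [List.length_take, Set.mem_Iio] at this hi hj
    omega
  have := Set.ncard_le_ncard hsub hT
  rw [hinj.ncard_image, Set.ncard_Iio_nat] at this
  exact this

theorem letter_lt_size {T : PlanarTree} (hT : T.IsFinite) {w : List ℕ} (hw : w ∈ T.verts)
    {k : ℕ} (hk : k ∈ w) : k < T.size := by
  obtain ⟨u, v, rfl⟩ := List.append_of_mem hk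
  have h1 : u ++ [k] ∈ T.verts := by
    have := T.take_mem hw (u.length + 1)
    rwa [List.take_append, List.take_of_length_le (by omega), Nat.add_sub_cancel_left] at this
  have hsub : (fun i => u ++ [i]) '' Set.Iio (k + 1) ⊆ T.verts := by
    rintro _ ⟨i, hi, rfl⟩
    rcases Nat.lt_succ_iff_lt_or_eq.1 hi with h | rfl
    · exact T.left_mem u i k h h1
    · exact h1
  have hinj : Set.InjOn (fun i => u ++ [i]) (Set.Iio (k + 1)) := by
    intro i _ j _ hij
    simpa using hij
  have := Set.ncard_le_ncard hsub hT
  rw [hinj.ncard_image, Set.ncard_Iio_nat] at this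
  exact this

theorem finite_ofSize (N : ℕ) : (ofSize N).Finite := by
  have hF : {w : List ℕ | w.length < N ∧ ∀ k ∈ w, k < N}.Finite := by
    refine ((List.finite_length_lt (Fin N) N).image (List.map Fin.val)).subset ?_
    rintro w ⟨h1, h2⟩
    refine ⟨w.pmap (fun k hk => ⟨k, hk⟩) h2, by simpa using h1, ?_⟩
    rw [List.map_pmap]
    simp
  refine Set.Finite.of_finite_image (f := verts) (hF.finite_subsets.subset ?_)
    (fun T _ T' _ h => PlanarTree.ext h)
  rintro _ ⟨T, ⟨hT, rfl⟩, rfl⟩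
  exact fun w hw => ⟨length_lt_size hT hw, fun k hk => letter_lt_size hT hw hk⟩

noncomputable instance (N : ℕ) : Fintype (ofSize N) := (finite_ofSize N).fintype

/-- The linear tree with `n + 1` edges. -/
def path (n : ℕ) : PlanarTree where
  verts := (fun i => List.replicate i 0) '' Set.Iio (n + 1)
  nil_mem := ⟨0, by simp, rfl⟩
  parent_mem := by
    rintro w k ⟨i, hi, h⟩
    rcases i with _ | i
    · simp at h
    · replace h : List.replicate (i + 1) 0 = w ++ [k] := h
      rw [List.replicate_succ'] at h
      obtain ⟨rfl, _⟩ := List.append_inj' h rfl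
      exact ⟨i, (Nat.lt_succ_self i).trans hi, rfl⟩
  left_mem := by
    rintro w j k hjk ⟨i, hi, h⟩
    have : k ∈ List.replicate i 0 := by
      rw [show List.replicate i 0 = w ++ [k] from h]; simp
    have := List.eq_of_mem_replicate this
    omega
  finite_offspring := by
    intro w
    refine (Set.finite_singleton 0).subset ?_
    rintro k ⟨i, hi, h⟩
    have : k ∈ List.replicate i 0 := by
      rw [show List.replicate i 0 = w ++ [k] from h]; simp
    exact List.eq_of_mem_replicate this

theorem path_mem_ofSize (n : ℕ) : path n ∈ ofSize (n + 1) := by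
  refine ⟨(Set.finite_Iio _).image _, ?_⟩
  have hinj : Function.Injective fun i => List.replicate i (0 : ℕ) := by
    intro i j h
    simpa using congrArg List.length h
  rw [size, path, Set.ncard_image_of_injective _ hinj, Set.ncard_Iio_nat]

instance : Inhabited PlanarTree := ⟨path 0⟩

/-- The finite size partition function `Z_N^{(μ)} = ∑_{T ∈ 𝒯_N} e^{-μ h(T)}`. -/
noncomputable def partitionFunction (μ : ℝ) (N : ℕ) : ℝ :=
  ∑ T : ofSize N, Real.exp (-μ * (T.1.height.toNat : ℝ))

theorem partitionFunction_pos (μ : ℝ) (N : ℕ+) : 0 < partitionFunction μ N := by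
  obtain ⟨n, hn⟩ := Nat.exists_eq_succ_of_ne_zero N.ne_zero
  refine Finset.sum_pos (fun _ _ => Real.exp_pos _) ⟨⟨path n, ?_⟩, Finset.mem_univ _⟩
  rw [hn]
  exact path_mem_ofSize n

/-- The probability measure `ν_N^{(μ)}` on planar trees, supported on `𝒯_N`, with
`ν_N^{(μ)}(T) = e^{-μ h(T)} / Z_N^{(μ)}` for `T ∈ 𝒯_N`. -/
noncomputable def finiteSizeLaw (μ : ℝ) (N : ℕ+) : ProbabilityMeasure PlanarTree :=
  ⟨∑ T : ofSize N, ENNReal.ofReal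
      (Real.exp (-μ * (T.1.height.toNat : ℝ)) / partitionFunction μ N) • Measure.dirac T.1, by
    constructor
    have hZ := partitionFunction_pos μ N
    simp only [Measure.coe_finsetSum, Finset.sum_apply, Measure.smul_apply, measure_univ,
      smul_eq_mul, mul_one]
    rw [← ENNReal.ofReal_sum_of_nonneg (fun _ _ => by positivity), ← Finset.sum_div]
    change ENNReal.ofReal (partitionFunction μ N / partitionFunction μ N) = 1
    rw [div_self hZ.ne', ENNReal.ofReal_one]⟩

/-- The local limit `ν^{(μ)}`: the weak limit of `ν_N^{(μ)}` as `N → ∞` (a junk value if that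
limit does not exist). -/
noncomputable def localLimit (μ : ℝ) : ProbabilityMeasure PlanarTree :=
  limUnder atTop (finiteSizeLaw μ)

/-! ### Bienaymé-Galton-Watson trees -/

/-- The planar tree in which every vertex `u` that occurs has `ξ u` offspring. -/
def ofOffspring (ξ : List ℕ → ℕ) : PlanarTree where
  verts := {w | ∀ u k, (u ++ [k]) <+: w → k < ξ u}
  nil_mem := by
    intro u k h
    simp at h
  parent_mem := fun w k h u l hu => h u l (hu.trans (List.prefix_append w [k]))
  left_mem := by
    intro w j k hjk h u l hu
    rcases List.prefix_concat_iff.1 hu with hu | hu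
    · obtain ⟨rfl, hl⟩ := List.append_inj' hu rfl
      obtain rfl : l = j := by simpa using hl
      exact hjk.trans (h u k List.prefix_rfl)
    · exact h u l (hu.trans (List.prefix_append w [k]))
  finite_offspring := fun w =>
    (Set.finite_Iio (ξ w)).subset fun k hk => hk w k List.prefix_rfl

/-- The law of the Bienaymé-Galton-Watson tree with offspring distribution `p`: the numbers of
offspring of all individuals (`i₁` being the first one) are independent with law `p`. -/
noncomputable def bgw (p : PMF ℕ) : Measure PlanarTree :=
  (Measure.infinitePi fun _ : List ℕ => p.toMeasure).map ofOffspring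

/-- The offspring distribution `p_n = 2^{-(n+1)}`. -/
noncomputable def criticalOffspring : PMF ℕ :=
  ⟨fun n => (2⁻¹ : ℝ≥0∞) ^ (n + 1), by
    have h := ENNReal.tsum_geometric_add_one (2⁻¹ : ℝ≥0∞)
    rw [ENNReal.one_sub_inv_two, inv_inv, ENNReal.inv_mul_cancel (by simp) (by simp)] at h
    exact h ▸ ENNReal.summable.hasSum⟩

/-- The critical Bienaymé-Galton-Watson measure `ρ`. -/
noncomputable def rho : Measure PlanarTree := bgw criticalOffspring

/-! ### The simplex and mixtures of product measures -/

/-- The open simplex `μ · Δ_n`, with coordinates indexed by a finite type `ι` with `n` elements. -/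
def simplex (ι : Type*) [Fintype ι] (μ : ℝ) : Set (ι → ℝ) := {m | ∑ i, m i = μ ∧ ∀ i, 0 < m i}

/-- The normalised Lebesgue measure `dω` on `μ · Δ_n`: the `(n - 1)`-dimensional Hausdorff measure
conditioned on the simplex. (On a hyperplane the Hausdorff measure is a translation invariant, so
the Lebesgue measure up to a constant factor, which the normalisation removes.) -/
noncomputable def simplexMeasure (ι : Type*) [Fintype ι] (μ : ℝ) : Measure (ι → ℝ) :=
  ProbabilityTheory.cond (Measure.hausdorffMeasure ((Fintype.card ι : ℝ) - 1)) (simplex ι μ)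

/-- The measure `A ↦ ∫_{μ·Δ_n} (∏_i ν^{(m_i)})(A) dω(m)` on `𝒯^ι`, where `n` is the number of
elements of `ι`. -/
noncomputable def simplexMixture (ι : Type*) [Fintype ι] (μ : ℝ) : Measure (ι → PlanarTree) :=
  (simplexMeasure ι μ).bind fun m =>
    Measure.pi fun i => (localLimit (m i) : Measure PlanarTree)

open scoped Classical in
/-- For a subset `D` of a finite index set `ι`, the product measure
`(∫_{μ·Δ_{|D|}} dω ∏_{i ∈ D} ν^{(μ_i)}) × ∏_{j ∉ D} ρ` on `𝒯^ι = 𝒯^D × 𝒯^{ι ∖ D}`. -/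
noncomputable def component {ι : Type*} [Fintype ι] (μ : ℝ) (D : Finset ι) :
    Measure (ι → PlanarTree) :=
  ((simplexMixture {i // i ∈ D} μ).prod (Measure.pi fun _ : {i // i ∉ D} => rho)).map
    (MeasurableEquiv.piEquivPiSubtypeProd (fun _ : ι => PlanarTree) (· ∈ D)).symm

end PlanarTree

/-! Trees of size `n` and height at most `m` correspond to excursions in a strip. Their generating
function in the variable `X / 4` is therefore a ratio of walk series on a finite path, with an
explicit spectral form: for `M = m + 1` the coefficients are sums of `sin² (kπ/M) cos²ⁿ (kπ/M)`
(`IsHeightSeries.coeff_succ`). Since `e^{-μh} = (1 - e^{-μ}) ∑_{m ≥ h} e^{-μm}`, grafting expresses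
the `ν_N`-mass of a ball with `K` top vertices through the sums `∑_m e^{-μm} [X^N] Q_m^K`
(`sum_exp_height_treesIn`).

The terms of these sums behave like `exp (-μM - π²N/M²)` and concentrate where `N/M³` is close to `s
= μ/(2π²)`. There, after rescaling by the top rate `cos² (π/M)`, the series `Q_m` equals `E + b (X +
X² + ⋯)`. Here `b ~ π²/M³`, so that `bN → μ/2`, and the mass of `E` tends to `1/2` and sits on
indices `o(N)`. Choosing the `j + 1` factors among `K` that share the macroscopic size gives `(K
choose j+1) (1/2)^{K-1-j} (μ/2)^j / j!`. The sum over `j` is `2^{1-K} p_K(μ)` with `p_K = spinePoly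
K` (`IsHeightSeries.tendsto_heightSum_div`).

The limiting probability of a cylinder is thus its `ρ`-probability times `e^{-nμ} p_W(μ)`, where `W`
is the number of vertices at height `n + 1`. One generation of critical branching multiplies
`p_W(μ)` by `e^μ` in the mean (`tsum_prod_mul_spinePoly`). The limiting weights are therefore those
of an h-transform of `ρ`, realised as the probability measure `spineTreeLaw`. No mass escapes, and
convergence on cylinders is weak convergence (`tendsto_finiteSizeLaw`).

The formula on balls rests on the convolution identity `δ + p_{L+M} = (δ + p_L) * (δ + p_M)`
(`ofReal_spinePoly_add`). Iterating it expands `p_{∑ l_i}` into simplex integrals over subsets `D`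
(`sum_subsetIntegral`). Hence both sides agree on cylinders, which form a generating π-system
(`restrict_localLimit_closedBall`). -/

namespace PlanarTree

/-! ### Trees of bounded height: the closed form of the generating functions -/

/-- A sequence of power series that satisfies the recursion of the generating functions, in the
indeterminate `X / 4`, of planar trees of height at most `m`. -/
structure IsHeightSeries (Q : ℕ → PowerSeries ℝ) : Prop where
  zero : Q 0 = 0
  succ : ∀ m, Q (m + 1) * (1 - Q m) = PowerSeries.C (1 / 4 : ℝ) * PowerSeries.X

/-- The weight of the walks with `n` steps from `1` to `j` on the path with vertices
`1, …, M - 1`, every step having weight `1 / 2`. -/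
noncomputable def walkWeight (M j n : ℕ) : ℝ :=
  2 / M * ∑ k ∈ Finset.range M,
    Real.sin (k * Real.pi / M) * Real.sin (j * (k * Real.pi / M)) * Real.cos (k * Real.pi / M) ^ n

theorem walkWeight_self {M : ℕ} (hM : M ≠ 0) (n : ℕ) : walkWeight M M n = 0 := by
  have h (k : ℕ) : Real.sin (M * (k * Real.pi / M)) = 0 := by
    rw [mul_div_cancel₀ _ (by exact_mod_cast hM)]
    exact Real.sin_nat_mul_pi k
  simp [walkWeight, h]

/-- For fixed `t`, the function `j ↦ sin (jt)` is an eigenfunction of the average over the two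
neighbours, with eigenvalue `cos t`. At `t = kπ/M` it also vanishes at the absorbing ends `0` and
`M`. -/
theorem walkWeight_succ (M j n : ℕ) :
    walkWeight M (j + 1) (n + 1) = 1 / 2 * (walkWeight M j n + walkWeight M (j + 2) n) := by
  simp only [walkWeight]
  rw [← mul_add, mul_left_comm (1 / 2 : ℝ), ← Finset.sum_add_distrib,
      Finset.mul_sum (a := (1 / 2 : ℝ))]
  congr 1
  refine Finset.sum_congr rfl fun k _ => ?_
  set t := (k : ℝ) * Real.pi / M
  have h1 : Real.sin (((j + 2 : ℕ) : ℝ) * t) = Real.sin (((j + 1 : ℕ) : ℝ) * t) * Real.cos t +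
      Real.cos (((j + 1 : ℕ) : ℝ) * t) * Real.sin t := by
    rw [← Real.sin_add]; push_cast; ring_nf
  have h2 : Real.sin ((j : ℝ) * t) = Real.sin (((j + 1 : ℕ) : ℝ) * t) * Real.cos t -
      Real.cos (((j + 1 : ℕ) : ℝ) * t) * Real.sin t := by
    rw [← Real.sin_sub]; push_cast; ring_nf
  rw [h1, h2]; ring

/-- Multiplication by `2 sin (lπ/(2M))`, nonzero because `0 < l < 2M`, makes the sum telescope. The
value depends only on the parity of `l`, which is what makes the sums for `l` and `l + 2` cancel
later. -/
theorem sum_range_cos_eq {M l : ℕ} (hl : 0 < l) (hlM : l < 2 * M) :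
    ∑ k ∈ Finset.range M, Real.cos (l * (k * Real.pi / M)) = (1 - (-1) ^ l) / 2 := by
  have hM : (M : ℝ) ≠ 0 := by
    have : M ≠ 0 := by omega
    exact_mod_cast this
  set a : ℝ := l * Real.pi / (2 * M) with ha
  have hMpos : (0 : ℝ) < M := lt_of_le_of_ne (by positivity) hM.symm
  have hsin : Real.sin a ≠ 0 := by
    refine (Real.sin_pos_of_pos_of_lt_pi ?_ ?_).ne'
    · have : (0 : ℝ) < l := by exact_mod_cast hl
      positivity
    · have : (l : ℝ) < 2 * M := by exact_mod_cast hlM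
      rw [ha, div_lt_iff₀ (by positivity)]
      nlinarith [Real.pi_pos]
  have key (n : ℕ) : ∑ k ∈ Finset.range n, 2 * Real.sin a * Real.cos (l * (k * Real.pi / M)) =
      Real.sin ((2 * n - 1) * a) + Real.sin a := by
    induction n with
    | zero => simp
    | succ n ih =>
      rw [Finset.sum_range_succ, ih]
      have e : (l : ℝ) * (n * Real.pi / M) = 2 * n * a := by rw [ha]; field_simp
      rw [e]
      have e1 : (2 * ((n + 1 : ℕ) : ℝ) - 1) * a = 2 * n * a + a := by push_cast; ring
      have e2 : (2 * (n : ℝ) - 1) * a = 2 * n * a - a := by ring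
      rw [e1, e2, Real.sin_add, Real.sin_sub]; ring
  have h := key M
  rw [← Finset.mul_sum] at h
  have e3 : (2 * (M : ℝ) - 1) * a = l * Real.pi - a := by rw [ha]; field_simp
  rw [e3, Real.sin_sub, Real.sin_nat_mul_pi, Real.cos_nat_mul_pi] at h
  have h' : 2 * Real.sin a * ∑ k ∈ Finset.range M, Real.cos (l * (k * Real.pi / M)) =
      2 * Real.sin a * ((1 - (-1) ^ l) / 2) := by rw [h]; ring
  exact mul_left_cancel₀ (mul_ne_zero two_ne_zero hsin) h'

/-- Orthogonality of the eigenvectors: the product of sines is a difference of cosines with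
frequencies `j - 1` and `j + 1` of equal parity. Their sums cancel unless the first frequency is
`0`. -/
theorem walkWeight_zero {M : ℕ} {j : ℕ} (hj : 1 ≤ j) (hjM : j < M) :
    walkWeight M j 0 = if j = 1 then 1 else 0 := by
  have hM : (M : ℝ) ≠ 0 := by
    have : M ≠ 0 := by omega
    exact_mod_cast this
  obtain ⟨i, rfl⟩ := Nat.exists_eq_add_of_le' hj
  have h (k : ℕ) : Real.sin (k * Real.pi / M) * Real.sin (((i + 1 : ℕ) : ℝ) * (k * Real.pi / M)) =
      (Real.cos ((i : ℕ) * (k * Real.pi / M)) -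
        Real.cos ((i + 2 : ℕ) * (k * Real.pi / M))) / 2 := by
    set t := (k : ℝ) * Real.pi / M
    have h1 : Real.cos (((i + 2 : ℕ) : ℝ) * t) = Real.cos (((i + 1 : ℕ) : ℝ) * t) * Real.cos t -
        Real.sin (((i + 1 : ℕ) : ℝ) * t) * Real.sin t := by
      rw [← Real.cos_add]; push_cast; ring_nf
    have h2 : Real.cos ((i : ℝ) * t) = Real.cos (((i + 1 : ℕ) : ℝ) * t) * Real.cos t +
        Real.sin (((i + 1 : ℕ) : ℝ) * t) * Real.sin t := by
      rw [← Real.cos_sub]; push_cast; ring_nf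
    rw [h1, h2]; ring
  simp only [walkWeight, pow_zero, mul_one, h]
  rw [← Finset.sum_div, Finset.sum_sub_distrib, sum_range_cos_eq (l := i + 2) (by omega) (by omega)]
  rcases Nat.eq_zero_or_pos i with rfl | hi
  · simp only [Nat.cast_zero, zero_mul, Real.cos_zero]
    simp [hM]
  · rw [sum_range_cos_eq hi (by omega), if_neg (by omega)]
    simp [pow_add]

/-- A walk from `1` cannot pass beyond `n + 1` in `n` steps. -/
theorem walkWeight_eq_zero {M j n : ℕ} (hn : n + 1 < j) (hj : j ≤ M) : walkWeight M j n = 0 := by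
  induction n generalizing j with
  | zero =>
    rcases hj.lt_or_eq with h | rfl
    · rw [walkWeight_zero (by omega) h, if_neg (by omega)]
    · exact walkWeight_self (by omega) 0
  | succ n ih =>
    rcases hj.lt_or_eq with h | rfl
    · obtain ⟨i, rfl⟩ : ∃ i, j = i + 1 := ⟨j - 1, by omega⟩
      rw [walkWeight_succ, ih (by omega) (by omega), ih (by omega) (by omega)]; simp
    · exact walkWeight_self (by omega) _

/-- The generating function of the weights `walkWeight`. -/
noncomputable def walkSeries (M j : ℕ) : PowerSeries ℝ :=
  PowerSeries.mk fun i => walkWeight M (j + 1) (2 * i + j)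

/-- Removal of the last step of the walk. By parity a walk from `1` to `j + 1` has `2i + j` steps,
and `X` marks `i`; the neighbour `0` contributes nothing. -/
theorem walkSeries_zero {M : ℕ} (hM : 2 ≤ M) :
    walkSeries M 0 = 1 + PowerSeries.C (1 / 2 : ℝ) * (PowerSeries.X * walkSeries M 1) := by
  ext i
  rcases i with _ | i
  · simp [walkSeries, walkWeight_zero le_rfl (show 1 < M by omega)]
  · rw [map_add, PowerSeries.coeff_C_mul, PowerSeries.coeff_succ_X_mul]
    simp only [walkSeries, PowerSeries.coeff_mk, PowerSeries.coeff_one]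
    rw [show 2 * (i + 1) + 0 = (2 * i + 1) + 1 by ring, walkWeight_succ]
    simp [walkWeight]

theorem walkSeries_succ {M j : ℕ} (hj : j + 2 < M) :
    walkSeries M (j + 1) = PowerSeries.C (1 / 2 : ℝ) * walkSeries M j +
      PowerSeries.C (1 / 2 : ℝ) * (PowerSeries.X * walkSeries M (j + 2)) := by
  ext i
  rw [map_add, PowerSeries.coeff_C_mul, PowerSeries.coeff_C_mul]
  rcases i with _ | i
  · simp only [walkSeries, PowerSeries.coeff_mk, PowerSeries.coeff_zero_X_mul, mul_zero, zero_add]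
    rw [walkWeight_succ, walkWeight_eq_zero (j := j + 1 + 2) (by omega) (by omega)]
    ring
  · rw [PowerSeries.coeff_succ_X_mul]
    simp only [walkSeries, PowerSeries.coeff_mk]
    rw [show 2 * (i + 1) + (j + 1) = (2 * (i + 1) + j) + 1 by ring, walkWeight_succ]
    rw [show 2 * i + (j + 2) = 2 * (i + 1) + j by ring]
    ring

/-! ### The height series as quotients of walk series -/

namespace IsHeightSeries

variable {Q : ℕ → PowerSeries ℝ}

/-- The quotients of consecutive walk series, read from the absorbing end `m + 1` downwards, satisfy
the same continued fraction recursion as `Q`, and both start from `0`. -/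
theorem X_mul_walkSeries (hQ : IsHeightSeries Q) {m i : ℕ} (hi : i < m) :
    PowerSeries.C (1 / 2 : ℝ) * (PowerSeries.X * walkSeries (m + 1) (m - i)) =
      Q i * walkSeries (m + 1) (m - i - 1) := by
  induction i with
  | zero =>
    have : walkSeries (m + 1) m = 0 := by
      ext i
      simp [walkSeries, walkWeight_self]
    simp [this, hQ.zero]
  | succ i ih =>
    have h := ih (by omega)
    obtain ⟨j, hj⟩ : ∃ j, m = j + i + 2 := ⟨m - i - 2, by omega⟩
    rw [show m - i = j + 2 by omega, show j + 2 - 1 = j + 1 by omega] at h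
    rw [show m - (i + 1) = j + 1 by omega, show j + 1 - 1 = j by omega]
    have h2 := walkSeries_succ (M := m + 1) (j := j) (by omega)
    rw [h] at h2
    have h3 := hQ.succ i
    have hC : PowerSeries.C (1 / 4 : ℝ) = PowerSeries.C (1 / 2 : ℝ) *
        PowerSeries.C (1 / 2 : ℝ) := by
      rw [← map_mul]; norm_num
    rw [hC] at h3
    have hC2 : (2 : PowerSeries ℝ) * PowerSeries.C (1 / 2 : ℝ) = 1 := by
      rw [show (2 : PowerSeries ℝ) = PowerSeries.C (2 : ℝ) from (map_ofNat _ 2).symm, ← map_mul]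
      norm_num
    -- With `W` the walk series, `h2` now reads `(1 - Q i) W_{j+1} = W_j / 2`. Multiplying by `Q (i
    -- + 1)` and using the recursion for `Q` gives the claim up to the factor `2`.
    linear_combination 2 * Q (i + 1) * h2 - 2 * walkSeries (m + 1) (j + 1) * h3 +
      (Q (i + 1) * walkSeries (m + 1) j - PowerSeries.C (1 / 2 : ℝ) * PowerSeries.X *
        walkSeries (m + 1) (j + 1)) * hC2

theorem coeff_zero (hQ : IsHeightSeries Q) (m : ℕ) : PowerSeries.coeff 0 (Q m) = 0 := by
  induction m with
  | zero => simp [hQ.zero]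
  | succ m ih =>
    have := congrArg (PowerSeries.coeff 0) (hQ.succ m)
    simp only [PowerSeries.coeff_zero_eq_constantCoeff, map_mul, map_sub] at this ih ⊢
    simpa [ih] using this

/-- At the near end the relation reads `W_0 (1 - Q_{m-1}) = 1`, so `W_0` is the inverse that the
recursion for `Q_m` calls for. -/
theorem eq_X_mul (hQ : IsHeightSeries Q) {m : ℕ} (hm : 1 ≤ m) :
    Q m = PowerSeries.C (1 / 4 : ℝ) * (PowerSeries.X * walkSeries (m + 1) 0) := by
  obtain ⟨i, rfl⟩ := Nat.exists_eq_add_of_le' hm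
  have h := hQ.X_mul_walkSeries (m := i + 1) (i := i) (by omega)
  rw [show i + 1 - i = 1 by omega] at h
  have h2 := walkSeries_zero (M := i + 1 + 1) (by omega)
  rw [h] at h2
  have h3 := hQ.succ i
  linear_combination -Q (i + 1) * h2 + walkSeries (i + 1 + 1) 0 * h3

theorem coeff_succ (hQ : IsHeightSeries Q) (m n : ℕ) :
    PowerSeries.coeff (n + 1) (Q m) = 1 / (2 * ((m + 1 : ℕ) : ℝ)) *
      ∑ k ∈ Finset.range (m + 1), Real.sin (k * Real.pi / (m + 1 : ℕ)) ^ 2 *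
        (Real.cos (k * Real.pi / (m + 1 : ℕ)) ^ 2) ^ n := by
  rcases Nat.eq_zero_or_pos m with rfl | hm
  · simp [hQ.zero]
  · rw [hQ.eq_X_mul hm, PowerSeries.coeff_C_mul, PowerSeries.coeff_succ_X_mul]
    simp only [walkSeries, PowerSeries.coeff_mk, walkWeight]
    rw [← mul_assoc]
    congr 1
    · field_simp; norm_num
    · refine Finset.sum_congr rfl fun k _ => ?_
      rw [add_zero, zero_add, pow_mul, Nat.cast_one, one_mul]; ring

end IsHeightSeries

/-! ### Coefficients of powers of power series -/

/-- The sum of the coefficients of index at most `L`. -/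
noncomputable def coeffSum (F : PowerSeries ℝ) (L : ℕ) : ℝ :=
  ∑ n ∈ Finset.range (L + 1), PowerSeries.coeff n F

/-- All coefficients are nonnegative. -/
def CoeffNonneg (F : PowerSeries ℝ) : Prop := ∀ n, 0 ≤ PowerSeries.coeff n F

theorem coeff_mul_eq_sum_range (F G : PowerSeries ℝ) (n : ℕ) :
    PowerSeries.coeff n (F * G) =
      ∑ i ∈ Finset.range (n + 1), PowerSeries.coeff i F * PowerSeries.coeff (n - i) G := by
  rw [PowerSeries.coeff_mul, Finset.Nat.sum_antidiagonal_eq_sum_range_succ_mk]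

namespace CoeffNonneg

variable {F G : PowerSeries ℝ}

theorem mul (hF : CoeffNonneg F) (hG : CoeffNonneg G) : CoeffNonneg (F * G) := fun n => by
  rw [coeff_mul_eq_sum_range]
  exact Finset.sum_nonneg fun i _ => mul_nonneg (hF i) (hG _)

theorem one : CoeffNonneg 1 := fun n => by
  rw [PowerSeries.coeff_one]; split_ifs <;> norm_num

theorem pow (hF : CoeffNonneg F) (k : ℕ) : CoeffNonneg (F ^ k) := by
  induction k with
  | zero => simpa using one
  | succ k ih => rw [pow_succ]; exact ih.mul hF

theorem coeffSum_mono (hF : CoeffNonneg F) {L L' : ℕ} (h : L ≤ L') :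
    coeffSum F L ≤ coeffSum F L' :=
  Finset.sum_le_sum_of_subset_of_nonneg (Finset.range_subset_range.2 (by omega))
    fun i _ _ => hF i

theorem coeffSum_nonneg (hF : CoeffNonneg F) (L : ℕ) : 0 ≤ coeffSum F L :=
  Finset.sum_nonneg fun i _ => hF i

end CoeffNonneg

theorem coeffSum_mul (F G : PowerSeries ℝ) (L : ℕ) :
    coeffSum (F * G) L = ∑ i ∈ Finset.range (L + 1), PowerSeries.coeff i F *
        coeffSum G (L - i) := by
  simp only [coeffSum, coeff_mul_eq_sum_range, Finset.mul_sum]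
  rw [Finset.sum_sigma', Finset.sum_sigma']
  refine Finset.sum_bij' (fun x _ => ⟨x.2, x.1 - x.2⟩) (fun x _ => ⟨x.1 + x.2, x.1⟩) ?_ ?_ ?_ ?_ ?_
  · rintro ⟨a, b⟩ h
    simp only [Finset.mem_sigma, Finset.mem_range] at h ⊢
    omega
  · rintro ⟨a, b⟩ h
    simp only [Finset.mem_sigma, Finset.mem_range] at h ⊢
    omega
  · rintro ⟨a, b⟩ h
    simp only [Finset.mem_sigma, Finset.mem_range] at h
    have : b + (a - b) = a := by omega
    simp [this]
  · rintro ⟨a, b⟩ h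
    simp
  · rintro ⟨a, b⟩ h
    rfl

theorem CoeffNonneg.coeffSum_mul_le {F G : PowerSeries ℝ} (hF : CoeffNonneg F)
    (hG : CoeffNonneg G) (L : ℕ) : coeffSum (F * G) L ≤ coeffSum F L * coeffSum G L := by
  rw [coeffSum_mul, coeffSum, Finset.sum_mul]
  exact Finset.sum_le_sum fun i _ =>
    mul_le_mul_of_nonneg_left (hG.coeffSum_mono (Nat.sub_le _ _)) (hF i)

/-- Indices at most `L` and at most `L'` add up to at most `L + L'`. Together with
`CoeffNonneg.coeffSum_mul_le` this pins down the mass of a product whose factors are concentrated on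
small indices. -/
theorem CoeffNonneg.le_coeffSum_mul {F G : PowerSeries ℝ} (hF : CoeffNonneg F)
    (hG : CoeffNonneg G) (L L' : ℕ) :
    coeffSum F L * coeffSum G L' ≤ coeffSum (F * G) (L + L') := by
  rw [coeffSum_mul]
  calc coeffSum F L * coeffSum G L'
      = ∑ i ∈ Finset.range (L + 1), PowerSeries.coeff i F * coeffSum G L' := by
        rw [coeffSum, Finset.sum_mul]
    _ ≤ ∑ i ∈ Finset.range (L + 1), PowerSeries.coeff i F * coeffSum G (L + L' - i) := by
        refine Finset.sum_le_sum fun i hi => mul_le_mul_of_nonneg_left (hG.coeffSum_mono ?_) (hF i)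
        rw [Finset.mem_range] at hi; omega
    _ ≤ _ := by
        refine Finset.sum_le_sum_of_subset_of_nonneg (Finset.range_subset_range.2 (by omega))
          fun i _ _ => mul_nonneg (hF i) (hG.coeffSum_nonneg _)

theorem coeffSum_one (L : ℕ) : coeffSum 1 L = 1 := by
  simp [coeffSum, PowerSeries.coeff_one]

theorem CoeffNonneg.coeffSum_pow_le {F : PowerSeries ℝ} (hF : CoeffNonneg F) (k L : ℕ) :
    coeffSum (F ^ k) L ≤ coeffSum F L ^ k := by
  induction k with
  | zero => simp [coeffSum_one]
  | succ k ih =>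
    rw [pow_succ, pow_succ]
    exact ((hF.pow k).coeffSum_mul_le hF L).trans
      (mul_le_mul_of_nonneg_right ih (hF.coeffSum_nonneg L))

theorem CoeffNonneg.le_coeffSum_pow {F : PowerSeries ℝ} (hF : CoeffNonneg F) (k L : ℕ) :
    coeffSum F L ^ k ≤ coeffSum (F ^ k) (k * L) := by
  induction k with
  | zero => simp [coeffSum_one]
  | succ k ih =>
    rw [pow_succ, pow_succ, Nat.succ_mul]
    exact (mul_le_mul_of_nonneg_right ih (hF.coeffSum_nonneg L)).trans
      ((hF.pow k).le_coeffSum_mul hF _ _)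

theorem coeff_pow_le_of_le_geometric {F : PowerSeries ℝ} (hF : CoeffNonneg F) {c σ : ℝ}
    (hc : 0 ≤ c) (hσ : 0 ≤ σ) (h : ∀ n, PowerSeries.coeff n F ≤ c * σ ^ n) (k n : ℕ) :
    PowerSeries.coeff n (F ^ k) ≤ c ^ k * (n + 1) ^ k * σ ^ n := by
  induction k generalizing n with
  | zero =>
    rcases n with _ | n
    · simp
    · simp only [pow_zero, PowerSeries.coeff_one]; simp; positivity
  | succ k ih =>
    rw [pow_succ, coeff_mul_eq_sum_range]
    calc _ ≤ ∑ i ∈ Finset.range (n + 1), c ^ (k + 1) * (n + 1) ^ k * σ ^ n := by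
          refine Finset.sum_le_sum fun i hi => ?_
          rw [Finset.mem_range] at hi
          have hin : (i : ℝ) ≤ n := by exact_mod_cast Nat.lt_succ_iff.1 hi
          calc _ ≤ (c ^ k * (i + 1) ^ k * σ ^ i) * (c * σ ^ (n - i)) :=
                mul_le_mul (ih i) (h _) (hF _) (by positivity)
            _ = c ^ (k + 1) * (i + 1) ^ k * (σ ^ i * σ ^ (n - i)) := by ring
            _ = c ^ (k + 1) * (i + 1) ^ k * σ ^ n := by
                rw [← pow_add, Nat.add_sub_cancel' (by omega)]
            _ ≤ _ := by gcongr
      _ = _ := by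
          rw [Finset.sum_const, Finset.card_range, nsmul_eq_mul]; push_cast; ring

/-- The series `X + X² + X³ + ⋯`. -/
noncomputable def geomSeries : PowerSeries ℝ := PowerSeries.X * PowerSeries.mk 1

/-- The coefficient counts the compositions of `n` into `j + 1` positive parts. The case `n = 0` is
separate because truncated subtraction would give `1` for `j = 0`. -/
theorem coeff_geomSeries_pow (j n : ℕ) :
    PowerSeries.coeff n (geomSeries ^ (j + 1)) = if n = 0 then 0 else ((n - 1).choose j : ℝ) := by
  rw [geomSeries, mul_pow, PowerSeries.mk_one_pow_eq_mk_choose_add, PowerSeries.coeff_X_pow_mul']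
  split_ifs with h1 h2 h2
  · omega
  · rw [PowerSeries.coeff_mk]; congr 2; omega
  · rfl
  · rw [Nat.choose_eq_zero_of_lt (by omega)]; simp

theorem coeff_geomSeries_pow_le {j n N : ℕ} (h : n ≤ N) :
    PowerSeries.coeff n (geomSeries ^ (j + 1)) ≤ ((N - 1).choose j : ℝ) := by
  rw [coeff_geomSeries_pow]
  split_ifs
  · positivity
  · exact_mod_cast Nat.choose_le_choose j (by omega)

theorem coeffNonneg_geomSeries : CoeffNonneg geomSeries := fun n => by
  have := coeff_geomSeries_pow 0 n
  simp only [zero_add, pow_one] at this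
  rw [this]; split_ifs <;> simp

theorem coeff_geomSeries_pow_mul_le {F : PowerSeries ℝ} (hF : CoeffNonneg F) (j N : ℕ) :
    PowerSeries.coeff N (F * geomSeries ^ (j + 1)) ≤ ((N - 1).choose j : ℝ) * coeffSum F N := by
  rw [coeff_mul_eq_sum_range, coeffSum, Finset.mul_sum]
  refine Finset.sum_le_sum fun i _ => ?_
  rw [mul_comm]
  exact mul_le_mul_of_nonneg_right (coeff_geomSeries_pow_le (by omega)) (hF i)

theorem le_coeff_geomSeries_pow_mul {F : PowerSeries ℝ} (hF : CoeffNonneg F) (j : ℕ) {N L : ℕ}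
    (hL : L < N) :
    ((N - L - 1).choose j : ℝ) * coeffSum F L ≤
      PowerSeries.coeff N (F * geomSeries ^ (j + 1)) := by
  rw [coeff_mul_eq_sum_range, coeffSum, Finset.mul_sum]
  calc _ ≤ ∑ i ∈ Finset.range (L + 1), PowerSeries.coeff i F *
        PowerSeries.coeff (N - i) (geomSeries ^ (j + 1)) := by
        refine Finset.sum_le_sum fun i hi => ?_
        rw [Finset.mem_range] at hi
        rw [mul_comm]
        refine mul_le_mul_of_nonneg_left ?_ (hF i)
        rw [coeff_geomSeries_pow, if_neg (by omega)]
        exact_mod_cast Nat.choose_le_choose j (by omega)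
    _ ≤ _ := Finset.sum_le_sum_of_subset_of_nonneg (Finset.range_subset_range.2 (by omega))
        fun i _ _ => mul_nonneg (hF i) (coeffNonneg_geomSeries.pow _ _)

/-- As `b → 0` and `bn → β`, each factor of the falling factorial, multiplied by `b`, tends to `β`.
-/
theorem tendsto_pow_mul_choose {α : Type*} {l : Filter α} {b : α → ℝ} {n : α → ℕ} {β : ℝ}
    (hb : Tendsto b l (𝓝 0)) (hb0 : ∀ᶠ a in l, 0 < b a)
    (hbn : Tendsto (fun a => b a * n a) l (𝓝 β)) (j : ℕ) :
    Tendsto (fun a => b a ^ j * ((n a - 1).choose j : ℝ)) l (𝓝 (β ^ j / j.factorial)) := by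
  induction j with
  | zero => simpa using tendsto_const_nhds
  | succ j ih =>
    have h1 : Tendsto (fun a => b a * ((n a - 1 - j : ℕ) : ℝ)) l (𝓝 β) := by
      have h2 : Tendsto (fun a => b a * n a - b a * (j + 1)) l (𝓝 β) := by
        simpa using hbn.sub (hb.mul_const ((j : ℝ) + 1))
      refine tendsto_of_tendsto_of_tendsto_of_le_of_le' h2 hbn ?_ ?_
      · filter_upwards [hb0] with a ha
        rw [← mul_sub]
        refine mul_le_mul_of_nonneg_left ?_ ha.le
        have : n a ≤ (n a - 1 - j) + (j + 1) := by omega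
        have : (n a : ℝ) ≤ ((n a - 1 - j : ℕ) : ℝ) + (j + 1) := by exact_mod_cast this
        linarith
      · filter_upwards [hb0] with a ha
        refine mul_le_mul_of_nonneg_left ?_ ha.le
        exact_mod_cast (by omega : n a - 1 - j ≤ n a)
    have h3 := (ih.mul h1).div_const ((j : ℝ) + 1)
    refine (h3.congr fun a => ?_).trans (le_of_eq ?_)
    · have := Nat.choose_succ_right_eq (n a - 1) j
      have h4 : ((n a - 1).choose (j + 1) : ℝ) * (j + 1) =
          (n a - 1).choose j * ((n a - 1 - j : ℕ) : ℝ) := by exact_mod_cast this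
      have hj : (j : ℝ) + 1 ≠ 0 := by positivity
      rw [div_eq_iff hj, mul_assoc (b a ^ (j + 1)), h4]; ring
    · congr 1
      rw [Nat.factorial_succ]
      have : (j.factorial : ℝ) ≠ 0 := by exact_mod_cast j.factorial_ne_zero
      push_cast
      field_simp
      ring

/-- The condensation step. In the binomial expansion, each factor `E` contributes asymptotically its
mass `1/2` and shifts the index by at most `L = o(N)`. The `j + 1` factors of the geometric series
then share an index close to `N`, which can be done in about `N^j / j!` ways. Bounding the shift by
`kL` gives the lower estimate; ignoring it gives the upper one. -/
theorem tendsto_coeff_add_pow {α : Type*} {l : Filter α} {b : α → ℝ} {E : α → PowerSeries ℝ}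
    {N L : α → ℕ} {β : ℝ} (hb : ∀ᶠ a in l, 0 < b a) (hE : ∀ᶠ a in l, CoeffNonneg (E a))
    (hN : Tendsto N l atTop) (hbN : Tendsto (fun a => b a * N a) l (𝓝 β))
    (hL : Tendsto (fun a => (L a : ℝ) / N a) l (𝓝 0))
    (hEle : ∀ᶠ a in l, ∀ n, coeffSum (E a) n ≤ 1 / 2)
    (hEL : Tendsto (fun a => coeffSum (E a) (L a)) l (𝓝 (1 / 2)))
    (hE0 : ∀ k, 1 ≤ k → Tendsto (fun a => PowerSeries.coeff (N a) (E a ^ k) / b a) l (𝓝 0))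
    {K : ℕ} (hK : 1 ≤ K) :
    Tendsto (fun a => PowerSeries.coeff (N a) ((E a + PowerSeries.C (b a) * geomSeries) ^ K) / b a)
      l (𝓝 (∑ j ∈ Finset.range K, (1 / 2) ^ (K - (j + 1)) * (β ^ j / j.factorial) *
        (K.choose (j + 1) : ℝ))) := by
  have hNr : Tendsto (fun a => (N a : ℝ)) l atTop := tendsto_natCast_atTop_atTop.comp hN
  have hb0 : Tendsto b l (𝓝 0) := by
    refine (hbN.div_atTop hNr).congr' ?_
    filter_upwards [hNr.eventually_gt_atTop 0] with a ha
    rw [mul_div_assoc, div_self ha.ne', mul_one]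
  have hterm (j k : ℕ) : Tendsto (fun a => b a ^ j *
      PowerSeries.coeff (N a) (E a ^ k * geomSeries ^ (j + 1))) l
      (𝓝 ((1 / 2) ^ k * (β ^ j / j.factorial))) := by
    have hkL : Tendsto (fun a => ((k * L a : ℕ) : ℝ) / N a) l (𝓝 0) := by
      have := hL.const_mul (k : ℝ)
      rw [mul_zero] at this
      refine this.congr fun a => ?_
      push_cast; ring
    have hlt : ∀ᶠ a in l, k * L a < N a := by
      filter_upwards [hkL.eventually_lt_const one_pos, hNr.eventually_gt_atTop 0] with a h1 h2
      rw [div_lt_one h2] at h1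
      exact_mod_cast h1
    have hbn : Tendsto (fun a => b a * ((N a - k * L a : ℕ) : ℝ)) l (𝓝 β) := by
      have := hbN.mul (hkL.const_sub 1)
      rw [sub_zero, mul_one] at this
      refine this.congr' ?_
      filter_upwards [hlt, hNr.eventually_gt_atTop 0] with a h1 h2
      rw [Nat.cast_sub h1.le]
      field_simp
    have hlow := (hEL.pow k).mul (tendsto_pow_mul_choose hb0 hb hbn j)
    have hup := (tendsto_pow_mul_choose hb0 hb hbN j).const_mul ((1 / 2 : ℝ) ^ k)
    refine tendsto_of_tendsto_of_tendsto_of_le_of_le' hlow hup ?_ ?_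
    · filter_upwards [hlt, hb, hE] with a h1 h2 h3
      have h4 := le_coeff_geomSeries_pow_mul (h3.pow k) j h1
      have h5 := h3.le_coeffSum_pow k (L a)
      calc coeffSum (E a) (L a) ^ k * (b a ^ j * ((N a - k * L a - 1).choose j : ℝ))
          = b a ^ j * (((N a - k * L a - 1).choose j : ℝ) * coeffSum (E a) (L a) ^ k) := by ring
        _ ≤ b a ^ j * (((N a - k * L a - 1).choose j : ℝ) * coeffSum (E a ^ k) (k * L a)) := by
            gcongr
        _ ≤ _ := by gcongr
    · filter_upwards [hb, hE, hEle] with a h2 h3 h4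
      have h5 := coeff_geomSeries_pow_mul_le (h3.pow k) j (N a)
      calc b a ^ j * PowerSeries.coeff (N a) (E a ^ k * geomSeries ^ (j + 1))
          ≤ b a ^ j * (((N a - 1).choose j : ℝ) * (1 / 2) ^ k) := by
            refine mul_le_mul_of_nonneg_left (h5.trans ?_) (by positivity)
            refine mul_le_mul_of_nonneg_left ?_ (by positivity)
            exact (h3.coeffSum_pow_le k _).trans
              (pow_le_pow_left₀ (h3.coeffSum_nonneg _) (h4 _) k)
        _ = _ := by ring
  have hsum := (tendsto_finsetSum (Finset.range K) fun j _ =>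
    (hterm j (K - (j + 1))).mul_const (K.choose (j + 1) : ℝ)).add (hE0 K hK)
  rw [add_zero] at hsum
  refine hsum.congr' ?_
  filter_upwards [hb] with a ha
  -- The summand split off has no geometric factor; it is the one that `hE0` makes negligible
  -- compared with `b`.
  rw [add_comm (E a), add_pow, Finset.sum_range_succ', map_add, map_sum, add_div, Finset.sum_div]
  congr 1
  · refine Finset.sum_congr rfl fun j _ => ?_
    have h : (PowerSeries.C (b a) * geomSeries) ^ (j + 1) * E a ^ (K - (j + 1)) *
        (K.choose (j + 1) : PowerSeries ℝ) = PowerSeries.C (b a ^ (j + 1) *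
            (K.choose (j + 1) : ℝ)) *
        (E a ^ (K - (j + 1)) * geomSeries ^ (j + 1)) := by
      rw [mul_pow, ← map_pow, map_mul, map_natCast]; ring
    rw [h, PowerSeries.coeff_C_mul, eq_div_iff ha.ne']
    ring
  · simp

/-! ### The spectral decomposition of the coefficients -/

theorem sin_sq_sub_sin_sq (a b : ℝ) :
    Real.sin a ^ 2 - Real.sin b ^ 2 = Real.sin (a + b) * Real.sin (a - b) := by
  rw [Real.sin_add, Real.sin_sub]
  linear_combination Real.sin b ^ 2 * Real.sin_sq_add_cos_sq a -
    Real.sin a ^ 2 * Real.sin_sq_add_cos_sq b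

/-- The angle `π / (p + 3)`. -/
noncomputable def angle (p : ℕ) : ℝ := Real.pi / (p + 3)

theorem angle_pos (p : ℕ) : 0 < angle p := by unfold angle; positivity

theorem mul_angle (p : ℕ) : (p + 3) * angle p = Real.pi := by
  unfold angle
  have : (p : ℝ) + 3 ≠ 0 := by positivity
  field_simp

theorem angle_le (p : ℕ) : angle p ≤ Real.pi / 3 := by
  unfold angle
  exact div_le_div_of_nonneg_left Real.pi_pos.le (by norm_num)
      (by linarith [p.cast_nonneg (α := ℝ)])

theorem sin_angle_pos (p : ℕ) : 0 < Real.sin (angle p) :=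
  Real.sin_pos_of_pos_of_lt_pi (angle_pos p) (by linarith [angle_le p, Real.pi_pos])

theorem half_le_cos_angle (p : ℕ) : 1 / 2 ≤ Real.cos (angle p) := by
  rw [← Real.cos_pi_div_three]
  exact Real.cos_le_cos_of_nonneg_of_le_pi (angle_pos p).le (by linarith [Real.pi_pos]) (angle_le p)

/-- The largest value of `cos²` at the nodes, i.e. the growth rate of the coefficients. -/
noncomputable def rate (p : ℕ) : ℝ := Real.cos (angle p) ^ 2

theorem quarter_le_rate (p : ℕ) : 1 / 4 ≤ rate p := by
  have := half_le_cos_angle p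
  unfold rate; nlinarith

theorem rate_pos (p : ℕ) : 0 < rate p := by linarith [quarter_le_rate p]

theorem sin_mul_angle_nonneg {p i : ℕ} (h : i ≤ p + 3) : 0 ≤ Real.sin (i * angle p) := by
  refine Real.sin_nonneg_of_nonneg_of_le_pi (mul_nonneg i.cast_nonneg (angle_pos p).le) ?_
  rw [← mul_angle p]
  refine mul_le_mul_of_nonneg_right ?_ (angle_pos p).le
  exact_mod_cast h

theorem sin_mul_angle_pos {p i : ℕ} (h0 : 0 < i) (h : i < p + 3) : 0 < Real.sin (i * angle p) := by
  refine Real.sin_pos_of_pos_of_lt_pi (mul_pos (by exact_mod_cast h0) (angle_pos p)) ?_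
  rw [← mul_angle p]
  refine mul_lt_mul_of_pos_right ?_ (angle_pos p)
  exact_mod_cast h

/-- The difference `sin² ((i + 2) θ) - sin² θ` for `θ = π / (p + 3)`. -/
noncomputable def gap (p i : ℕ) : ℝ := Real.sin ((i + 3 : ℕ) * angle p) *
    Real.sin ((i + 1 : ℕ) * angle p)

theorem gap_pos {p i : ℕ} (h : i < p) : 0 < gap p i :=
  mul_pos (sin_mul_angle_pos (by omega) (by omega)) (sin_mul_angle_pos (by omega) (by omega))

theorem sin_sq_eq_gap (p i : ℕ) :
    Real.sin ((i + 2 : ℕ) * angle p) ^ 2 = gap p i + Real.sin (angle p) ^ 2 := by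
  rw [← sub_eq_iff_eq_add, sin_sq_sub_sin_sq, gap]
  push_cast; ring_nf

theorem cos_sq_eq_gap (p i : ℕ) :
    Real.cos ((i + 2 : ℕ) * angle p) ^ 2 = rate p - gap p i := by
  rw [Real.cos_sq', sin_sq_eq_gap, rate, Real.cos_sq']; ring

/-- The node `2θ` is the closest competitor: `sin² ((i+2)θ) - sin² (2θ) = sin ((i+4)θ) sin (iθ)`,
and `i + 4 ≤ p + 3` keeps both angles in `[0, π]`. -/
theorem gap_zero_le {p i : ℕ} (h : i < p) : gap p 0 ≤ gap p i := by
  have h1 := sin_sq_eq_gap p i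
  have h2 := sin_sq_eq_gap p 0
  have h3 := sin_sq_sub_sin_sq ((i + 2 : ℕ) * angle p) ((0 + 2 : ℕ) * angle p)
  have h4 : 0 ≤ Real.sin ((i + 2 : ℕ) * angle p + (0 + 2 : ℕ) * angle p) *
      Real.sin ((i + 2 : ℕ) * angle p - (0 + 2 : ℕ) * angle p) := by
    have e1 : ((i + 2 : ℕ) : ℝ) * angle p + (0 + 2 : ℕ) * angle p = (i + 4 : ℕ) * angle p := by
      push_cast; ring
    have e2 : ((i + 2 : ℕ) : ℝ) * angle p - (0 + 2 : ℕ) * angle p = i * angle p := by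
      push_cast; ring
    rw [e1, e2]
    exact mul_nonneg (sin_mul_angle_nonneg (by omega)) (sin_mul_angle_nonneg (by omega))
  linarith

theorem gap_le_rate (p i : ℕ) : gap p i ≤ rate p := by
  have := cos_sq_eq_gap p i
  nlinarith [sq_nonneg (Real.cos ((i + 2 : ℕ) * angle p))]

theorem sin_three_mul_eq (p : ℕ) : gap p 0 = Real.sin (angle p) ^ 2 * (4 * rate p - 1) := by
  have h := sin_sq_eq_gap p 0
  have h2 : Real.sin ((0 + 2 : ℕ) * angle p) = 2 * Real.sin (angle p) * Real.cos (angle p) := by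
    rw [← Real.sin_two_mul]; push_cast; ring_nf
  rw [h2] at h
  unfold rate; linear_combination -h

theorem half_le_rate {p : ℕ} (hp : 1 ≤ p) : 1 / 2 ≤ rate p := by
  have h : Real.cos (Real.pi / 4) ≤ Real.cos (angle p) := by
    refine Real.cos_le_cos_of_nonneg_of_le_pi (angle_pos p).le (by linarith [Real.pi_pos]) ?_
    unfold angle
    refine div_le_div_of_nonneg_left Real.pi_pos.le (by norm_num) ?_
    have : (1 : ℝ) ≤ p := by exact_mod_cast hp
    linarith
  rw [Real.cos_pi_div_four] at h
  have h2 : (Real.sqrt 2 / 2) ^ 2 = 1 / 2 := by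
    rw [div_pow, Real.sq_sqrt (by norm_num)]; norm_num
  rw [← h2, rate]
  exact pow_le_pow_left₀ (by positivity) h 2

/-- Jordan's inequality `sin x ≥ 2x/π`. -/
theorem two_div_le_sin_angle (p : ℕ) : 2 / (p + 3) ≤ Real.sin (angle p) := by
  have h := Real.mul_le_sin (angle_pos p).le (by linarith [angle_le p, Real.pi_pos])
  refine le_trans (le_of_eq ?_) h
  unfold angle
  have := Real.pi_pos.ne'
  field_simp

/-- The ratio of the second largest to the largest value of `cos²` at the nodes. -/
noncomputable def subRate (p : ℕ) : ℝ := (rate p - gap p 0) / rate p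

theorem subRate_nonneg (p : ℕ) : 0 ≤ subRate p :=
  div_nonneg (by linarith [gap_le_rate p 0]) (rate_pos p).le

theorem rate_le_one (p : ℕ) : rate p ≤ 1 := Real.cos_sq_le_one _

/-- The relative spectral gap is at least of order `M⁻²`: `sin² (2θ) - sin² θ = sin² θ (4 cos² θ -
1)`, where the bracket is at least `1` once `M ≥ 4`. -/
theorem subRate_le {p : ℕ} (hp : 1 ≤ p) : subRate p ≤ Real.exp (-(4 / (p + 3) ^ 2)) := by
  have h1 : (4 : ℝ) / (p + 3) ^ 2 ≤ Real.sin (angle p) ^ 2 := by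
    refine le_trans (le_of_eq ?_) (pow_le_pow_left₀ (by positivity) (two_div_le_sin_angle p) 2)
    rw [div_pow]; norm_num
  have h2 : Real.sin (angle p) ^ 2 ≤ gap p 0 := by
    rw [sin_three_mul_eq]
    nlinarith [half_le_rate hp, sq_nonneg (Real.sin (angle p))]
  have h3 : subRate p ≤ 1 - 4 / (p + 3) ^ 2 := by
    rw [subRate, sub_div, div_self (rate_pos p).ne']
    have : gap p 0 ≤ gap p 0 / rate p := by
      rw [le_div_iff₀ (rate_pos p)]
      nlinarith [rate_le_one p, sq_nonneg (Real.sin (angle p))]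
    linarith
  refine h3.trans ?_
  have := Real.add_one_le_exp (-((4 : ℝ) / (p + 3) ^ 2))
  linarith

/-- Each summand is a multiple of `cot ((i+1)θ) - cot ((i+3)θ)`, so the sum telescopes; it equals
`3/2 - tan² θ / 2`. The bound controls the total mass of `remainderSeries`. -/
theorem sum_sin_sq_div_gap_le (p : ℕ) :
    ∑ i ∈ Finset.range p, Real.sin (angle p) ^ 2 / gap p i ≤ 3 / 2 := by
  set t := angle p with ht
  have hs := sin_angle_pos p
  have hc : 0 < Real.cos t := by linarith [half_le_cos_angle p]
  rw [← ht] at hs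
  have hs2 : Real.sin (2 * t) = 2 * Real.sin t * Real.cos t := Real.sin_two_mul t
  -- The cotangents differ by two indices, so it is the sum of two consecutive ones that telescopes;
  -- the far end is reflected by `x ↦ π - x`.
  let c : ℕ → ℝ := fun i => Real.cos (i * t) / Real.sin (i * t)
  have hterm : ∀ i ∈ Finset.range p, Real.sin t ^ 2 / gap p i =
      Real.sin t / (2 * Real.cos t) * ((c (i + 1) + c (i + 2)) - (c (i + 1 + 1) +
          c (i + 1 + 2))) := by
    intro i hi
    rw [Finset.mem_range] at hi
    have h1 := sin_mul_angle_pos (p := p) (i := i + 1) (by omega) (by omega)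
    have h3 := sin_mul_angle_pos (p := p) (i := i + 3) (by omega) (by omega)
    rw [← ht] at h1 h3
    have e : Real.sin (2 * t) = Real.sin ((i + 3 : ℕ) * t) * Real.cos ((i + 1 : ℕ) * t) -
        Real.cos ((i + 3 : ℕ) * t) * Real.sin ((i + 1 : ℕ) * t) := by
      rw [← Real.sin_sub]; push_cast; ring_nf
    rw [hs2] at e
    rw [gap, ← ht]
    have : c (i + 1) + c (i + 2) - (c (i + 1 + 1) + c (i + 1 + 2)) = c (i + 1) - c (i + 3) := by
      ring
    rw [this]
    simp only [c]
    rw [div_sub_div _ _ h1.ne' h3.ne']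
    have e2 : Real.cos ((i + 1 : ℕ) * t) * Real.sin ((i + 3 : ℕ) * t) -
        Real.sin ((i + 1 : ℕ) * t) * Real.cos ((i + 3 : ℕ) * t) = 2 * Real.sin t * Real.cos t := by
      rw [e]; ring
    rw [e2]
    field_simp
  rw [Finset.sum_congr rfl hterm, ← Finset.mul_sum,
    Finset.sum_range_sub' (fun i => c (i + 1) + c (i + 2))]
  have hpi : (p + 3) * t = Real.pi := mul_angle p
  have hc1 : c (p + 2) = - c 1 := by
    simp only [c]
    have : ((p + 2 : ℕ) : ℝ) * t = Real.pi - (1 : ℕ) * t := by rw [← hpi]; push_cast; ring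
    rw [this, Real.cos_pi_sub, Real.sin_pi_sub, neg_div]
  have hc2 : c (p + 1) = - c 2 := by
    simp only [c]
    have : ((p + 1 : ℕ) : ℝ) * t = Real.pi - (2 : ℕ) * t := by rw [← hpi]; push_cast; ring
    rw [this, Real.cos_pi_sub, Real.sin_pi_sub, neg_div]
  simp only [zero_add]
  rw [hc1, hc2]
  have v1 : c 1 = Real.cos t / Real.sin t := by simp [c]
  have v2 : c 2 = (2 * Real.cos t ^ 2 - 1) / (2 * Real.sin t * Real.cos t) := by
    simp only [c]; push_cast; rw [hs2, Real.cos_two_mul]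
  rw [v1, v2]
  have : Real.sin t / (2 * Real.cos t) * (Real.cos t / Real.sin t +
      (2 * Real.cos t ^ 2 - 1) / (2 * Real.sin t * Real.cos t) -
      (-((2 * Real.cos t ^ 2 - 1) / (2 * Real.sin t * Real.cos t)) + -(Real.cos t / Real.sin t))) =
      3 / 2 + 2 * (Real.cos t ^ 2 - 1) / (4 * Real.cos t ^ 2) := by
    field_simp
    ring
  rw [this]
  have h5 : 2 * (Real.cos t ^ 2 - 1) / (4 * Real.cos t ^ 2) ≤ 0 :=
    div_nonpos_of_nonpos_of_nonneg (by nlinarith [Real.cos_sq_le_one t]) (by positivity)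
  linarith

/-- The contribution to the rescaled generating function of all poles but the first one, divided
by `X`. -/
noncomputable def remainderCoeff (p n : ℕ) : ℝ :=
  1 / (2 * (p + 3)) * ∑ i ∈ Finset.range p,
    (gap p i + Real.sin (angle p) ^ 2) / rate p * ((rate p - gap p i) / rate p) ^ n

/-- The contribution to the rescaled generating function of all poles but the first one. -/
noncomputable def remainderSeries (p : ℕ) : PowerSeries ℝ :=
  PowerSeries.X * PowerSeries.mk (remainderCoeff p)

/-- The coefficient of the first pole of the rescaled generating function. -/
noncomputable def leadCoeff (p : ℕ) : ℝ := Real.sin (angle p) ^ 2 / ((p + 3) * rate p)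

theorem leadCoeff_pos (p : ℕ) : 0 < leadCoeff p :=
  div_pos (pow_pos (sin_angle_pos p) 2) (mul_pos (by positivity) (rate_pos p))

theorem remainderCoeff_nonneg (p n : ℕ) : 0 ≤ remainderCoeff p n := by
  refine mul_nonneg (by positivity) (Finset.sum_nonneg fun i hi => ?_)
  have h1 := gap_pos (Finset.mem_range.1 hi)
  have h2 := gap_le_rate p i
  have h3 := rate_pos p
  have : 0 ≤ rate p - gap p i := by linarith
  positivity

theorem coeffNonneg_mk_remainderCoeff (p : ℕ) : CoeffNonneg (PowerSeries.mk (remainderCoeff p)) :=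
  fun n => by rw [PowerSeries.coeff_mk]; exact remainderCoeff_nonneg p n

theorem coeffNonneg_X : CoeffNonneg (PowerSeries.X : PowerSeries ℝ) := fun n => by
  rw [PowerSeries.coeff_X]; split_ifs <;> norm_num

theorem coeffNonneg_remainderSeries (p : ℕ) : CoeffNonneg (remainderSeries p) :=
  coeffNonneg_X.mul (coeffNonneg_mk_remainderCoeff p)

/-- Every prefactor is at most `1 / rate p ≤ 4`, and averaging with weight `1/(2M)` over `p < M`
nodes leaves `2`. -/
theorem remainderCoeff_le (p n : ℕ) : remainderCoeff p n ≤ 2 * subRate p ^ n := by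
  have hr := rate_pos p
  have h : ∀ i ∈ Finset.range p, (gap p i + Real.sin (angle p) ^ 2) / rate p *
      ((rate p - gap p i) / rate p) ^ n ≤ 4 * subRate p ^ n := by
    intro i hi
    have h1 := gap_pos (Finset.mem_range.1 hi)
    have h2 := gap_le_rate p i
    have h3 := gap_zero_le (Finset.mem_range.1 hi)
    refine mul_le_mul ?_ ?_ (pow_nonneg (div_nonneg (by linarith) hr.le) n) (by norm_num)
    · rw [← sin_sq_eq_gap, div_le_iff₀ hr]
      nlinarith [Real.sin_sq_le_one ((i + 2 : ℕ) * angle p), quarter_le_rate p]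
    · refine pow_le_pow_left₀ (div_nonneg (by linarith) hr.le) ?_ n
      exact div_le_div_of_nonneg_right (by linarith) hr.le
  calc remainderCoeff p n ≤ 1 / (2 * (p + 3)) * ∑ i ∈ Finset.range p, 4 * subRate p ^ n :=
        mul_le_mul_of_nonneg_left (Finset.sum_le_sum h) (by positivity)
    _ = (p / (p + 3)) * (2 * subRate p ^ n) := by
        rw [Finset.sum_const, Finset.card_range, nsmul_eq_mul]
        rw [show (1 : ℝ) / (2 * ((p : ℝ) + 3)) = 1 / 2 * ((p : ℝ) + 3)⁻¹ by rw [one_div, mul_inv]; ring]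
        ring
    _ ≤ 1 * (2 * subRate p ^ n) := by
        refine mul_le_mul_of_nonneg_right ?_
          (mul_nonneg zero_le_two (pow_nonneg (subRate_nonneg p) n))
        rw [div_le_one (by positivity)]; linarith
    _ = _ := one_mul _

theorem coeff_remainderSeries_pow_le (p k N : ℕ) :
    PowerSeries.coeff N (remainderSeries p ^ k) ≤ 2 ^ k * (N + 1) ^ k * subRate p ^ (N - k) := by
  have h0 := subRate_nonneg p
  rw [remainderSeries, mul_pow, PowerSeries.coeff_X_pow_mul']
  split_ifs with h
  · refine (coeff_pow_le_of_le_geometric (coeffNonneg_mk_remainderCoeff p) zero_le_two h0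
      (fun n => by rw [PowerSeries.coeff_mk]; exact remainderCoeff_le p n) k (N - k)).trans ?_
    have : ((N - k : ℕ) : ℝ) ≤ N := by exact_mod_cast Nat.sub_le N k
    gcongr
  · positivity

/-- A geometric sum for each node: its ratio `x` satisfies `1 - x = gap / rate`, which turns the
prefactor into `1 + sin² θ / gap`. -/
theorem coeffSum_remainderSeries (p L : ℕ) :
    coeffSum (remainderSeries p) L = 1 / (2 * (p + 3)) * ∑ i ∈ Finset.range p,
      (1 + Real.sin (angle p) ^ 2 / gap p i) * (1 - ((rate p - gap p i) / rate p) ^ L) := by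
  rw [coeffSum, Finset.sum_range_succ', remainderSeries, PowerSeries.coeff_zero_X_mul, add_zero]
  simp only [PowerSeries.coeff_succ_X_mul, PowerSeries.coeff_mk, remainderCoeff]
  rw [← Finset.mul_sum, Finset.sum_comm]
  congr 1
  refine Finset.sum_congr rfl fun i hi => ?_
  have h1 := gap_pos (Finset.mem_range.1 hi)
  have hr := rate_pos p
  rw [← Finset.mul_sum]
  have hx : (rate p - gap p i) / rate p ≠ 1 := by
    rw [Ne, div_eq_one_iff_eq hr.ne']; linarith
  rw [geom_sum_eq hx]
  have : (rate p - gap p i) / rate p - 1 = -(gap p i / rate p) := by field_simp; ring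
  rw [this]
  generalize ((rate p - gap p i) / rate p) ^ L = y
  field_simp
  ring

/-- The constant `1/2` is the value at `1/4` of the generating function of all finite trees, which
is the limit of these masses. -/
theorem coeffSum_remainderSeries_le (p L : ℕ) : coeffSum (remainderSeries p) L ≤ 1 / 2 := by
  have hr := rate_pos p
  rw [coeffSum_remainderSeries]
  calc _ ≤ 1 / (2 * ((p : ℝ) + 3)) * ∑ i ∈ Finset.range p,
      (1 + Real.sin (angle p) ^ 2 / gap p i) := by
        refine mul_le_mul_of_nonneg_left (Finset.sum_le_sum fun i hi => ?_) (by positivity)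
        have h1 := gap_pos (Finset.mem_range.1 hi)
        have h2 : 0 ≤ ((rate p - gap p i) / rate p) ^ L :=
          pow_nonneg (div_nonneg (by linarith [gap_le_rate p i]) hr.le) L
        exact mul_le_of_le_one_right (by positivity) (by linarith)
    _ ≤ 1 / (2 * ((p : ℝ) + 3)) * (p + 3 / 2) := by
        rw [Finset.sum_add_distrib]
        refine mul_le_mul_of_nonneg_left ?_ (by positivity)
        simpa using sum_sin_sq_div_gap_le p
    _ ≤ 1 / 2 := by
        rw [div_mul_eq_mul_div, div_le_div_iff₀ (by positivity) (by positivity)]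
        linarith

theorem le_coeffSum_remainderSeries (p L : ℕ) :
    p / (2 * (p + 3)) * (1 - subRate p ^ L) ≤ coeffSum (remainderSeries p) L := by
  have hr := rate_pos p
  rw [coeffSum_remainderSeries]
  have h : ∑ i ∈ Finset.range p, (1 - subRate p ^ L) ≤ ∑ i ∈ Finset.range p,
      (1 + Real.sin (angle p) ^ 2 / gap p i) * (1 - ((rate p - gap p i) / rate p) ^ L) := by
    refine Finset.sum_le_sum fun i hi => ?_
    have h1 := gap_pos (Finset.mem_range.1 hi)
    have h2 := gap_le_rate p i
    have h3 := gap_zero_le (Finset.mem_range.1 hi)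
    have h4 : ((rate p - gap p i) / rate p) ^ L ≤ subRate p ^ L :=
      pow_le_pow_left₀ (div_nonneg (by linarith) hr.le)
        (div_le_div_of_nonneg_right (by linarith) hr.le) L
    have h5 : ((rate p - gap p i) / rate p) ^ L ≤ 1 :=
      pow_le_one₀ (div_nonneg (by linarith) hr.le) (by rw [div_le_one hr]; linarith)
    have h6 : 0 ≤ Real.sin (angle p) ^ 2 / gap p i := by positivity
    nlinarith
  refine le_trans (le_of_eq ?_) (mul_le_mul_of_nonneg_left h (by positivity))
  rw [Finset.sum_const, Finset.card_range, nsmul_eq_mul]; ring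

/-- The node `k = 0` drops out, and `k = 1` and `k = M - 1` give the same leading term, which
cancels the `2` in `1/(2M)`. The `p` nodes in between are separated from it by `gap`. -/
theorem IsHeightSeries.coeff_succ_eq {Q : ℕ → PowerSeries ℝ} (hQ : IsHeightSeries Q) (p n : ℕ) :
    PowerSeries.coeff (n + 1) (Q (p + 2)) = Real.sin (angle p) ^ 2 / (p + 3) * rate p ^ n +
      1 / (2 * (p + 3)) * ∑ i ∈ Finset.range p,
        (gap p i + Real.sin (angle p) ^ 2) * (rate p - gap p i) ^ n := by
  rw [hQ.coeff_succ]
  have hM : ((p + 2 + 1 : ℕ) : ℝ) = p + 3 := by push_cast; ring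
  have ht (k : ℕ) : (k : ℝ) * Real.pi / (p + 3) = k * angle p := by rw [angle]; ring
  rw [hM]
  simp only [ht]
  rw [show p + 2 + 1 = (p + 1) + 1 + 1 by ring, Finset.sum_range_succ, Finset.sum_range_succ',
    Finset.sum_range_succ']
  have hlast : ((p + 1 + 1 : ℕ) : ℝ) * angle p = Real.pi - angle p := by
    rw [← mul_angle p]; push_cast; ring
  rw [hlast, Real.sin_pi_sub, Real.cos_pi_sub, neg_sq]
  simp only [sin_sq_eq_gap, cos_sq_eq_gap, show ∀ i : ℕ, i + 1 + 1 = i + 2 from fun i => rfl]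
  simp only [zero_add, Nat.cast_one, one_mul, Nat.cast_zero, zero_mul, Real.sin_zero]
  rw [← rate]
  field_simp
  ring

theorem IsHeightSeries.rescale_eq {Q : ℕ → PowerSeries ℝ} (hQ : IsHeightSeries Q) (p : ℕ) :
    PowerSeries.rescale (rate p)⁻¹ (Q (p + 2)) =
      remainderSeries p + PowerSeries.C (leadCoeff p) * geomSeries := by
  have hr := (rate_pos p).ne'
  ext n
  rw [PowerSeries.coeff_rescale, map_add, PowerSeries.coeff_C_mul, remainderSeries, geomSeries]
  rcases n with _ | n
  · rw [hQ.coeff_zero]; simp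
  · rw [PowerSeries.coeff_succ_X_mul, PowerSeries.coeff_succ_X_mul, hQ.coeff_succ_eq]
    simp only [PowerSeries.coeff_mk, remainderCoeff, leadCoeff, Pi.one_apply, mul_one]
    rw [mul_add, add_comm]
    congr 1
    · rw [mul_left_comm, Finset.mul_sum]
      congr 1
      refine Finset.sum_congr rfl fun i _ => ?_
      rw [div_pow, inv_pow, pow_succ]
      field_simp
    · rw [inv_pow, pow_succ]
      field_simp

theorem tendsto_pow_mul_exp_neg_mul (n : ℕ) {c : ℝ} (hc : 0 < c) :
    Tendsto (fun x : ℝ => x ^ n * Real.exp (-(c * x))) atTop (𝓝 0) := by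
  have h := (Real.tendsto_pow_mul_exp_neg_atTop_nhds_zero n).comp
    (tendsto_id.const_mul_atTop hc)
  have h2 := h.const_mul (c ^ n)⁻¹
  rw [mul_zero] at h2
  refine h2.congr fun x => ?_
  simp only [Function.comp, id, mul_pow]
  have : c ^ n ≠ 0 := by positivity
  field_simp

/-! ### The regime in which `N / M³` tends to a positive constant -/

section Window

variable {α : Type*} {l : Filter α} {N p : α → ℕ} {s : ℝ}

theorem tendsto_add_three_of_window (hN : Tendsto N l atTop) (hs0 : 0 < s)
    (hs : Tendsto (fun a => (N a : ℝ) / (p a + 3) ^ 3) l (𝓝 s)) :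
    Tendsto (fun a => (p a : ℝ) + 3) l atTop := by
  have hNr : Tendsto (fun a => (N a : ℝ)) l atTop := tendsto_natCast_atTop_atTop.comp hN
  have h1 : Tendsto (fun a => ((p a : ℝ) + 3) ^ 3) l atTop := by
    refine (hNr.atTop_mul_pos (inv_pos.2 hs0) (hs.inv₀ hs0.ne')).congr' ?_
    filter_upwards [hNr.eventually_gt_atTop 0] with a ha
    field_simp
  rw [tendsto_atTop] at h1 ⊢
  intro B
  filter_upwards [h1 (max B 0 ^ 3)] with a ha
  exact (le_max_left B 0).trans (le_of_pow_le_pow_left₀ (by norm_num) (by positivity) ha)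

theorem tendsto_rate (hp : Tendsto (fun a => (p a : ℝ) + 3) l atTop) :
    Tendsto (fun a => angle (p a)) l (𝓝 0) ∧ Tendsto (fun a => rate (p a)) l (𝓝 1) := by
  have h1 : Tendsto (fun a => angle (p a)) l (𝓝 0) := tendsto_const_nhds.div_atTop hp
  refine ⟨h1, ?_⟩
  have h2 := ((Real.continuous_cos.tendsto 0).comp h1).pow 2
  simpa [Function.comp_def, rate] using h2

/-- Since `sin² (π/M) ~ π²/M²`, the leading coefficient is asymptotic to `π²/M³`. -/
theorem tendsto_leadCoeff_mul (hN : Tendsto N l atTop) (hs0 : 0 < s)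
    (hs : Tendsto (fun a => (N a : ℝ) / (p a + 3) ^ 3) l (𝓝 s)) :
    Tendsto (fun a => leadCoeff (p a) * N a) l (𝓝 (s * Real.pi ^ 2)) := by
  have hp := tendsto_add_three_of_window hN hs0 hs
  obtain ⟨h1, h2⟩ := tendsto_rate hp
  have h3 : Tendsto (fun a => Real.sinc (angle (p a))) l (𝓝 1) := by
    have := (Real.continuous_sinc.tendsto 0).comp h1
    rwa [Real.sinc_zero] at this
  have h4 := hs.mul (((h3.const_mul Real.pi).pow 2).div h2 one_ne_zero)
  simp only [mul_one, div_one] at h4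
  refine h4.congr fun a => ?_
  rw [Pi.div_apply, Real.sinc_of_ne_zero (angle_pos _).ne', leadCoeff]
  have hpi := Real.pi_pos.ne'
  have e : Real.pi * (Real.sin (angle (p a)) / angle (p a)) =
      (p a + 3) * Real.sin (angle (p a)) := by
    have := (angle_pos (p a)).ne'
    rw [← mul_angle (p a)]; field_simp
  rw [e]
  have := (rate_pos (p a)).ne'
  field_simp

/-- A relative gap of order `M⁻²` acting over `N ~ sM³` indices gives a factor exponentially small
in `M`; everything else is polynomial in `M`. -/
theorem tendsto_coeff_remainderSeries_div (hN : Tendsto N l atTop) (hs0 : 0 < s)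
    (hs : Tendsto (fun a => (N a : ℝ) / (p a + 3) ^ 3) l (𝓝 s)) (k : ℕ) :
    Tendsto (fun a => PowerSeries.coeff (N a) (remainderSeries (p a) ^ k) / leadCoeff (p a)) l
      (𝓝 0) := by
  have hp := tendsto_add_three_of_window hN hs0 hs
  have hlim : Tendsto (fun a => 2 ^ k * (s + 2) ^ k / 4 *
      (((p a : ℝ) + 3) ^ (3 * k + 3) * Real.exp (-(2 * s * (p a + 3))))) l (𝓝 0) := by
    have := ((tendsto_pow_mul_exp_neg_mul (3 * k + 3) (c := 2 * s) (by positivity)).comp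
        hp).const_mul
      (2 ^ k * (s + 2) ^ k / 4 : ℝ)
    rwa [mul_zero] at this
  refine squeeze_zero' ?_ ?_ hlim
  · exact Eventually.of_forall fun a =>
      div_nonneg ((coeffNonneg_remainderSeries _).pow k _) (leadCoeff_pos _).le
  have hk : Tendsto (fun a => (N a : ℝ) / (p a + 3) ^ 3 - k / ((p a + 3) ^ 3)) l (𝓝 s) := by
    have h3 : Tendsto (fun a => ((p a : ℝ) + 3) ^ 3) l atTop :=
      (tendsto_pow_atTop (by norm_num)).comp hp
    simpa using hs.sub (tendsto_const_nhds.div_atTop h3)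
  filter_upwards [hs.eventually_lt_const (show s < s + 1 by linarith),
    hk.eventually_const_lt (show s / 2 < s by linarith), hp.eventually_ge_atTop 4] with a h1 h2 h3
  have hM : (0 : ℝ) < p a + 3 := by positivity
  have hpa : 1 ≤ p a := by
    have : (1 : ℝ) ≤ p a := by linarith
    exact_mod_cast this
  set M : ℝ := p a + 3 with hMdef
  have hM3 : 0 < M ^ 3 := by positivity
  have hM1 : 1 ≤ M ^ 3 := one_le_pow₀ (by linarith)
  rw [div_lt_iff₀ hM3] at h1
  rw [← sub_div, lt_div_iff₀ hM3] at h2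
  have hNk : (N a : ℝ) - k ≤ ((N a - k : ℕ) : ℝ) := by
    rw [sub_le_iff_le_add]
    exact_mod_cast (by omega : N a ≤ N a - k + k)
  -- In the window `N - k` exceeds `sM³/2`, hence `(N - k) · 4/M² ≥ 2sM`.
  have hσ : subRate (p a) ^ (N a - k) ≤ Real.exp (-(2 * s * M)) := by
    calc subRate (p a) ^ (N a - k) ≤ Real.exp (-(4 / M ^ 2)) ^ (N a - k) :=
          pow_le_pow_left₀ (subRate_nonneg _) (subRate_le hpa) _
      _ = Real.exp (-(((N a - k : ℕ) : ℝ) * (4 / M ^ 2))) := by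
          rw [← Real.exp_nat_mul, mul_neg]
      _ ≤ _ := by
          rw [Real.exp_le_exp, neg_le_neg_iff]
          rw [← mul_div_assoc, le_div_iff₀ (by positivity)]
          nlinarith
  have hlead : 4 / M ^ 3 ≤ leadCoeff (p a) := by
    have h5 := two_div_le_sin_angle (p a)
    rw [← hMdef] at h5
    have h6 : (2 / M) ^ 2 ≤ Real.sin (angle (p a)) ^ 2 := pow_le_pow_left₀ (by positivity) h5 2
    rw [leadCoeff, ← hMdef, le_div_iff₀ (mul_pos hM (rate_pos _))]
    calc 4 / M ^ 3 * (M * rate (p a)) = (2 / M) ^ 2 * rate (p a) := by field_simp; ring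
      _ ≤ (2 / M) ^ 2 * 1 := by gcongr; exact rate_le_one _
      _ ≤ _ := by rw [mul_one]; exact h6
  rw [div_le_iff₀ (leadCoeff_pos _)]
  have hN1 : (N a : ℝ) + 1 ≤ (s + 2) * M ^ 3 := by linarith
  calc PowerSeries.coeff (N a) (remainderSeries (p a) ^ k)
      ≤ 2 ^ k * (N a + 1) ^ k * subRate (p a) ^ (N a - k) := coeff_remainderSeries_pow_le _ _ _
    _ ≤ 2 ^ k * ((s + 2) * M ^ 3) ^ k * Real.exp (-(2 * s * M)) := by
        have := subRate_nonneg (p a)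
        gcongr
    _ = 2 ^ k * (s + 2) ^ k / 4 * (M ^ (3 * k + 3) * Real.exp (-(2 * s * M))) * (4 / M ^ 3) := by
        rw [mul_pow, ← pow_mul, pow_add]; field_simp
    _ ≤ _ := by
        refine mul_le_mul_of_nonneg_left hlead (by positivity)

/-- The cutoff `M² √M` lies between the relaxation scale `M²`, beyond which the mass is exhausted,
and `N ~ M³`. -/
theorem tendsto_coeffSum_remainderSeries (hp : Tendsto (fun a => (p a : ℝ) + 3) l atTop) :
    Tendsto (fun a => coeffSum (remainderSeries (p a)) ((p a + 3) ^ 2 * Nat.sqrt (p a + 3))) l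
      (𝓝 (1 / 2)) := by
  have hpn : Tendsto (fun a => p a + 3) l atTop := by
    rw [← tendsto_natCast_atTop_iff (R := ℝ)]
    simpa using hp
  have hsq : Tendsto (fun a => (Nat.sqrt (p a + 3) : ℝ)) l atTop :=
    tendsto_natCast_atTop_atTop.comp ((tendsto_atTop_atTop.2 fun b => ⟨b * b, fun a ha =>
      Nat.le_sqrt.2 ha⟩ : Tendsto Nat.sqrt atTop atTop).comp hpn)
  have h1 : Tendsto (fun a => (p a : ℝ) / (2 * (p a + 3))) l (𝓝 (1 / 2)) := by
    have : Tendsto (fun a => (1 / 2 : ℝ) - (3 / 2) / (p a + 3)) l (𝓝 (1 / 2)) := by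
      simpa using (tendsto_const_nhds (x := (1 / 2 : ℝ))).sub
        ((tendsto_const_nhds (x := (3 / 2 : ℝ))).div_atTop hp)
    refine this.congr fun a => ?_
    have : (p a : ℝ) + 3 ≠ 0 := by positivity
    field_simp
    ring
  have h2 : Tendsto (fun a => 1 - Real.exp (-(4 * (Nat.sqrt (p a + 3) : ℝ)))) l (𝓝 1) := by
    have := Real.tendsto_exp_neg_atTop_nhds_zero.comp
        (hsq.const_mul_atTop (show (0 : ℝ) < 4 by norm_num))
    simpa using this.const_sub 1
  have h3 := h1.mul h2
  rw [mul_one] at h3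
  refine tendsto_of_tendsto_of_tendsto_of_le_of_le' h3 tendsto_const_nhds ?_
    (Eventually.of_forall fun a => coeffSum_remainderSeries_le _ _)
  filter_upwards [hp.eventually_ge_atTop 4] with a ha
  have hpa : 1 ≤ p a := by
    have : (1 : ℝ) ≤ p a := by linarith
    exact_mod_cast this
  refine le_trans ?_ (le_coeffSum_remainderSeries _ _)
  refine mul_le_mul_of_nonneg_left ?_ (by positivity)
  rw [sub_le_sub_iff_left]
  calc _ ≤ Real.exp (-(4 / (p a + 3) ^ 2)) ^ ((p a + 3) ^ 2 * Nat.sqrt (p a + 3)) :=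
        pow_le_pow_left₀ (subRate_nonneg _) (subRate_le hpa) _
    _ = _ := by
        rw [← Real.exp_nat_mul]
        congr 1
        push_cast
        field_simp

theorem IsHeightSeries.tendsto_coeff_pow_div {Q : ℕ → PowerSeries ℝ} (hQ : IsHeightSeries Q)
    (hN : Tendsto N l atTop) (hs0 : 0 < s)
    (hs : Tendsto (fun a => (N a : ℝ) / (p a + 3) ^ 3) l (𝓝 s)) {K : ℕ} (hK : 1 ≤ K) :
    Tendsto (fun a => PowerSeries.coeff (N a) (Q (p a + 2) ^ K) /
        (leadCoeff (p a) * rate (p a) ^ N a)) l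
      (𝓝 (∑ j ∈ Finset.range K, (1 / 2) ^ (K - (j + 1)) *
        ((s * Real.pi ^ 2) ^ j / j.factorial) * (K.choose (j + 1) : ℝ))) := by
  have hp := tendsto_add_three_of_window hN hs0 hs
  have hpn : Tendsto (fun a => p a + 3) l atTop := by
    rw [← tendsto_natCast_atTop_iff (R := ℝ)]
    simpa using hp
  have hsq : Tendsto (fun a => (Nat.sqrt (p a + 3) : ℝ)) l atTop :=
    tendsto_natCast_atTop_atTop.comp ((tendsto_atTop_atTop.2 fun b => ⟨b * b, fun a ha =>
      Nat.le_sqrt.2 ha⟩ : Tendsto Nat.sqrt atTop atTop).comp hpn)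
  have hNr : Tendsto (fun a => (N a : ℝ)) l atTop := tendsto_natCast_atTop_atTop.comp hN
  have hL : Tendsto (fun a => (((p a + 3) ^ 2 * Nat.sqrt (p a + 3) : ℕ) : ℝ) / N a) l (𝓝 0) := by
    have h1 : Tendsto (fun a => (Nat.sqrt (p a + 3) : ℝ) / (p a + 3)) l (𝓝 0) := by
      refine squeeze_zero (fun a => by positivity) (fun a => ?_) (tendsto_inv_atTop_zero.comp hsq)
      have hpos : (0 : ℝ) < Nat.sqrt (p a + 3) := by
        exact_mod_cast Nat.sqrt_pos.2 (by omega)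
      have : (Nat.sqrt (p a + 3) : ℝ) * Nat.sqrt (p a + 3) ≤ p a + 3 := by
        exact_mod_cast Nat.sqrt_le (p a + 3)
      simp only [Function.comp]
      rw [div_le_iff₀ (by positivity), ← div_eq_inv_mul, le_div_iff₀ hpos]
      exact this
    have h2 := h1.div hs hs0.ne'
    rw [zero_div] at h2
    refine h2.congr' ?_
    filter_upwards [hNr.eventually_gt_atTop 0] with a ha
    have : (p a : ℝ) + 3 ≠ 0 := by positivity
    rw [Pi.div_apply]
    push_cast
    field_simp
  have h := tendsto_coeff_add_pow (Eventually.of_forall fun a => leadCoeff_pos (p a))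
    (Eventually.of_forall fun a => coeffNonneg_remainderSeries (p a)) hN
    (tendsto_leadCoeff_mul hN hs0 hs) hL
    (Eventually.of_forall fun a n => coeffSum_remainderSeries_le (p a) n)
    (tendsto_coeffSum_remainderSeries hp)
    (fun k _ => tendsto_coeff_remainderSeries_div hN hs0 hs k) hK
  refine h.congr fun a => ?_
  rw [← hQ.rescale_eq, ← map_pow, PowerSeries.coeff_rescale, inv_pow]
  have h1 := (leadCoeff_pos (p a)).ne'
  have h2 := (rate_pos (p a)).ne'
  field_simp

end Window

/-! ### Summation over the height -/

/-- The function `cos y · exp (y²/2)` decreases on `[0, π/2)` because `y ≤ tan y`. -/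
theorem cos_le_exp_neg_sq_div_two {x : ℝ} (h0 : 0 ≤ x) (h1 : x < Real.pi / 2) :
    Real.cos x ≤ Real.exp (-(x ^ 2 / 2)) := by
  have hd (y : ℝ) : HasDerivAt (fun y => Real.cos y * Real.exp (y ^ 2 / 2))
      (-Real.sin y * Real.exp (y ^ 2 / 2) + Real.cos y * (Real.exp (y ^ 2 / 2) * y)) y := by
    refine (Real.hasDerivAt_cos y).mul (HasDerivAt.exp ?_)
    have := (hasDerivAt_pow 2 y).div_const 2
    simpa using this
  have hanti : AntitoneOn (fun y => Real.cos y * Real.exp (y ^ 2 / 2)) (Set.Icc 0 x) := by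
    refine antitoneOn_of_deriv_nonpos (convex_Icc 0 x)
      (fun y _ => (hd y).continuousAt.continuousWithinAt)
      (fun y _ => (hd y).differentiableAt.differentiableWithinAt) fun y hy => ?_
    rw [interior_Icc] at hy
    rw [(hd y).deriv]
    have hy2 : y < Real.pi / 2 := hy.2.trans h1
    have hc : 0 < Real.cos y := Real.cos_pos_of_mem_Ioo ⟨by linarith [hy.1, Real.pi_pos], hy2⟩
    have ht := Real.le_tan hy.1.le hy2
    rw [Real.tan_eq_sin_div_cos, le_div_iff₀ hc] at ht
    have := Real.exp_pos (y ^ 2 / 2)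
    nlinarith
  have h := hanti (Set.left_mem_Icc.2 h0) (Set.right_mem_Icc.2 h0) h0
  simp only [Real.cos_zero, one_mul, ne_eq, OfNat.ofNat_ne_zero, not_false_eq_true, zero_pow,
    zero_div, Real.exp_zero] at h
  rw [Real.exp_neg, ← one_div, le_div_iff₀ (Real.exp_pos _)]
  exact h

theorem rate_pow_le (p N : ℕ) :
    rate p ^ N ≤ Real.exp (-(Real.pi ^ 2 * N / ((p : ℝ) + 3) ^ 2)) := by
  have h := cos_le_exp_neg_sq_div_two (angle_pos p).le (by linarith [angle_le p, Real.pi_pos])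
  have hc : 0 ≤ Real.cos (angle p) := by linarith [half_le_cos_angle p]
  have h2 : rate p ≤ Real.exp (-(angle p ^ 2)) := by
    calc rate p ≤ Real.exp (-(angle p ^ 2 / 2)) ^ 2 := pow_le_pow_left₀ hc h 2
      _ = _ := by rw [← Real.exp_nat_mul]; congr 1; push_cast; ring
  calc rate p ^ N ≤ Real.exp (-(angle p ^ 2)) ^ N := pow_le_pow_left₀ (rate_pos p).le h2 N
    _ = _ := by
      rw [← Real.exp_nat_mul, angle]; congr 1; rw [div_pow]; ring

/-- With `t = θ² ≤ 1/3`, one has `cos² θ ≥ 1 - t ≥ exp (-(t + t²))`. The correction `π⁴N/M⁴` stays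
bounded near the saddle point, where `N ~ sM³`. -/
theorem le_rate_pow {p : ℕ} (hp : 3 ≤ p) (N : ℕ) :
    Real.exp (-(Real.pi ^ 2 * N / ((p : ℝ) + 3) ^ 2) - Real.pi ^ 4 * N / ((p : ℝ) + 3) ^ 4) ≤
      rate p ^ N := by
  have hp' : (3 : ℝ) ≤ p := by exact_mod_cast hp
  set t := angle p ^ 2 with ht
  have ht0 : 0 ≤ t := sq_nonneg _
  have hang : angle p ≤ Real.pi / 6 := by
    unfold angle
    exact div_le_div_of_nonneg_left Real.pi_pos.le (by norm_num) (by linarith)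
  have ht1 : t ≤ 1 / 3 := by
    have h1 : angle p ≤ 0.53 := by linarith [Real.pi_lt_d2]
    have := angle_pos p
    rw [ht]; nlinarith
  have h1 : 1 - t ≤ rate p := by
    rw [rate, Real.cos_sq']
    have := Real.sin_le (angle_pos p).le
    have := sin_angle_pos p
    rw [ht]; nlinarith
  have h2 : Real.exp (-(t + t ^ 2)) ≤ 1 - t := by
    have h3 := Real.quadratic_le_exp_of_nonneg (x := t + t ^ 2) (by positivity)
    rw [Real.exp_neg, inv_eq_one_div, div_le_iff₀ (Real.exp_pos _)]
    have h4 : 1 ≤ (1 - t) * (1 + (t + t ^ 2) + (t + t ^ 2) ^ 2 / 2) := by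
      have : (1 - t) * (1 + (t + t ^ 2) + (t + t ^ 2) ^ 2 / 2) - 1 =
          t ^ 2 * (1 - t - t ^ 2 - t ^ 3) / 2 := by ring
      have h5 : 0 ≤ 1 - t - t ^ 2 - t ^ 3 := by
        nlinarith [pow_nonneg ht0 2, mul_nonneg ht0 (sub_nonneg.2 ht1)]
      nlinarith [mul_nonneg (sq_nonneg t) h5]
    exact h4.trans (mul_le_mul_of_nonneg_left h3 (by linarith))
  calc _ = Real.exp (-(t + t ^ 2)) ^ N := by
        rw [← Real.exp_nat_mul, ht, angle]; congr 1; rw [div_pow, div_pow]; ring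
    _ ≤ _ := pow_le_pow_left₀ (Real.exp_pos _).le (h2.trans h1) N

theorem leadCoeff_le (p : ℕ) : leadCoeff p ≤ 2 := by
  rw [leadCoeff, div_le_iff₀ (mul_pos (by positivity) (rate_pos p))]
  nlinarith [Real.sin_sq_le_one (angle p), quarter_le_rate p, p.cast_nonneg (α := ℝ)]

theorem le_leadCoeff (p : ℕ) : 4 / ((p : ℝ) + 3) ^ 3 ≤ leadCoeff p := by
  have hM : (0 : ℝ) < p + 3 := by positivity
  have h6 : (2 / ((p : ℝ) + 3)) ^ 2 ≤ Real.sin (angle p) ^ 2 :=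
    pow_le_pow_left₀ (by positivity) (two_div_le_sin_angle p) 2
  rw [leadCoeff, le_div_iff₀ (mul_pos hM (rate_pos _))]
  calc 4 / ((p : ℝ) + 3) ^ 3 * ((p + 3) * rate p) = (2 / ((p : ℝ) + 3)) ^ 2 * rate p := by
        field_simp; ring
    _ ≤ (2 / ((p : ℝ) + 3)) ^ 2 * 1 := by gcongr; exact rate_le_one _
    _ ≤ _ := by rw [mul_one]; exact h6

/-- A crude bound uniform in the height, for use away from the saddle point. The factor `4^K` pays
for replacing `rate^(N-K)` by `rate^N`, as the rate is at least `1/4`. -/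
theorem IsHeightSeries.coeff_pow_le {Q : ℕ → PowerSeries ℝ} (hQ : IsHeightSeries Q) (p K N : ℕ) :
    0 ≤ PowerSeries.coeff N (Q (p + 2) ^ K) ∧
      PowerSeries.coeff N (Q (p + 2) ^ K) ≤ 4 ^ K * (N + 1) ^ K * rate p ^ N := by
  have hr := rate_pos p
  set F : PowerSeries ℝ := PowerSeries.mk fun n => PowerSeries.coeff (n + 1) (Q (p + 2)) with hF
  have hQF : Q (p + 2) = PowerSeries.X * F := by
    ext n
    rcases n with _ | n
    · rw [hQ.coeff_zero]; simp
    · rw [PowerSeries.coeff_succ_X_mul, hF, PowerSeries.coeff_mk]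
  have hF0 : CoeffNonneg F := fun n => by
    rw [hF, PowerSeries.coeff_mk, hQ.coeff_succ]
    exact mul_nonneg (by positivity) (Finset.sum_nonneg fun k _ => by positivity)
  have hF1 : ∀ n, PowerSeries.coeff n F ≤ 1 * rate p ^ n := fun n => by
    rw [hF, PowerSeries.coeff_mk, hQ.coeff_succ_eq]
    have h1 : ∑ i ∈ Finset.range p, (gap p i + Real.sin (angle p) ^ 2) * (rate p - gap p i) ^ n ≤
        ∑ i ∈ Finset.range p, rate p ^ n := by
      refine Finset.sum_le_sum fun i hi => ?_
      have h2 := gap_le_rate p i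
      have h3 := gap_pos (Finset.mem_range.1 hi)
      rw [← sin_sq_eq_gap]
      calc _ ≤ 1 * rate p ^ n := mul_le_mul (Real.sin_sq_le_one _)
            (pow_le_pow_left₀ (by linarith) (by linarith) n)
            (pow_nonneg (by linarith) n) zero_le_one
        _ = _ := one_mul _
    rw [Finset.sum_const, Finset.card_range, nsmul_eq_mul] at h1
    have hy : 0 ≤ rate p ^ n := by positivity
    calc _ ≤ 1 / ((p : ℝ) + 3) * rate p ^ n + 1 / (2 * ((p : ℝ) + 3)) * (p * rate p ^ n) := by
          gcongr
          exact Real.sin_sq_le_one _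
      _ = (((p : ℝ) + 2) / (2 * (p + 3))) * rate p ^ n := by
          generalize rate p ^ n = y
          have : (p : ℝ) + 3 ≠ 0 := by positivity
          field_simp
          ring
      _ ≤ 1 * rate p ^ n := by
          refine mul_le_mul_of_nonneg_right ?_ hy
          rw [div_le_one (by positivity)]; linarith [p.cast_nonneg (α := ℝ)]
  refine ⟨by rw [hQF]; exact (coeffNonneg_X.mul hF0).pow K N, ?_⟩
  rw [hQF, mul_pow, PowerSeries.coeff_X_pow_mul']
  split_ifs with h
  · refine (coeff_pow_le_of_le_geometric hF0 zero_le_one hr.le hF1 K (N - K)).trans ?_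
    have h1 : ((N - K : ℕ) : ℝ) ≤ N := by exact_mod_cast Nat.sub_le N K
    have h2 : rate p ^ (N - K) ≤ 4 ^ K * rate p ^ N := by
      have h3 : 1 ≤ (4 * rate p) ^ K := one_le_pow₀ (by linarith [quarter_le_rate p])
      calc rate p ^ (N - K) ≤ (4 * rate p) ^ K * rate p ^ (N - K) :=
            le_mul_of_one_le_left (by positivity) h3
        _ = 4 ^ K * rate p ^ N := by
            rw [mul_pow, mul_assoc, ← pow_add, Nat.add_sub_cancel' h]
    calc _ ≤ 1 ^ K * ((N : ℝ) + 1) ^ K * (4 ^ K * rate p ^ N) := by gcongr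
      _ = _ := by ring
  · positivity

/-- Pairs `(N, p)` for which `N` is large and `N / (p + 3) ^ 3` is close to `s`. -/
noncomputable def window (s : ℝ) : Filter (ℕ × ℕ) :=
  comap Prod.fst atTop ⊓ comap (fun x : ℕ × ℕ => (x.1 : ℝ) / (x.2 + 3) ^ 3) (𝓝 s)

theorem exists_of_eventually_window {s : ℝ} {P : ℕ × ℕ → Prop} (h : ∀ᶠ x in window s, P x) :
    ∃ N₀ : ℕ, ∃ δ > 0, ∀ N p : ℕ, N₀ ≤ N → |(N : ℝ) / (p + 3) ^ 3 - s| < δ → P (N, p) := by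
  obtain ⟨⟨N₀, δ⟩, ⟨-, hδ⟩, hP⟩ := (((atTop_basis (α := ℕ)).comap Prod.fst).inf
    ((Metric.nhds_basis_ball (x := s)).comap
      fun x : ℕ × ℕ => (x.1 : ℝ) / (x.2 + 3) ^ 3)).eventually_iff.1 h
  exact ⟨N₀, δ, hδ, fun N p hN hp => hP ⟨hN, by simpa [Real.dist_eq] using hp⟩⟩

/-- The weight `e^{-μ M}` of the height, `M = p + 3`. -/
noncomputable def heightWeight (μ : ℝ) (p : ℕ) : ℝ := Real.exp (-(μ * (p + 3)))

theorem heightWeight_pos (μ : ℝ) (p : ℕ) : 0 < heightWeight μ p := Real.exp_pos _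

theorem summable_heightWeight {μ : ℝ} (hμ : 0 < μ) : Summable (heightWeight μ) := by
  have h : Summable fun p : ℕ => Real.exp (-(μ * 3)) * Real.exp (-μ) ^ p :=
    (summable_geometric_of_lt_one (Real.exp_pos _).le
      (by rw [Real.exp_lt_one_iff]; linarith)).mul_left _
  refine h.congr fun p => ?_
  rw [← Real.exp_nat_mul, ← Real.exp_add, heightWeight]; congr 1; ring

/-- The exponent is minimal at `M = x`, with value `3μx/2`. The excess is exact because `2M³ + x³ -
3xM² = (M - x)² (2M + x)`. -/
theorem exponent_eq {μ s x M N : ℝ} (hs : s = μ / (2 * Real.pi ^ 2)) (hN : N = s * x ^ 3)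
    (hM : M ≠ 0) : μ * M + Real.pi ^ 2 * N / M ^ 2 =
      3 / 2 * (μ * x) + μ * ((M - x) ^ 2 / M ^ 2) * (2 * M + x) / 2 := by
  have hpi := Real.pi_pos.ne'
  rw [hN, hs]
  field_simp
  ring

/-- The total weight of the leading terms. -/
noncomputable def leadSum (μ : ℝ) (N : ℕ) : ℝ :=
  ∑' p, heightWeight μ p * (leadCoeff p * rate p ^ N)

theorem summable_heightWeight_mul {μ : ℝ} (hμ : 0 < μ) {f : ℕ → ℝ} (C : ℝ) (hf : ∀ p, 0 ≤ f p)
    (hC : ∀ p, f p ≤ C) : Summable fun p => heightWeight μ p * f p := by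
  refine Summable.of_nonneg_of_le (fun p => mul_nonneg (heightWeight_pos μ p).le (hf p))
    (fun p => ?_) ((summable_heightWeight hμ).mul_right C)
  exact mul_le_mul_of_nonneg_left (hC p) (heightWeight_pos μ p).le

theorem rate_pow_le_one (p N : ℕ) : rate p ^ N ≤ 1 := pow_le_one₀ (rate_pos p).le (rate_le_one p)

theorem summable_lead {μ : ℝ} (hμ : 0 < μ) (N : ℕ) :
    Summable fun p => heightWeight μ p * (leadCoeff p * rate p ^ N) := by
  refine summable_heightWeight_mul hμ 2
    (fun p => mul_nonneg (leadCoeff_pos p).le (pow_nonneg (rate_pos p).le _)) fun p => ?_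
  have := mul_le_mul (leadCoeff_le p) (rate_pow_le_one p N) (pow_nonneg (rate_pos p).le _)
      zero_le_two
  linarith

/-- The location `(N / s) ^ (1 / 3)` of the saddle point. -/
noncomputable def saddle (s : ℝ) (N : ℕ) : ℝ := ((N : ℝ) / s) ^ (3 : ℝ)⁻¹

theorem saddle_nonneg {s : ℝ} (hs : 0 < s) (N : ℕ) : 0 ≤ saddle s N :=
  Real.rpow_nonneg (by positivity) _

theorem eq_mul_saddle_pow {s : ℝ} (hs : 0 < s) (N : ℕ) : (N : ℝ) = s * saddle s N ^ 3 := by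
  have : saddle s N ^ 3 = (N : ℝ) / s := by
    rw [saddle, ← Real.rpow_natCast, ← Real.rpow_mul (by positivity)]
    norm_num
  rw [this]; field_simp

theorem tendsto_saddle {s : ℝ} (hs : 0 < s) : Tendsto (saddle s) atTop atTop :=
  (tendsto_rpow_atTop (by norm_num)).comp (tendsto_natCast_atTop_atTop.atTop_div_const hs)

/-- The single term with `M = ⌈x⌉`, `x` being the saddle point, suffices. -/
theorem exists_le_leadSum {μ s : ℝ} (hμ : 0 < μ) (hs : s = μ / (2 * Real.pi ^ 2)) :
    ∃ c > 0, ∀ᶠ N in atTop,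
      c * (saddle s N ^ 3)⁻¹ * Real.exp (-(3 / 2 * (μ * saddle s N))) ≤ leadSum μ N := by
  have hs0 : 0 < s := by rw [hs]; positivity
  -- The factors come from `4/M³ ≥ 1/(2x³)` (as `M ≤ 2x`), from `M ≤ x + 1`, and from `π⁴N/M⁴ ≤ π⁴s`
  -- (as `M ≥ x ≥ 1`).
  refine ⟨1 / 2 * Real.exp (-μ) * Real.exp (-(Real.pi ^ 4 * s)), by positivity, ?_⟩
  filter_upwards [(tendsto_saddle hs0).eventually_ge_atTop 6] with N hN
  set x := saddle s N with hx
  have hNx : (N : ℝ) = s * x ^ 3 := eq_mul_saddle_pow hs0 N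
  have hx0 : 0 < x := by linarith
  have hceil : 6 ≤ ⌈x⌉₊ := by
    have := Nat.ceil_mono hN
    simpa using this
  obtain ⟨p, hp⟩ : ∃ p : ℕ, ⌈x⌉₊ = p + 3 := ⟨⌈x⌉₊ - 3, by omega⟩
  have hp3 : 3 ≤ p := by omega
  have hM1 : x ≤ (p : ℝ) + 3 := by
    have := Nat.le_ceil x
    rw [hp] at this; exact_mod_cast this
  have hM2 : (p : ℝ) + 3 ≤ x + 1 := by
    have := (Nat.ceil_lt_add_one hx0.le).le
    rw [hp] at this; exact_mod_cast this
  have hterm : heightWeight μ p * (leadCoeff p * rate p ^ N) ≤ leadSum μ N :=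
    (summable_lead hμ N).le_tsum p fun q _ => mul_nonneg (heightWeight_pos μ q).le
      (mul_nonneg (leadCoeff_pos q).le (pow_nonneg (rate_pos q).le _))
  refine le_trans ?_ hterm
  set M : ℝ := (p : ℝ) + 3 with hM
  have hM0 : 0 < M := by linarith
  have h1 : Real.exp (-μ) * Real.exp (-(μ * x)) ≤ heightWeight μ p := by
    rw [← Real.exp_add, heightWeight, Real.exp_le_exp]
    nlinarith
  have h2 : 1 / 2 * (x ^ 3)⁻¹ ≤ leadCoeff p := by
    refine le_trans ?_ (le_leadCoeff p)
    rw [← one_div, div_mul_div_comm, one_mul, div_le_div_iff₀ (by positivity) (by positivity)]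
    have h3 : M ≤ 2 * x := by linarith
    have h4 : M ^ 3 ≤ (2 * x) ^ 3 := pow_le_pow_left₀ hM0.le h3 3
    nlinarith
  have h3 : Real.exp (-(μ * x / 2)) * Real.exp (-(Real.pi ^ 4 * s)) ≤ rate p ^ N := by
    refine le_trans ?_ (le_rate_pow hp3 N)
    rw [← Real.exp_add, Real.exp_le_exp, sub_eq_add_neg]
    refine add_le_add (neg_le_neg ?_) (neg_le_neg ?_)
    · have h5 : Real.pi ^ 2 * N / M ^ 2 ≤ Real.pi ^ 2 * N / x ^ 2 := by gcongr
      refine h5.trans (le_of_eq ?_)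
      have hpi := Real.pi_pos.ne'
      rw [hNx, hs]; field_simp
    · have h5 : Real.pi ^ 4 * N / M ^ 4 ≤ Real.pi ^ 4 * N / x ^ 4 := by gcongr
      refine h5.trans ?_
      have : Real.pi ^ 4 * N / x ^ 4 = Real.pi ^ 4 * s / x := by rw [hNx]; field_simp
      rw [this]
      exact div_le_self (by positivity) (by linarith)
  calc _ = (Real.exp (-μ) * Real.exp (-(μ * x))) * ((1 / 2 * (x ^ 3)⁻¹) *
        (Real.exp (-(μ * x / 2)) * Real.exp (-(Real.pi ^ 4 * s)))) := by
        have : Real.exp (-(3 / 2 * (μ * x))) = Real.exp (-(μ * x)) * Real.exp (-(μ * x / 2)) := by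
          rw [← Real.exp_add]; congr 1; ring
        rw [this]; ring
    _ ≤ _ := by
        have := leadCoeff_pos p
        have := heightWeight_pos μ p
        gcongr

theorem leadSum_pos {μ : ℝ} (hμ : 0 < μ) (N : ℕ) : 0 < leadSum μ N :=
  (summable_lead hμ N).tsum_pos (fun q => mul_nonneg (heightWeight_pos μ q).le
      (mul_nonneg (leadCoeff_pos q).le (pow_nonneg (rate_pos q).le _))) 0
    (mul_pos (heightWeight_pos μ 0) (mul_pos (leadCoeff_pos 0) (pow_pos (rate_pos 0) _)))

/-- Outside the window `(M - x)²/M²` is bounded below, so by `exponent_eq` the exponent exceeds its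
minimum by at least `c (2M + x)`. The part `cx` beats all powers of `N`; the part `2cM` makes the
sum over heights converge. -/
theorem heightWeight_mul_rate_pow_le {μ s δ : ℝ} (hμ : 0 < μ) (hs : s = μ / (2 * Real.pi ^ 2))
    (hδ : 0 < δ) : ∃ c > 0, ∀ N p : ℕ, δ ≤ |(N : ℝ) / (p + 3) ^ 3 - s| →
      heightWeight μ p * rate p ^ N ≤ Real.exp (-(3 / 2 * (μ * saddle s N))) *
        Real.exp (-(c * saddle s N)) * heightWeight (2 * c) p := by
  have hs0 : 0 < s := by rw [hs]; positivity
  -- The entry `1` keeps `y = x/M` below `2`, where `|y³ - 1| ≤ 7 |1 - y|`; the other entry gives `7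
  -- s c₀ ≤ δ`.
  set c₀ : ℝ := min 1 (δ / (7 * s)) with hc₀
  have hc₀0 : 0 < c₀ := lt_min one_pos (by positivity)
  refine ⟨μ * c₀ ^ 2 / 2, by positivity, fun N p h => ?_⟩
  set x := saddle s N with hx
  have hNx : (N : ℝ) = s * x ^ 3 := eq_mul_saddle_pow hs0 N
  have hx0 : 0 ≤ x := saddle_nonneg hs0 N
  set M : ℝ := (p : ℝ) + 3 with hM
  have hM0 : 0 < M := by positivity
  have hy : c₀ ≤ |1 - x / M| := by
    by_contra! hlt
    set y := x / M with hy
    have h1 : (N : ℝ) / M ^ 3 - s = s * (y ^ 3 - 1) := by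
      rw [hNx, hy]; field_simp
    have hc1 : c₀ ≤ 1 := min_le_left _ _
    have hc2 : c₀ ≤ δ / (7 * s) := min_le_right _ _
    have hy0 : 0 ≤ y := by positivity
    have hy2 : y ≤ 2 := by
      have := neg_abs_le (1 - y)
      linarith
    have h2 : |y ^ 3 - 1| ≤ 7 * |1 - y| := by
      have : y ^ 3 - 1 = -((1 - y) * (y ^ 2 + y + 1)) := by ring
      rw [this, abs_neg, abs_mul, mul_comm 7]
      refine mul_le_mul_of_nonneg_left ?_ (abs_nonneg _)
      rw [abs_of_nonneg (by positivity)]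
      nlinarith
    rw [h1, abs_mul, abs_of_pos hs0] at h
    have h3 : s * |y ^ 3 - 1| < s * (7 * (δ / (7 * s))) := by
      refine mul_lt_mul_of_pos_left ?_ hs0
      linarith
    have h4 : s * (7 * (δ / (7 * s))) = δ := by field_simp
    linarith
  have hsq : c₀ ^ 2 ≤ (M - x) ^ 2 / M ^ 2 := by
    have : (M - x) ^ 2 / M ^ 2 = |1 - x / M| ^ 2 := by
      rw [sq_abs, ← div_pow, sub_div, div_self hM0.ne']
    rw [this]
    exact pow_le_pow_left₀ hc₀0.le hy 2
  calc heightWeight μ p * rate p ^ N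
      ≤ heightWeight μ p * Real.exp (-(Real.pi ^ 2 * N / M ^ 2)) :=
        mul_le_mul_of_nonneg_left (rate_pow_le p N) (heightWeight_pos μ p).le
    _ = Real.exp (-(μ * M + Real.pi ^ 2 * N / M ^ 2)) := by
        rw [heightWeight, ← Real.exp_add]; congr 1; ring
    _ ≤ _ := by
        rw [heightWeight, ← Real.exp_add, ← Real.exp_add, Real.exp_le_exp,
          exponent_eq hs hNx hM0.ne', ← hM]
        have h5 : μ * c₀ ^ 2 * (2 * M + x) ≤ μ * ((M - x) ^ 2 / M ^ 2) * (2 * M + x) := by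
          have : 0 ≤ 2 * M + x := by positivity
          gcongr
        linarith

/-- Laplace's method without evaluating the sum: inside the window the terms are compared with those
of `leadSum`. Outside it both are exponentially small against the lower bound for `leadSum`, even
after multiplication by a power of `N`. -/
theorem tendsto_tsum_heightWeight_div {μ s : ℝ} (hμ : 0 < μ) (hs : s = μ / (2 * Real.pi ^ 2))
    {a : ℕ → ℕ → ℝ} {C R : ℝ} {k : ℕ} (hC : 0 ≤ C) (ha0 : ∀ N p, 0 ≤ a N p)
    (ha : ∀ N p, a N p ≤ C * (N + 1) ^ k * rate p ^ N)
    (h : Tendsto (fun x : ℕ × ℕ => a x.1 x.2 / (leadCoeff x.2 * rate x.2 ^ x.1)) (window s) (𝓝 R)) :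
    Tendsto (fun N => (∑' p, heightWeight μ p * a N p) / leadSum μ N) atTop (𝓝 R) := by
  have hs0 : 0 < s := by rw [hs]; positivity
  rw [Metric.tendsto_nhds]
  intro ε hε
  obtain ⟨N₀, δ, hδ, hwin⟩ := exists_of_eventually_window
    (Metric.tendsto_nhds.1 h (ε / 2) (half_pos hε))
  obtain ⟨c, hc, hout⟩ := heightWeight_mul_rate_pow_le hμ hs hδ
  obtain ⟨c', hc', hlow⟩ := exists_le_leadSum hμ hs
  set S := ∑' p, heightWeight (2 * c) p with hS
  have hSsum := summable_heightWeight (μ := 2 * c) (by positivity)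
  have hS0 : 0 ≤ S := tsum_nonneg fun p => (heightWeight_pos _ p).le
  set B : ℕ → ℝ := fun N => (C + 2 * |R|) * (N + 1) ^ k *
    (Real.exp (-(3 / 2 * (μ * saddle s N))) * Real.exp (-(c * saddle s N))) with hB
  have hB0 : ∀ N, 0 ≤ B N := fun N => by simp only [hB]; positivity
  have hpoint : ∀ N, N₀ ≤ N → ∀ p, |heightWeight μ p * a N p -
      R * (heightWeight μ p * (leadCoeff p * rate p ^ N))| ≤
      ε / 2 * (heightWeight μ p * (leadCoeff p * rate p ^ N)) + B N * heightWeight (2 * c) p := by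
    intro N hN p
    have hw := heightWeight_pos μ p
    have hg : 0 < leadCoeff p * rate p ^ N := mul_pos (leadCoeff_pos p) (pow_pos (rate_pos p) N)
    have hw2 := heightWeight_pos (2 * c) p
    have e : heightWeight μ p * a N p - R * (heightWeight μ p * (leadCoeff p * rate p ^ N)) =
        heightWeight μ p * (a N p - R * (leadCoeff p * rate p ^ N)) := by ring
    rw [e, abs_mul, abs_of_pos hw]
    by_cases hd : |(N : ℝ) / (p + 3) ^ 3 - s| < δ
    · have h1 := hwin N p hN hd
      rw [Real.dist_eq] at h1
      have h2 : a N p - R * (leadCoeff p * rate p ^ N) =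
          (a N p / (leadCoeff p * rate p ^ N) - R) * (leadCoeff p * rate p ^ N) := by
        rw [sub_mul, div_mul_cancel₀ _ hg.ne']
      rw [h2, abs_mul, abs_of_pos hg]
      have h3 : heightWeight μ p * (|a N p / (leadCoeff p * rate p ^ N) - R| *
          (leadCoeff p * rate p ^ N)) ≤ heightWeight μ p *
              (ε / 2 * (leadCoeff p * rate p ^ N)) := by
        gcongr
      have := mul_nonneg (hB0 N) hw2.le
      linarith
    · have h1 := hout N p (not_lt.1 hd)
      have hr : 0 < rate p ^ N := pow_pos (rate_pos p) N
      have h2 : |a N p - R * (leadCoeff p * rate p ^ N)| ≤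
          (C + 2 * |R|) * (N + 1) ^ k * rate p ^ N := by
        have h3 : |R * (leadCoeff p * rate p ^ N)| ≤ 2 * |R| * (N + 1) ^ k * rate p ^ N := by
          rw [abs_mul, abs_of_pos hg]
          have h4 : (1 : ℝ) ≤ (N + 1) ^ k := one_le_pow₀ (by linarith [N.cast_nonneg (α := ℝ)])
          calc |R| * (leadCoeff p * rate p ^ N) ≤ |R| * (2 * rate p ^ N) := by
                gcongr; exact leadCoeff_le p
            _ = 2 * |R| * 1 * rate p ^ N := by ring
            _ ≤ _ := by gcongr
        calc _ ≤ |a N p| + |R * (leadCoeff p * rate p ^ N)| := abs_sub _ _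
          _ ≤ C * (N + 1) ^ k * rate p ^ N + 2 * |R| * (N + 1) ^ k * rate p ^ N := by
              rw [abs_of_nonneg (ha0 N p)]
              exact add_le_add (ha N p) h3
          _ = _ := by ring
      calc _ ≤ heightWeight μ p * ((C + 2 * |R|) * (N + 1) ^ k * rate p ^ N) := by gcongr
        _ = (C + 2 * |R|) * (N + 1) ^ k * (heightWeight μ p * rate p ^ N) := by ring
        _ ≤ (C + 2 * |R|) * (N + 1) ^ k * (Real.exp (-(3 / 2 * (μ * saddle s N))) *
              Real.exp (-(c * saddle s N)) * heightWeight (2 * c) p) := by gcongr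
        _ = B N * heightWeight (2 * c) p := by simp only [hB]; ring
        _ ≤ _ := le_add_of_nonneg_left (by positivity)
  have hsuma (N : ℕ) : Summable fun p => heightWeight μ p * a N p :=
    summable_heightWeight_mul hμ (C * (N + 1) ^ k) (ha0 N) fun p => (ha N p).trans
      (mul_le_of_le_one_right (by positivity) (rate_pow_le_one p N))
  have hsumg := summable_lead hμ
  have htot : ∀ N, N₀ ≤ N → |(∑' p, heightWeight μ p * a N p) - R * leadSum μ N| ≤
      ε / 2 * leadSum μ N + B N * S := by
    intro N hN
    rw [leadSum, ← tsum_mul_left, ← (hsuma N).tsum_sub ((hsumg N).mul_left R)]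
    have hsb := ((hsumg N).mul_left (ε / 2)).add (hSsum.mul_left (B N))
    have h1 : Summable fun p => |heightWeight μ p * a N p -
        R * (heightWeight μ p * (leadCoeff p * rate p ^ N))| :=
      Summable.of_nonneg_of_le (fun p => abs_nonneg _) (hpoint N hN) hsb
    calc _ ≤ ∑' p, |heightWeight μ p * a N p -
        R * (heightWeight μ p * (leadCoeff p * rate p ^ N))| := by
          have := norm_tsum_le_tsum_norm (f := fun p => heightWeight μ p * a N p -
            R * (heightWeight μ p * (leadCoeff p * rate p ^ N))) h1
          simpa only [Real.norm_eq_abs] using this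
      _ ≤ _ := h1.tsum_le_tsum (hpoint N hN) hsb
      _ = _ := by
          rw [((hsumg N).mul_left (ε / 2)).tsum_add (hSsum.mul_left (B N)), tsum_mul_left,
            tsum_mul_left]
  have hBlim : Tendsto (fun N => (C + 2 * |R|) * (s + 1) ^ k / c' * S *
      (saddle s N ^ (3 * k + 3) * Real.exp (-(c * saddle s N)))) atTop (𝓝 0) := by
    have := ((tendsto_pow_mul_exp_neg_mul (3 * k + 3) hc).comp (tendsto_saddle hs0)).const_mul
      ((C + 2 * |R|) * (s + 1) ^ k / c' * S)
    rwa [mul_zero] at this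
  filter_upwards [hBlim.eventually_lt_const (half_pos hε), hlow, eventually_ge_atTop N₀,
    (tendsto_saddle hs0).eventually_ge_atTop 1] with N h1 h2 h3 h4
  have hG := leadSum_pos hμ N
  have h5 := htot N h3
  rw [Real.dist_eq]
  have e : (∑' p, heightWeight μ p * a N p) / leadSum μ N - R =
      ((∑' p, heightWeight μ p * a N p) - R * leadSum μ N) / leadSum μ N := by
    rw [sub_div, mul_div_cancel_right₀ _ hG.ne']
  rw [e, abs_div, abs_of_pos hG, div_lt_iff₀ hG]
  have hNx := eq_mul_saddle_pow hs0 N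
  set x := saddle s N with hx
  have hx3 : 1 ≤ x ^ 3 := one_le_pow₀ h4
  have h6 : B N * S < ε / 2 * leadSum μ N := by
    have hN1 : (N : ℝ) + 1 ≤ (s + 1) * x ^ 3 := by rw [hNx]; linarith
    calc B N * S ≤ (C + 2 * |R|) * ((s + 1) * x ^ 3) ^ k *
          (Real.exp (-(3 / 2 * (μ * x))) * Real.exp (-(c * x))) * S := by
          simp only [hB]; rw [← hx]; gcongr
      _ = ((C + 2 * |R|) * (s + 1) ^ k / c' * S * (x ^ (3 * k + 3) * Real.exp (-(c * x)))) *
          (c' * (x ^ 3)⁻¹ * Real.exp (-(3 / 2 * (μ * x)))) := by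
          have : x ≠ 0 := by positivity
          rw [mul_pow, ← pow_mul, pow_add]; field_simp
      _ < ε / 2 * (c' * (x ^ 3)⁻¹ * Real.exp (-(3 / 2 * (μ * x)))) :=
          mul_lt_mul_of_pos_right h1 (by positivity)
      _ ≤ _ := by gcongr
  linarith

/-- The polynomial `p_L(μ) = ∑_{j ≥ 1} (L choose j) μ^{j-1} / (j-1)!`. -/
noncomputable def spinePoly (L : ℕ) (μ : ℝ) : ℝ :=
  ∑ j ∈ Finset.range L, (L.choose (j + 1) : ℝ) * (μ ^ j / j.factorial)

namespace IsHeightSeries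

variable {Q : ℕ → PowerSeries ℝ}

/-- The height partition function of `K`-tuples of trees. -/
noncomputable def heightSum (Q : ℕ → PowerSeries ℝ) (μ : ℝ) (K N : ℕ) : ℝ :=
  ∑' m : ℕ, Real.exp (-(μ * m)) * PowerSeries.coeff N (Q m ^ K)

theorem eq_one (hQ : IsHeightSeries Q) : Q 1 = PowerSeries.C (1 / 4 : ℝ) * PowerSeries.X := by
  have := hQ.succ 0
  rwa [hQ.zero, sub_zero, mul_one] at this

/-- Heights `0` and `1` do not contribute: `Q 0 = 0`, and `Q 1 ^ K` has only the coefficient of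
index `K < N`. The factor `e^μ` accounts for `m = p + 2` against `M = p + 3`. -/
theorem heightSum_eq (hQ : IsHeightSeries Q) {μ : ℝ} (hμ : 0 < μ) {K N : ℕ} (hK : 1 ≤ K)
    (hN : K < N) : heightSum Q μ K N =
      Real.exp μ * ∑' p, heightWeight μ p * PowerSeries.coeff N (Q (p + 2) ^ K) := by
  set f : ℕ → ℝ := fun m => Real.exp (-(μ * m)) * PowerSeries.coeff N (Q m ^ K) with hf
  have hterm (p : ℕ) : f (p + 2) =
      Real.exp μ * (heightWeight μ p * PowerSeries.coeff N (Q (p + 2) ^ K)) := by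
    simp only [hf]
    rw [heightWeight, ← mul_assoc, ← Real.exp_add]
    congr 2; push_cast; ring
  have hsum : Summable fun p : ℕ => f (p + 2) := by
    simp only [hterm]
    refine Summable.mul_left _ (summable_heightWeight_mul hμ (4 ^ K * ((N : ℝ) + 1) ^ K)
      (fun p => (hQ.coeff_pow_le p K N).1) fun p => (hQ.coeff_pow_le p K N).2.trans ?_)
    exact mul_le_of_le_one_right (by positivity) (rate_pow_le_one p N)
  have h0 : f 0 = 0 := by
    simp only [hf]
    rw [hQ.zero, zero_pow (by omega), map_zero, mul_zero]
  have h1 : f 1 = 0 := by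
    simp only [hf]
    rw [hQ.eq_one, mul_pow, ← map_pow, PowerSeries.coeff_C_mul, PowerSeries.coeff_X_pow,
      if_neg hN.ne', mul_zero, mul_zero]
  have h := hsum.sum_add_tsum_nat_add' (f := f)
  rw [Finset.sum_range_succ, Finset.sum_range_one, h0, h1, add_zero, zero_add] at h
  rw [heightSum, ← h, ← tsum_mul_left]
  exact tsum_congr hterm

theorem tendsto_fst_window (s : ℝ) : Tendsto Prod.fst (window s) atTop :=
  tendsto_comap.mono_left inf_le_left

theorem tendsto_ratio_window (s : ℝ) :
    Tendsto (fun x : ℕ × ℕ => (x.1 : ℝ) / (x.2 + 3) ^ 3) (window s) (𝓝 s) :=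
  tendsto_comap.mono_left inf_le_right

/-- At the saddle point `sπ² = μ/2`, so the powers of `1/2` in all terms of the window limit combine
to `(1/2)^(K-1)`. -/
theorem tendsto_heightSum_div_leadSum (hQ : IsHeightSeries Q) {μ : ℝ} (hμ : 0 < μ) {K : ℕ}
    (hK : 1 ≤ K) : Tendsto (fun N => heightSum Q μ K N / leadSum μ N) atTop
      (𝓝 (Real.exp μ * ((1 / 2) ^ (K - 1) * spinePoly K μ))) := by
  set s := μ / (2 * Real.pi ^ 2) with hs
  have hs0 : 0 < s := by rw [hs]; positivity
  have h1 := hQ.tendsto_coeff_pow_div (tendsto_fst_window s) hs0 (tendsto_ratio_window s) hK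
  have h2 := tendsto_tsum_heightWeight_div (a := fun N p => PowerSeries.coeff N (Q (p + 2) ^ K))
    (C := 4 ^ K) (k := K) hμ hs (by positivity) (fun N p => (hQ.coeff_pow_le p K N).1)
    (fun N p => (hQ.coeff_pow_le p K N).2) h1
  refine ((h2.const_mul (Real.exp μ)).congr' ?_).trans (le_of_eq ?_)
  · filter_upwards [eventually_gt_atTop K] with N hN
    rw [hQ.heightSum_eq hμ hK hN, mul_div_assoc]
  · congr 2
    rw [spinePoly, Finset.mul_sum]
    refine Finset.sum_congr rfl fun j hj => ?_
    rw [Finset.mem_range] at hj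
    have e : s * Real.pi ^ 2 = μ * (1 / 2) := by
      have := Real.pi_pos.ne'
      rw [hs]; field_simp
    rw [e, mul_pow, show K - 1 = (K - (j + 1)) + j by omega, pow_add]
    ring

/-- The rate tends to `1` in the window, so a bounded shift of `N` is invisible once the growth
`4^N` has been absorbed into `X / 4`. -/
theorem tendsto_leadSum_succ {μ : ℝ} (hμ : 0 < μ) :
    Tendsto (fun N => leadSum μ (N + 1) / leadSum μ N) atTop (𝓝 1) := by
  set s := μ / (2 * Real.pi ^ 2) with hs
  have hs0 : 0 < s := by rw [hs]; positivity
  have hp := tendsto_add_three_of_window (tendsto_fst_window s) hs0 (tendsto_ratio_window s)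
  have h2 := tendsto_tsum_heightWeight_div (a := fun N p => leadCoeff p * rate p ^ (N + 1))
    (C := 2) (k := 0) (R := 1) hμ hs (by positivity)
    (fun N p => mul_nonneg (leadCoeff_pos p).le (pow_nonneg (rate_pos p).le _))
    (fun N p => ?_) ?_
  · exact h2
  · rw [pow_zero, mul_one, pow_succ, ← mul_assoc]
    have h := pow_nonneg (rate_pos p).le N
    calc leadCoeff p * rate p ^ N * rate p ≤ leadCoeff p * rate p ^ N * 1 :=
          mul_le_mul_of_nonneg_left (rate_le_one p) (mul_nonneg (leadCoeff_pos p).le h)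
      _ ≤ 2 * rate p ^ N := by rw [mul_one]; exact mul_le_mul_of_nonneg_right (leadCoeff_le p) h
  · refine (tendsto_rate hp).2.congr fun x => ?_
    have h1 := (leadCoeff_pos x.2).ne'
    have h3 := (rate_pos x.2).ne'
    rw [pow_succ]
    field_simp

theorem tendsto_leadSum_add {μ : ℝ} (hμ : 0 < μ) (a : ℕ) :
    Tendsto (fun N => leadSum μ (N + a) / leadSum μ N) atTop (𝓝 1) := by
  induction a with
  | zero =>
    refine tendsto_const_nhds.congr fun N => ?_
    rw [add_zero, div_self (leadSum_pos hμ N).ne']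
  | succ a ih =>
    have h := ((tendsto_leadSum_succ hμ).comp (tendsto_add_atTop_nat a)).mul ih
    rw [mul_one] at h
    refine h.congr fun N => ?_
    have := (leadSum_pos hμ (N + a)).ne'
    simp only [Function.comp]
    rw [div_mul_div_cancel₀ this, add_assoc]

theorem tendsto_heightSum_div (hQ : IsHeightSeries Q) {μ : ℝ} (hμ : 0 < μ) {K : ℕ} (hK : 1 ≤ K)
    (a b : ℕ) : Tendsto (fun N => heightSum Q μ K (N + a) / heightSum Q μ 1 (N + b)) atTop
      (𝓝 ((1 / 2) ^ (K - 1) * spinePoly K μ)) := by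
  have h (K : ℕ) (hK : 1 ≤ K) (a : ℕ) : Tendsto (fun N => heightSum Q μ K (N + a) / leadSum μ N)
      atTop (𝓝 (Real.exp μ * ((1 / 2) ^ (K - 1) * spinePoly K μ))) := by
    have := ((hQ.tendsto_heightSum_div_leadSum hμ hK).comp (tendsto_add_atTop_nat a)).mul
      (tendsto_leadSum_add hμ a)
    rw [mul_one] at this
    refine this.congr fun N => ?_
    have := (leadSum_pos hμ (N + a)).ne'
    simp only [Function.comp]
    rw [div_mul_div_cancel₀ this]
  have h1 := h 1 le_rfl b
  have e : Real.exp μ * ((1 / 2) ^ (1 - 1) * spinePoly 1 μ) = Real.exp μ := by simp [spinePoly]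
  rw [e] at h1
  have h2 := (h K hK a).div h1 (Real.exp_pos μ).ne'
  refine (h2.congr fun N => ?_).trans (le_of_eq ?_)
  · rw [Pi.div_apply, div_div_div_cancel_right₀ (leadSum_pos hμ N).ne']
  · rw [mul_div_cancel_left₀ _ (Real.exp_pos μ).ne']

end IsHeightSeries

/-! ### Balls, heights and grafting -/

theorem mem_ball_iff {T : PlanarTree} {r : ℕ} {w : List ℕ} :
    w ∈ T.ball r ↔ w ∈ T.verts ∧ w.length + 1 ≤ r := Iff.rfl

theorem mem_level_iff {T : PlanarTree} {r : ℕ} {w : List ℕ} :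
    w ∈ T.level r ↔ w ∈ T.verts ∧ w.length + 1 = r := Iff.rfl

/-- If the balls of radius `r` differ, only radii below `r` are admissible and the distance is at
least `1/(r-1) > 1/r`. Radius `1` is trivial and is excluded first, so that `r - 1` is positive. -/
theorem mem_closedBall_iff {T T₀ : PlanarTree} {r : ℕ} (hr : 1 ≤ r) :
    T ∈ Metric.closedBall T₀ (1 / (r : ℝ)) ↔ T.ball r = T₀.ball r := by
  rw [Metric.mem_closedBall]
  change sInf (distSet T T₀) ≤ 1 / (r : ℝ) ↔ _
  constructor
  · intro h
    by_contra hne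
    have hr2 : 2 ≤ r := by
      rcases hr.lt_or_eq with h | rfl
      · exact h
      · exact absurd (by rw [ball_one, ball_one]) hne
    have hr' : (2 : ℝ) ≤ r := by exact_mod_cast hr2
    have hle : 1 / ((r : ℝ) - 1) ≤ sInf (distSet T T₀) := by
      refine le_csInf (distSet_nonempty T T₀) ?_
      rintro x ⟨q, hq1, hq, rfl⟩
      have hqr : q < r := by
        by_contra! hlt
        exact hne (ball_eq_of_le hlt hq)
      have hq1' : (1 : ℝ) ≤ q := by exact_mod_cast hq1
      have hqr' : (q : ℝ) + 1 ≤ r := by exact_mod_cast hqr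
      exact one_div_le_one_div_of_le (by linarith) (by linarith)
    have hlt : 1 / (r : ℝ) < 1 / ((r : ℝ) - 1) :=
      one_div_lt_one_div_of_lt (by linarith) (by linarith)
    linarith
  · intro h
    exact csInf_le (distSet_bddBelow T T₀) ⟨r, hr, h, rfl⟩

theorem height_le_iff {T : PlanarTree} {m : ℕ} :
    T.height ≤ m ↔ ∀ w ∈ T.verts, w.length + 1 ≤ m := by
  simp only [height, iSup₂_le_iff, vertexHeight]
  exact forall₂_congr fun w _ => by norm_cast

theorem one_le_of_height_eq {T : PlanarTree} {r : ℕ} (h : T.height = r) : 1 ≤ r :=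
  height_le_iff.1 h.le [] T.nil_mem

theorem length_lt_of_height_eq {T : PlanarTree} {r : ℕ} (h : T.height = r) {w : List ℕ}
    (hw : w ∈ T.verts) : w.length + 1 ≤ r := height_le_iff.1 h.le w hw

theorem ball_eq_verts {T : PlanarTree} {r : ℕ} (h : T.height ≤ r) : T.ball r = T.verts := by
  ext w
  rw [mem_ball_iff, and_iff_left_iff_imp]
  exact fun hw => height_le_iff.1 h w hw

theorem level_nonempty_of_height_eq {T : PlanarTree} {r : ℕ} (h : T.height = r) :
    (T.level r).Nonempty := by
  by_contra hne
  have hr := one_le_of_height_eq h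
  have : T.height ≤ (r - 1 : ℕ) := height_le_iff.2 fun w hw => by
    have h1 := length_lt_of_height_eq h hw
    have h2 : w.length + 1 ≠ r := fun he => hne ⟨w, hw, he⟩
    omega
  rw [h, Nat.cast_le] at this
  omega

theorem finite_ball (T : PlanarTree) (r : ℕ) : (T.ball r).Finite := by
  refine ((Set.finite_Iic r).biUnion fun s _ => T.finite_level s).subset ?_
  rintro w ⟨hw, h⟩
  simp only [Set.mem_iUnion]
  exact ⟨vertexHeight w, h, hw, rfl⟩

theorem append_mem_of_append_mem (T : PlanarTree) {u v : List ℕ} (h : u ++ v ∈ T.verts) :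
    u ∈ T.verts := by
  have := T.take_mem h u.length
  rwa [List.take_left'] at this
  rfl

/-- The tree of descendants of the vertex `w`, the parent of `w` being the new root. -/
def branch (T : PlanarTree) (w : List ℕ) (hw : w ∈ T.verts) : PlanarTree where
  verts := {u | w ++ u ∈ T.verts}
  nil_mem := by simpa using hw
  parent_mem u k h := T.parent_mem (w ++ u) k (by simpa using h)
  left_mem u j k hjk h := by
    have := T.left_mem (w ++ u) j k hjk (by simpa using h)
    simpa using this
  finite_offspring u := by
    have := T.finite_offspring (w ++ u)
    simpa using this

/-- The family of branches at the vertices of height `r` of a tree that agrees with `T₀` up to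
height `r`. -/
def branches {T T₀ : PlanarTree} {r : ℕ} (h : T.ball r = T₀.ball r) (i : T₀.level r) :
    PlanarTree :=
  T.branch i.1 ((h ▸ (⟨i.2.1, i.2.2.le⟩ : i.1 ∈ T₀.ball r) : i.1 ∈ T.ball r)).1

/-! ### Grafting: inverse, levels, size and height -/

section Graft

variable {T₀ : PlanarTree} {r : ℕ}

theorem mem_graft {S : T₀.level r → PlanarTree} {w : List ℕ} :
    w ∈ (T₀.graft r S).verts ↔ w ∈ T₀.verts ∨ ∃ i : T₀.level r, ∃ u ∈ (S i).verts, w = i.1 ++ u :=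
  Iff.rfl

theorem append_mem_graft (hT₀ : T₀.height = r) {S : T₀.level r → PlanarTree} {i : T₀.level r}
    {u : List ℕ} : i.1 ++ u ∈ (T₀.graft r S).verts ↔ u ∈ (S i).verts := by
  rw [mem_graft]
  constructor
  · rintro (h | ⟨j, v, hv, h⟩)
    · have h1 := length_lt_of_height_eq hT₀ h
      have h2 : i.1.length + 1 = r := i.2.2
      rw [List.length_append] at h1
      have : u = [] := List.length_eq_zero_iff.1 (by omega)
      rw [this]; exact (S i).nil_mem
    · have h1 : i.1.length + 1 = r := i.2.2
      have h2 : j.1.length + 1 = r := j.2.2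
      obtain ⟨hij, rfl⟩ := List.append_inj h (by omega)
      rw [Subtype.ext hij]; exact hv
  · exact fun h => Or.inr ⟨i, u, h, rfl⟩

theorem ball_graft_self (S : T₀.level r → PlanarTree) :
    (T₀.graft r S).ball r = T₀.ball r := by
  ext w
  rw [mem_ball_iff, mem_ball_iff, and_congr_left_iff]
  intro hw
  rw [mem_graft, or_iff_left_iff_imp]
  rintro ⟨i, u, hu, rfl⟩
  have h1 : i.1.length + 1 = r := i.2.2
  rw [List.length_append] at hw
  have : u = [] := List.length_eq_zero_iff.1 (by omega)
  rw [this, List.append_nil]; exact i.2.1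

theorem graft_branches {T : PlanarTree} (h : T.ball r = T₀.ball r) (hT₀ : T₀.height = r) :
    T₀.graft r (branches h) = T := by
  ext w
  rw [mem_graft]
  have hr := one_le_of_height_eq hT₀
  constructor
  · rintro (hw | ⟨i, u, hu, rfl⟩)
    · have : w ∈ T₀.ball r := ⟨hw, length_lt_of_height_eq hT₀ hw⟩
      rw [← h] at this; exact this.1
    · exact hu
  · intro hw
    by_cases hl : w.length + 1 ≤ r
    · left
      have : w ∈ T.ball r := ⟨hw, hl⟩
      rw [h] at this; exact this.1
    · right
      have h1 : w.take (r - 1) ∈ T.ball r := by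
        refine ⟨T.take_mem hw _, ?_⟩
        simp only [vertexHeight, List.length_take]; omega
      rw [h] at h1
      refine ⟨⟨w.take (r - 1), h1.1, ?_⟩, w.drop (r - 1), ?_, ?_⟩
      · simp only [vertexHeight, List.length_take]; omega
      · change w.take (r - 1) ++ w.drop (r - 1) ∈ T.verts
        rwa [List.take_append_drop]
      · simp

theorem graft_injective (hT₀ : T₀.height = r) : Function.Injective (T₀.graft r) := by
  intro S S' h
  funext i
  ext u
  rw [← append_mem_graft hT₀, ← append_mem_graft hT₀ (S := S'), h]

theorem ball_graft (hT₀ : T₀.height = r) (S : T₀.level r → PlanarTree) {s : ℕ} :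
    (T₀.graft r S).ball (r + s) =
      T₀.verts ∪ ⋃ i : T₀.level r, (fun u => i.1 ++ u) '' (S i).ball (s + 1) := by
  ext w
  rw [mem_ball_iff, mem_graft, Set.mem_union, Set.mem_iUnion, or_and_right]
  refine or_congr ?_ ?_
  · rw [and_iff_left_iff_imp]
    intro hw
    have := length_lt_of_height_eq hT₀ hw
    omega
  · constructor
    · rintro ⟨⟨i, u, hu, rfl⟩, hl⟩
      have h1 : i.1.length + 1 = r := i.2.2
      rw [List.length_append] at hl
      exact ⟨i, u, ⟨hu, by simp only [vertexHeight]; omega⟩, rfl⟩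
    · rintro ⟨i, u, ⟨hu, hl⟩, rfl⟩
      have h1 : i.1.length + 1 = r := i.2.2
      simp only [vertexHeight] at hl
      refine ⟨⟨i, u, hu, rfl⟩, ?_⟩
      rw [List.length_append]; omega

theorem verts_graft (S : T₀.level r → PlanarTree) : (T₀.graft r S).verts =
    T₀.verts ∪ ⋃ i : T₀.level r, (fun u => i.1 ++ u) '' (S i).verts := by
  ext w
  rw [mem_graft, Set.mem_union, Set.mem_iUnion]
  refine or_congr Iff.rfl (exists_congr fun i => ?_)
  rw [Set.mem_image]
  exact exists_congr fun u => and_congr Iff.rfl eq_comm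

theorem level_graft (hT₀ : T₀.height = r) (S : T₀.level r → PlanarTree) {s : ℕ} :
    (T₀.graft r S).level (r + s) =
      ⋃ i : T₀.level r, (fun u => i.1 ++ u) '' (S i).level (s + 1) := by
  ext w
  rw [mem_level_iff, mem_graft, Set.mem_iUnion]
  constructor
  · rintro ⟨hw | ⟨i, u, hu, rfl⟩, hl⟩
    · have h1 := length_lt_of_height_eq hT₀ hw
      have : s = 0 := by omega
      subst this
      exact ⟨⟨w, hw, hl⟩, [], ⟨(S _).nil_mem, rfl⟩, by simp⟩
    · have h1 : i.1.length + 1 = r := i.2.2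
      rw [List.length_append] at hl
      exact ⟨i, u, ⟨hu, by simp only [vertexHeight]; omega⟩, rfl⟩
  · rintro ⟨i, u, ⟨hu, hl⟩, rfl⟩
    have h1 : i.1.length + 1 = r := i.2.2
    simp only [vertexHeight] at hl
    refine ⟨Or.inr ⟨i, u, hu, rfl⟩, ?_⟩
    rw [List.length_append]; omega

theorem pairwise_disjoint_append (A : T₀.level r → Set (List ℕ)) :
    Pairwise (Function.onFun Disjoint fun i : T₀.level r => (fun u => i.1 ++ u) '' A i) := by
  intro i j hij
  rw [Function.onFun, Set.disjoint_left]
  rintro _ ⟨u, _, rfl⟩ ⟨v, _, h⟩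
  have h1 : i.1.length + 1 = r := i.2.2
  have h2 : j.1.length + 1 = r := j.2.2
  exact hij (Subtype.ext (List.append_inj h (by omega)).1.symm)

theorem ncard_iUnion_append (A : T₀.level r → Set (List ℕ)) (hA : ∀ i, (A i).Finite) :
    (⋃ i : T₀.level r, (fun u => i.1 ++ u) '' A i).ncard = ∑ i, (A i).ncard := by
  rw [← finsum_eq_sum_of_fintype, Set.ncard_iUnion_of_finite (fun i => (hA i).image _)
    (pairwise_disjoint_append A)]
  · exact finsum_congr fun i => Set.ncard_image_of_injective _ fun u v h =>
        List.append_cancel_left h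

/-- The vertices of `T₀` at height `r` are exactly those shared with the grafted pieces, and are
counted twice on the right. -/
theorem ncard_union_append (hT₀ : T₀.height = r) (hfin : T₀.IsFinite)
    (A : T₀.level r → Set (List ℕ)) (hA : ∀ i, (A i).Finite) (hnil : ∀ i, [] ∈ A i) :
    (T₀.verts ∪ ⋃ i : T₀.level r, (fun u => i.1 ++ u) '' A i).ncard + Fintype.card (T₀.level r) =
      T₀.size + ∑ i, (A i).ncard := by
  have hinter : T₀.verts ∩ ⋃ i : T₀.level r, (fun u => i.1 ++ u) '' A i = T₀.level r := by
    ext w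
    rw [Set.mem_inter_iff, Set.mem_iUnion]
    constructor
    · rintro ⟨hw, i, u, hu, rfl⟩
      have h1 := length_lt_of_height_eq hT₀ hw
      have h2 : i.1.length + 1 = r := i.2.2
      rw [List.length_append] at h1
      have : u = [] := List.length_eq_zero_iff.1 (by omega)
      simp [this]
    · intro hw
      exact ⟨hw.1, ⟨w, hw⟩, [], hnil _, by simp⟩
  rw [← ncard_iUnion_append A hA, ← Nat.card_eq_fintype_card, Nat.card_coe_set_eq]
  rw [← congrArg Set.ncard hinter]
  exact Set.ncard_union_add_ncard_inter _ _ hfin (Set.finite_iUnion fun i => (hA i).image _)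

theorem isFinite_graft_iff {S : T₀.level r → PlanarTree} (hfin : T₀.IsFinite) :
    (T₀.graft r S).IsFinite ↔ ∀ i, (S i).IsFinite := by
  rw [IsFinite, verts_graft]
  constructor
  · intro h i
    refine Set.Finite.of_finite_image (f := fun u => i.1 ++ u) (h.subset ?_)
      fun u _ v _ h => List.append_cancel_left h
    exact Set.subset_union_of_subset_right
      (Set.subset_iUnion (fun i : T₀.level r => (fun u => i.1 ++ u) '' (S i).verts) i) _
  · exact fun h => Set.Finite.union hfin (Set.finite_iUnion fun i => (h i).image _)

theorem size_graft (hT₀ : T₀.height = r) (hfin : T₀.IsFinite) {S : T₀.level r → PlanarTree}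
    (hS : ∀ i, (S i).IsFinite) : (T₀.graft r S).size + Fintype.card (T₀.level r) =
      T₀.size + ∑ i, (S i).size := by
  rw [size, verts_graft]
  exact ncard_union_append hT₀ hfin _ hS fun i => (S i).nil_mem

/-- The root edge of a grafted tree is shared, hence the offset `r - 1`. A top vertex exists, which
forces `m ≥ 1` when the right side holds. -/
theorem height_graft_le_iff (hT₀ : T₀.height = r) {S : T₀.level r → PlanarTree} {m : ℕ} :
    (T₀.graft r S).height ≤ (r - 1 + m : ℕ) ↔ ∀ i, (S i).height ≤ m := by
  have hr := one_le_of_height_eq hT₀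
  simp only [height_le_iff]
  constructor
  · intro h i u hu
    have h1 := h _ ((append_mem_graft hT₀).2 hu)
    have h2 : i.1.length + 1 = r := i.2.2
    rw [List.length_append] at h1
    omega
  · intro h w hw
    obtain ⟨w₀, hw₀⟩ := level_nonempty_of_height_eq hT₀
    have hm := h ⟨w₀, hw₀⟩ [] (S _).nil_mem
    rcases mem_graft.1 hw with hw | ⟨i, u, hu, rfl⟩
    · have := length_lt_of_height_eq hT₀ hw
      simp only [List.length_nil] at hm
      omega
    · have h1 := h i u hu
      have h2 : i.1.length + 1 = r := i.2.2
      rw [List.length_append]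
      omega

end Graft

/-! ### Counting trees by size and height -/

open scoped Classical in
/-- The trees of size `n` and height at most `m`. -/
noncomputable def treesOf (m n : ℕ) : Finset PlanarTree :=
  (finite_ofSize n).toFinset.filter fun T => T.height ≤ m

theorem mem_treesOf {m n : ℕ} {T : PlanarTree} :
    T ∈ treesOf m n ↔ (T.IsFinite ∧ T.size = n) ∧ T.height ≤ m := by
  simp [treesOf, ofSize]

/-- The tree whose first child of `i₁` carries the branch `A` and whose other branches are those of
`B`. -/
def cons (A B : PlanarTree) : PlanarTree where
  verts := {w | match w with
    | [] => True
    | 0 :: u => u ∈ A.verts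
    | (k + 1) :: u => k :: u ∈ B.verts}
  nil_mem := trivial
  parent_mem w k h := by
    rcases w with _ | ⟨_ | l, v⟩
    · trivial
    · exact A.parent_mem v k h
    · exact B.parent_mem (l :: v) k h
  left_mem w j k hjk h := by
    rcases w with _ | ⟨_ | l, v⟩
    · rcases k with _ | k
      · omega
      · rcases j with _ | j
        · exact A.nil_mem
        · exact B.left_mem [] j k (by omega) h
    · exact A.left_mem v j k hjk h
    · exact B.left_mem (l :: v) j k hjk h
  finite_offspring w := by
    rcases w with _ | ⟨_ | l, v⟩
    · refine ((Set.finite_singleton 0).union ((B.finite_offspring []).image Nat.succ)).subset ?_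
      rintro (_ | k) hk
      · exact Or.inl rfl
      · exact Or.inr ⟨k, hk, rfl⟩
    · exact A.finite_offspring v
    · exact B.finite_offspring (l :: v)

/-- The tree without the branch at the first child of `i₁`. -/
def tail (T : PlanarTree) : PlanarTree where
  verts := {w | match w with
    | [] => True
    | k :: u => (k + 1) :: u ∈ T.verts}
  nil_mem := trivial
  parent_mem w k h := by
    rcases w with _ | ⟨l, v⟩
    · trivial
    · exact T.parent_mem ((l + 1) :: v) k h
  left_mem w j k hjk h := by
    rcases w with _ | ⟨l, v⟩
    · exact T.left_mem [] (j + 1) (k + 1) (by omega) h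
    · exact T.left_mem ((l + 1) :: v) j k hjk h
  finite_offspring w := by
    rcases w with _ | ⟨l, v⟩
    · refine Set.Finite.of_finite_image (f := Nat.succ) ((T.finite_offspring []).subset ?_)
        Nat.succ_injective.injOn
      rintro _ ⟨k, hk, rfl⟩
      exact hk
    · exact T.finite_offspring ((l + 1) :: v)

theorem cons_branch_tail {T : PlanarTree} (h : [0] ∈ T.verts) :
    cons (T.branch [0] h) T.tail = T := by
  ext w
  rcases w with _ | ⟨_ | l, v⟩
  · exact ⟨fun _ => T.nil_mem, fun _ => trivial⟩
  · exact Iff.rfl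
  · exact Iff.rfl

theorem cons_injective {A A' B B' : PlanarTree} (h : cons A B = cons A' B') : A = A' ∧ B = B' := by
  have hv := congrArg verts h
  constructor
  · ext u
    exact Set.ext_iff.1 hv (0 :: u)
  · ext u
    rcases u with _ | ⟨l, v⟩
    · exact ⟨fun _ => B'.nil_mem, fun _ => B.nil_mem⟩
    · exact Set.ext_iff.1 hv ((l + 1) :: v)

/-- The relabelling of the vertices of `B` in `cons A B`. -/
def shiftFirst : List ℕ → List ℕ
  | [] => []
  | k :: u => (k + 1) :: u

theorem shiftFirst_injective : Function.Injective shiftFirst := by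
  rintro (_ | ⟨k, u⟩) (_ | ⟨l, v⟩) h <;> simp_all [shiftFirst]

theorem verts_cons (A B : PlanarTree) :
    (cons A B).verts = (fun u => 0 :: u) '' A.verts ∪ shiftFirst '' B.verts := by
  ext w
  rcases w with _ | ⟨_ | l, v⟩
  · exact ⟨fun _ => Or.inr ⟨[], B.nil_mem, rfl⟩, fun _ => trivial⟩
  · constructor
    · exact fun h => Or.inl ⟨v, h, rfl⟩
    · rintro (⟨u, hu, h⟩ | ⟨u, hu, h⟩)
      · obtain rfl : u = v := by simpa using h
        exact hu
      · rcases u with _ | ⟨k, u⟩ <;> simp [shiftFirst] at h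
  · constructor
    · exact fun h => Or.inr ⟨l :: v, h, rfl⟩
    · rintro (⟨u, hu, h⟩ | ⟨u, hu, h⟩)
      · simp at h
      · rcases u with _ | ⟨k, u⟩
        · simp [shiftFirst] at h
        · obtain ⟨rfl, rfl⟩ : k = l ∧ u = v := by simpa [shiftFirst] using h
          exact hu

theorem isFinite_cons {A B : PlanarTree} : (cons A B).IsFinite ↔ A.IsFinite ∧ B.IsFinite := by
  rw [IsFinite, verts_cons, Set.finite_union,
    Set.finite_image_iff (fun u _ v _ h => by simpa using h),
    Set.finite_image_iff shiftFirst_injective.injOn]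
  rfl

theorem size_cons {A B : PlanarTree} (hA : A.IsFinite) (hB : B.IsFinite) :
    (cons A B).size = A.size + B.size := by
  rw [size, verts_cons, Set.ncard_union_eq ?_ (hA.image _) (hB.image _),
    Set.ncard_image_of_injective _ (fun u v h => by simpa using h),
    Set.ncard_image_of_injective _ shiftFirst_injective]
  · rfl
  · rw [Set.disjoint_left]
    rintro _ ⟨u, _, rfl⟩ ⟨v, _, h⟩
    rcases v with _ | ⟨k, v⟩ <;> simp [shiftFirst] at h

theorem height_cons_le_iff {A B : PlanarTree} {m : ℕ} :
    (cons A B).height ≤ (m + 1 : ℕ) ↔ A.height ≤ m ∧ B.height ≤ (m + 1 : ℕ) := by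
  simp only [height_le_iff]
  constructor
  · intro h
    constructor
    · intro u hu
      have := h (0 :: u) hu
      simp only [List.length_cons] at this
      omega
    · intro u hu
      rcases u with _ | ⟨k, u⟩
      · simp
      · simpa using h ((k + 1) :: u) hu
  · rintro ⟨h1, h2⟩ w hw
    rcases w with _ | ⟨_ | l, v⟩
    · simp
    · have := h1 v hw
      simp only [List.length_cons]; omega
    · simpa using h2 (l :: v) hw

theorem verts_path_zero : (path 0).verts = {[]} := by
  ext w
  constructor
  · rintro ⟨i, hi, rfl⟩
    have : i = 0 := by simpa using hi
    simp [this]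
  · rintro rfl
    exact ⟨0, by simp, rfl⟩

theorem eq_path_zero {T : PlanarTree} (h : [0] ∉ T.verts) : T = path 0 := by
  ext w
  rw [verts_path_zero, Set.mem_singleton_iff]
  constructor
  · intro hw
    rcases w with _ | ⟨k, v⟩
    · rfl
    · exfalso
      have h1 : [k] ∈ T.verts := T.append_mem_of_append_mem (u := [k]) (v := v) (by simpa using hw)
      rcases k with _ | k
      · exact h h1
      · exact h (T.left_mem [] 0 (k + 1) (by omega) h1)
  · rintro rfl
    exact T.nil_mem

theorem height_path_zero : (path 0).height = (1 : ℕ) := by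
  refine le_antisymm (height_le_iff.2 fun w hw => ?_) ?_
  · rw [verts_path_zero] at hw
    rw [hw]; simp
  · exact le_iSup₂_of_le (f := fun (w : List ℕ) (_ : w ∈ (path 0).verts) => (vertexHeight w : ℕ∞))
      [] (path 0).nil_mem (by simp [vertexHeight])

theorem treesOf_zero (n : ℕ) : treesOf 0 n = ∅ := by
  rw [Finset.eq_empty_iff_forall_notMem]
  intro T hT
  have := height_le_iff.1 (mem_treesOf.1 hT).2 [] T.nil_mem
  omega

/-- A tree is either a single edge or `cons A B`: cutting off the first branch `A`, which starts one
level higher, leaves a tree `B` with the same height bound. This is `Q_{m+1} = X + Q_m Q_{m+1}`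
before the rescaling of `X`. -/
theorem card_treesOf_succ (m n : ℕ) : (treesOf (m + 1) n).card = (if n = 1 then 1 else 0) +
    ∑ x ∈ Finset.HasAntidiagonal.antidiagonal n, (treesOf m x.1).card *
        (treesOf (m + 1) x.2).card := by
  classical
  rw [← Finset.card_filter_add_card_filter_not (fun T : PlanarTree => [0] ∉ T.verts)]
  congr 1
  · have hpath := path_mem_ofSize 0
    split_ifs with h
    · rw [Finset.card_eq_one]
      refine ⟨path 0, ?_⟩
      ext T
      rw [Finset.mem_filter, mem_treesOf, Finset.mem_singleton]
      constructor
      · exact fun hT => eq_path_zero hT.2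
      · rintro rfl
        refine ⟨⟨⟨hpath.1, by rw [h]; exact hpath.2⟩, ?_⟩, by simp [verts_path_zero]⟩
        rw [height_path_zero]
        exact_mod_cast (by omega : 1 ≤ m + 1)
    · rw [Finset.card_eq_zero, Finset.eq_empty_iff_forall_notMem]
      intro T hT
      rw [Finset.mem_filter, mem_treesOf] at hT
      obtain rfl := eq_path_zero hT.2
      exact h (hT.1.1.2.symm.trans hpath.2)
  · simp only [← Finset.card_product]
    rw [← Finset.card_sigma]
    symm
    refine Finset.card_bij (fun x _ => cons x.2.1 x.2.2) ?_ ?_ ?_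
    · rintro ⟨⟨i, j⟩, A, B⟩ h
      simp only [Finset.mem_sigma, Finset.HasAntidiagonal.mem_antidiagonal, Finset.mem_product,
          mem_treesOf] at h
      obtain ⟨rfl, ⟨⟨hA, rfl⟩, hA'⟩, ⟨hB, rfl⟩, hB'⟩ := h
      rw [Finset.mem_filter, mem_treesOf, not_not]
      exact ⟨⟨⟨isFinite_cons.2 ⟨hA, hB⟩, size_cons hA hB⟩, height_cons_le_iff.2 ⟨hA', hB'⟩⟩,
        A.nil_mem⟩
    · rintro ⟨⟨i, j⟩, A, B⟩ h ⟨⟨i', j'⟩, A', B'⟩ h' he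
      simp only [Finset.mem_sigma, Finset.HasAntidiagonal.mem_antidiagonal, Finset.mem_product,
          mem_treesOf] at h h'
      obtain ⟨rfl, ⟨⟨hA, rfl⟩, hA'⟩, ⟨hB, rfl⟩, hB'⟩ := h
      obtain ⟨h1, ⟨⟨-, rfl⟩, -⟩, ⟨-, rfl⟩, -⟩ := h'
      obtain ⟨rfl, rfl⟩ := cons_injective he
      rfl
    · intro T hT
      rw [Finset.mem_filter, mem_treesOf, not_not] at hT
      obtain ⟨⟨⟨hfin, hsize⟩, hh⟩, h0⟩ := hT
      have hc := cons_branch_tail h0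
      rw [← hc] at hfin hh hsize
      have hf := isFinite_cons.1 hfin
      have hh' := height_cons_le_iff.1 hh
      rw [size_cons hf.1 hf.2] at hsize
      refine ⟨⟨⟨(T.branch [0] h0).size, T.tail.size⟩, T.branch [0] h0, T.tail⟩, ?_, hc⟩
      simp only [Finset.mem_sigma, Finset.HasAntidiagonal.mem_antidiagonal, Finset.mem_product,
          mem_treesOf]
      exact ⟨hsize, ⟨⟨hf.1, trivial⟩, hh'.1⟩, ⟨hf.2, trivial⟩, hh'.2⟩

/-- The generating function, in the variable `X / 4`, of the trees of height at most `m`. -/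
noncomputable def treeSeries (m : ℕ) : PowerSeries ℝ :=
  PowerSeries.mk fun n => ((treesOf m n).card : ℝ) / 4 ^ n

theorem isHeightSeries_treeSeries : IsHeightSeries treeSeries where
  zero := by
    ext n
    simp [treeSeries, treesOf_zero]
  succ m := by
    rw [mul_sub, mul_one, sub_eq_iff_eq_add, mul_comm (treeSeries (m + 1))]
    ext n
    rw [map_add, PowerSeries.coeff_C_mul, PowerSeries.coeff_mul, PowerSeries.coeff_X]
    simp only [treeSeries, PowerSeries.coeff_mk]
    rw [card_treesOf_succ]
    push_cast
    rw [add_div, Finset.sum_div]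
    congr 1
    · split_ifs with h
      · simp [h]
      · simp
    · refine Finset.sum_congr rfl fun x hx => ?_
      rw [← Finset.HasAntidiagonal.mem_antidiagonal.1 hx, pow_add, mul_div_mul_comm]

open scoped Classical in
/-- The trees of size `N` in a set `s` of trees. -/
noncomputable def treesIn (N : ℕ) (s : Set PlanarTree) : Finset PlanarTree :=
  (finite_ofSize N).toFinset.filter fun T => T ∈ s

theorem mem_treesIn {N : ℕ} {s : Set PlanarTree} {T : PlanarTree} :
    T ∈ treesIn N s ↔ (T.IsFinite ∧ T.size = N) ∧ T ∈ s := by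
  simp [treesIn, ofSize]

/-! ### Weighted counting of the trees in a ball -/

section Ball

variable {T₀ : PlanarTree} {r : ℕ}

-- Trees in the ball are the grafts onto `T₀`, so they correspond to tuples of `K` branches of total
-- size `N'`; the shift between `N` and `N'` accounts for the shared edges.
open scoped Classical in
theorem card_treesIn_ball (hT₀ : T₀.height = r) (hfin : T₀.IsFinite) {N N' : ℕ}
    (hN : N + Fintype.card (T₀.level r) = T₀.size + N') (m : ℕ) :
    (((treesIn N {T | T.ball r = T₀.ball r}).filter
      fun T => T.height ≤ ((r - 1 + m : ℕ) : ℕ∞)).card : ℝ) =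
      4 ^ N' * PowerSeries.coeff N' (treeSeries m ^ Fintype.card (T₀.level r)) := by
  have h1 : PowerSeries.coeff N' (treeSeries m ^ Fintype.card (T₀.level r)) =
      (∑ l ∈ Finset.finsuppAntidiag (Finset.univ : Finset (T₀.level r)) N',
        ∏ i, ((treesOf m (l i)).card : ℝ)) / 4 ^ N' := by
    rw [← Finset.card_univ, ← Finset.prod_const, PowerSeries.coeff_prod, Finset.sum_div]
    refine Finset.sum_congr rfl fun l hl => ?_
    rw [Finset.mem_finsuppAntidiag] at hl
    simp only [treeSeries, PowerSeries.coeff_mk]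
    rw [Finset.prod_div_distrib, Finset.prod_pow_eq_pow_sum, hl.1]
  rw [h1, mul_div_cancel₀ _ (by positivity)]
  have h2 : ∑ l ∈ Finset.finsuppAntidiag (Finset.univ : Finset (T₀.level r)) N',
      ∏ i, (treesOf m (l i)).card =
      ((Finset.finsuppAntidiag (Finset.univ : Finset (T₀.level r)) N').sigma
        fun l => Fintype.piFinset fun i => treesOf m (l i)).card := by
    rw [Finset.card_sigma]
    exact Finset.sum_congr rfl fun l _ => (Fintype.card_piFinset _).symm
  have h3 : ((Finset.finsuppAntidiag (Finset.univ : Finset (T₀.level r)) N').sigma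
        fun l => Fintype.piFinset fun i => treesOf m (l i)).card =
      ((treesIn N {T | T.ball r = T₀.ball r}).filter
        fun T => T.height ≤ ((r - 1 + m : ℕ) : ℕ∞)).card := by
    refine Finset.card_bij (fun x _ => T₀.graft r x.2) ?_ ?_ ?_
    · rintro ⟨l, S⟩ h
      simp only [Finset.mem_sigma, Finset.mem_finsuppAntidiag, Fintype.mem_piFinset,
        mem_treesOf] at h
      obtain ⟨⟨hl, -⟩, hS⟩ := h
      have hsz := size_graft hT₀ hfin fun i => (hS i).1.1
      rw [Finset.sum_congr rfl fun i _ => (hS i).1.2, hl] at hsz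
      rw [Finset.mem_filter, mem_treesIn]
      exact ⟨⟨⟨(isFinite_graft_iff hfin).2 fun i => (hS i).1.1, by dsimp only; omega⟩,
        ball_graft_self S⟩, (height_graft_le_iff hT₀).2 fun i => (hS i).2⟩
    · rintro ⟨l, S⟩ h ⟨l', S'⟩ h' he
      obtain rfl : S = S' := graft_injective hT₀ he
      simp only [Finset.mem_sigma, Finset.mem_finsuppAntidiag, Fintype.mem_piFinset,
        mem_treesOf] at h h'
      obtain rfl : l = l' := by
        ext i
        rw [← (h.2 i).1.2, (h'.2 i).1.2]
      rfl
    · intro T hT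
      rw [Finset.mem_filter, mem_treesIn] at hT
      obtain ⟨⟨⟨hTf, hTs⟩, hb⟩, hh⟩ := hT
      have hg := graft_branches hb hT₀
      rw [← hg] at hTf hh hTs
      have hSf := (isFinite_graft_iff hfin).1 hTf
      have hSh := (height_graft_le_iff hT₀).1 hh
      have hsz := size_graft hT₀ hfin hSf
      refine ⟨⟨Finsupp.equivFunOnFinite.symm fun i => (branches hb i).size, branches hb⟩, ?_, hg⟩
      simp only [Finset.mem_sigma, Finset.mem_finsuppAntidiag, Fintype.mem_piFinset,
        mem_treesOf, Finsupp.equivFunOnFinite_symm_apply_apply]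
      exact ⟨⟨by omega, Finset.subset_univ _⟩, fun i => ⟨⟨hSf i, trivial⟩, hSh i⟩⟩
  rw [← h3, ← h2]
  push_cast
  rfl

theorem exp_neg_mul_eq_tsum {μ : ℝ} (hμ : 0 < μ) (h : ℕ) :
    HasSum (fun m : ℕ => if h ≤ m then Real.exp (-(μ * m)) else 0)
      (Real.exp (-μ * h) / (1 - Real.exp (-μ))) := by
  have hlt : Real.exp (-μ) < 1 := by rw [Real.exp_lt_one_iff]; linarith
  have h1 := (hasSum_geometric_of_lt_one (Real.exp_pos (-μ)).le hlt).mul_left (Real.exp (-μ * h))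
  rw [← div_eq_mul_inv] at h1
  rw [← hasSum_nat_add_iff' h]
  have h0 : ∑ i ∈ Finset.range h, (if h ≤ i then Real.exp (-(μ * i)) else 0) = 0 := by
    refine Finset.sum_eq_zero fun i hi => if_neg ?_
    rw [Finset.mem_range] at hi; omega
  rw [h0, sub_zero]
  refine h1.congr_fun fun m => ?_
  rw [if_pos (by omega), ← Real.exp_nat_mul, ← Real.exp_add]
  congr 1; push_cast; ring

theorem height_toNat_le_iff {T : PlanarTree} (hT : T.IsFinite) {m : ℕ} :
    T.height.toNat ≤ m ↔ T.height ≤ m := by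
  have : T.height ≤ T.size := height_le_iff.2 fun w hw => length_lt_size hT hw
  have hne : T.height ≠ ⊤ := fun h => by rw [h] at this; simp at this
  rw [← ENat.natCast_toNat hne, Nat.cast_le, ENat.toNat_natCast]

/-- Summation by parts: `e^{-μh}` is `1 - e^{-μ}` times the tail of the geometric series from `h`,
which turns the exact height into the bounds `h ≤ m` counted by `treeSeries`. -/
theorem sum_exp_height_treesIn {μ : ℝ} (hμ : 0 < μ) (hT₀ : T₀.height = r) (hfin : T₀.IsFinite)
    {N N' : ℕ} (hN : N + Fintype.card (T₀.level r) = T₀.size + N') :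
    ∑ T ∈ treesIn N {T | T.ball r = T₀.ball r}, Real.exp (-μ * (T.height.toNat : ℝ)) =
      (1 - Real.exp (-μ)) * (Real.exp (-((r : ℝ) - 1) * μ) * (4 ^ N' *
        IsHeightSeries.heightSum treeSeries μ (Fintype.card (T₀.level r)) N')) := by
  classical
  have hlt : Real.exp (-μ) < 1 := by rw [Real.exp_lt_one_iff]; linarith
  have hne : 1 - Real.exp (-μ) ≠ 0 := by linarith
  have hr := one_le_of_height_eq hT₀
  set F := treesIn N {T | T.ball r = T₀.ball r} with hF
  have h1 : HasSum (fun m : ℕ => ∑ T ∈ F, if T.height.toNat ≤ m then Real.exp (-(μ * m)) else 0)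
      (∑ T ∈ F, Real.exp (-μ * (T.height.toNat : ℝ)) / (1 - Real.exp (-μ))) :=
    hasSum_sum fun T _ => exp_neg_mul_eq_tsum hμ _
  have h2 : (fun m : ℕ => ∑ T ∈ F, if T.height.toNat ≤ m then Real.exp (-(μ * m)) else 0) =
      fun m : ℕ => Real.exp (-(μ * m)) * ((F.filter fun T => T.height ≤ (m : ℕ∞)).card : ℝ) := by
    funext m
    rw [← Finset.sum_filter, Finset.sum_const, nsmul_eq_mul, mul_comm]
    congr 3
    refine Finset.filter_congr fun T hT => ?_
    exact height_toNat_le_iff (mem_treesIn.1 hT).1.1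
  rw [h2, ← hasSum_nat_add_iff' (r - 1)] at h1
  -- A tree in the ball contains the vertices of `T₀` at height `r`, so no height bound below `r` is
  -- met.
  have h3 : ∑ m ∈ Finset.range (r - 1), Real.exp (-(μ * m)) *
      ((F.filter fun T => T.height ≤ (m : ℕ∞)).card : ℝ) = 0 := by
    refine Finset.sum_eq_zero fun m hm => ?_
    rw [Finset.mem_range] at hm
    have : F.filter (fun T => T.height ≤ (m : ℕ∞)) = ∅ := by
      rw [Finset.eq_empty_iff_forall_notMem]
      intro T hT
      rw [Finset.mem_filter, mem_treesIn] at hT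
      obtain ⟨w, hw⟩ := level_nonempty_of_height_eq hT₀
      have hw' : w ∈ T₀.ball r := ⟨hw.1, hw.2.le⟩
      rw [← (show T.ball r = T₀.ball r from hT.1.2)] at hw'
      have h4 := height_le_iff.1 hT.2 w hw'.1
      have h5 : w.length + 1 = r := hw.2
      omega
    rw [this]; simp
  rw [h3, sub_zero] at h1
  have h4 := h1.tsum_eq
  rw [← Finset.sum_div, eq_div_iff hne] at h4
  rw [← h4, mul_comm, IsHeightSeries.heightSum, ← tsum_mul_left (a := (4 : ℝ) ^ N'),
    ← tsum_mul_left (a := Real.exp (-((r : ℝ) - 1) * μ))]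
  refine congrArg (fun x => (1 - Real.exp (-μ)) * x) (tsum_congr fun m => ?_)
  rw [add_comm m (r - 1), card_treesIn_ball hT₀ hfin hN]
  have : Real.exp (-(μ * ((r - 1 + m : ℕ) : ℝ))) =
      Real.exp (-((r : ℝ) - 1) * μ) * Real.exp (-(μ * m)) := by
    rw [← Real.exp_add]; congr 1; push_cast [Nat.cast_sub hr]; ring
  rw [this]; ring

end Ball

/-! ### The limits of the probabilities of balls -/

/-- The tree `T` cut at height `n + 1`. -/
def trunc (T : PlanarTree) (n : ℕ) : PlanarTree where
  verts := T.ball (n + 1)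
  nil_mem := ⟨T.nil_mem, by simp [vertexHeight]⟩
  parent_mem w k h := by
    refine ⟨T.parent_mem w k h.1, ?_⟩
    have := h.2
    simp only [vertexHeight, List.length_append, List.length_singleton] at this ⊢
    omega
  left_mem w j k hjk h := by
    refine ⟨T.left_mem w j k hjk h.1, ?_⟩
    have := h.2
    simp only [vertexHeight, List.length_append, List.length_singleton] at this ⊢
    omega
  finite_offspring w := (T.finite_offspring w).subset fun _ h => h.1

theorem mem_trunc {T : PlanarTree} {n : ℕ} {w : List ℕ} :
    w ∈ (T.trunc n).verts ↔ w ∈ T.verts ∧ w.length + 1 ≤ n + 1 := Iff.rfl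

theorem isFinite_trunc (T : PlanarTree) (n : ℕ) : (T.trunc n).IsFinite := T.finite_ball (n + 1)

theorem ball_trunc {T : PlanarTree} {n k : ℕ} (h : k ≤ n + 1) : (T.trunc n).ball k = T.ball k := by
  ext w
  simp only [mem_ball_iff, mem_trunc]
  constructor
  · exact fun hw => ⟨hw.1.1, hw.2⟩
  · exact fun hw => ⟨⟨hw.1, hw.2.trans h⟩, hw.2⟩

theorem level_trunc {T : PlanarTree} {n k : ℕ} (h : k ≤ n + 1) :
    (T.trunc n).level k = T.level k := by
  ext w
  simp only [mem_level_iff, mem_trunc]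
  constructor
  · exact fun hw => ⟨hw.1.1, hw.2⟩
  · exact fun hw => ⟨⟨hw.1, by omega⟩, hw.2⟩

theorem level_eq_of_ball_eq {T T' : PlanarTree} {r k : ℕ} (h : T.ball r = T'.ball r) (hk : k ≤ r) :
    T.level k = T'.level k := by
  ext w
  have := Set.ext_iff.1 h w
  simp only [mem_ball_iff, mem_level_iff] at this ⊢
  constructor
  · exact fun hw => ⟨(this.1 ⟨hw.1, by omega⟩).1, hw.2⟩
  · exact fun hw => ⟨(this.2 ⟨hw.1, by omega⟩).1, hw.2⟩

theorem trunc_eq_iff {T T' : PlanarTree} {n : ℕ} :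
    T.trunc n = T'.trunc n ↔ T.ball (n + 1) = T'.ball (n + 1) :=
  ⟨fun h => congrArg verts h, fun h => PlanarTree.ext h⟩

theorem height_trunc {T : PlanarTree} {n : ℕ} (h : (T.level (n + 1)).Nonempty) :
    (T.trunc n).height = (n + 1 : ℕ) := by
  refine le_antisymm (height_le_iff.2 fun w hw => hw.2) ?_
  obtain ⟨w, hw⟩ := h
  exact le_iSup₂_of_le (f := fun (w : List ℕ) (_ : w ∈ (T.trunc n).verts) => (vertexHeight w : ℕ∞))
      w ⟨hw.1, hw.2.le⟩ (by rw [hw.2])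

theorem height_le_of_level_eq_empty {T : PlanarTree} {n : ℕ} (h : T.level (n + 1) = ∅) :
    T.height ≤ (n + 1 : ℕ) := by
  refine height_le_iff.2 fun w hw => ?_
  by_contra! hlt
  have : w.take n ∈ T.level (n + 1) :=
    ⟨T.take_mem hw n, by simp only [vertexHeight, List.length_take]; omega⟩
  rw [h] at this
  exact this

theorem eq_of_level_eq_empty {T T' : PlanarTree} {n : ℕ} (h : T.level (n + 1) = ∅)
    (hb : T'.ball (n + 1) = T.ball (n + 1)) : T' = T := by
  have h' : T'.level (n + 1) = ∅ := by rw [level_eq_of_ball_eq hb le_rfl, h]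
  ext w
  rw [← ball_eq_verts (height_le_of_level_eq_empty h), ← hb,
    ball_eq_verts (height_le_of_level_eq_empty h')]

/-- The set of trees that agree with `T` up to height `n + 1`. -/
def cyl (T : PlanarTree) (n : ℕ) : Set PlanarTree := {T' | T'.ball (n + 1) = T.ball (n + 1)}

theorem mem_cyl {T T' : PlanarTree} {n : ℕ} : T' ∈ T.cyl n ↔ T'.ball (n + 1) = T.ball (n + 1) :=
  Iff.rfl

theorem closedBall_eq_cyl (T : PlanarTree) (n : ℕ) :
    Metric.closedBall T (1 / ((n + 1 : ℕ) : ℝ)) = T.cyl n := by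
  ext T'
  exact mem_closedBall_iff (by omega)

theorem measurableSet_cyl (T : PlanarTree) (n : ℕ) : MeasurableSet (T.cyl n) := by
  rw [← closedBall_eq_cyl]
  exact Metric.isClosed_closedBall.measurableSet

/-- The number of edges of the ball of radius `n + 1`. -/
noncomputable def cylSize (T : PlanarTree) (n : ℕ) : ℕ := (T.ball (n + 1)).ncard

/-- The number of vertices at height `n + 1`. -/
noncomputable def cylWidth (T : PlanarTree) (n : ℕ) : ℕ := (T.level (n + 1)).ncard

/-- The probability that the local limit agrees with `T` up to height `n + 1`. -/
noncomputable def cylWeight (μ : ℝ) (T : PlanarTree) (n : ℕ) : ℝ :=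
  Real.exp (-(n : ℝ) * μ) * ((4 : ℝ) ^ T.cylSize n)⁻¹ * 2 ^ (T.cylWidth n + 1) *
    spinePoly (T.cylWidth n) μ

theorem finiteSizeLaw_apply (μ : ℝ) (N : ℕ+) {s : Set PlanarTree} (hs : MeasurableSet s) :
    (finiteSizeLaw μ N : Measure PlanarTree) s = ENNReal.ofReal
      ((∑ T ∈ treesIn N s, Real.exp (-μ * (T.height.toNat : ℝ))) / partitionFunction μ N) := by
  classical
  have hZ := partitionFunction_pos μ N
  change (∑ T : ofSize N, ENNReal.ofReal
      (Real.exp (-μ * (T.1.height.toNat : ℝ)) / partitionFunction μ N) • Measure.dirac T.1) s = _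
  rw [Measure.finsetSum_apply, Finset.sum_div, ENNReal.ofReal_sum_of_nonneg fun _ _ =>
      by positivity]
  simp only [Measure.smul_apply, Measure.dirac_apply' _ hs, smul_eq_mul]
  have h1 : ∑ T ∈ treesIn N s, ENNReal.ofReal
      (Real.exp (-μ * (T.height.toNat : ℝ)) / partitionFunction μ N) =
      ∑ T ∈ (finite_ofSize N).toFinset, ENNReal.ofReal
        (Real.exp (-μ * (T.height.toNat : ℝ)) / partitionFunction μ N) * s.indicator 1 T := by
    rw [treesIn, Finset.sum_filter]
    refine Finset.sum_congr rfl fun T _ => ?_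
    by_cases h : T ∈ s <;> simp [h]
  rw [h1]
  symm
  exact Finset.sum_subtype _ (fun T => by simp) _

theorem card_level_eq_cylWidth (T : PlanarTree) (n : ℕ) :
    Fintype.card (T.level (n + 1)) = T.cylWidth n := by
  rw [← Nat.card_eq_fintype_card, Nat.card_coe_set_eq, cylWidth]

/-- The ball of radius `1` around the single edge contains all trees, so this is the preceding count
with one branch. -/
theorem partitionFunction_eq {μ : ℝ} (hμ : 0 < μ) (N : ℕ) : partitionFunction μ N =
    (1 - Real.exp (-μ)) * (4 ^ N * IsHeightSeries.heightSum treeSeries μ 1 N) := by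
  have hcard : Fintype.card ((path 0).level 1) = 1 := by
    rw [card_level_eq_cylWidth _ 0, cylWidth, Set.ncard_eq_one]
    refine ⟨[], ?_⟩
    ext w
    rw [mem_level_iff, verts_path_zero, Set.mem_singleton_iff]
    constructor
    · exact fun h => h.1
    · rintro rfl; simp
  have h := sum_exp_height_treesIn (N := N) (N' := N) hμ height_path_zero (path_mem_ofSize 0).1
    (by rw [hcard, (path_mem_ofSize 0).2]; ring)
  rw [hcard] at h
  simp only [ball_one] at h
  have h1 : treesIn N {_T | True} = (finite_ofSize N).toFinset := by
    classical
    ext T; simp [treesIn]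
  rw [h1] at h
  rw [partitionFunction]
  rw [Finset.sum_subtype (p := (· ∈ ofSize N)) _ (fun T => by simp)] at h
  rw [h]; simp

theorem tendsto_pnat_coe_atTop : Tendsto (fun N : ℕ+ => (N : ℕ)) atTop atTop :=
  tendsto_atTop_atTop.2 fun b => ⟨b.succPNat, fun a ha => by
    have : (b.succPNat : ℕ) ≤ a := ha
    rw [Nat.succPNat_coe] at this
    omega⟩

/-- If `V` has no vertex at height `n + 1`, the cylinder contains only the finite tree `V`, which is
missed for large `N`. Otherwise the probability is a ratio of height sums, with common factors
cancelled. -/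
theorem tendsto_finiteSizeLaw_cyl {μ : ℝ} (hμ : 0 < μ) (V : PlanarTree) (n : ℕ) :
    Tendsto (fun N => (finiteSizeLaw μ N : Measure PlanarTree) (V.cyl n)) atTop
      (𝓝 (ENNReal.ofReal (cylWeight μ V n))) := by
  rcases (V.level (n + 1)).eq_empty_or_nonempty with he | hne
  · have hw : cylWeight μ V n = 0 := by
      simp [cylWeight, cylWidth, he, spinePoly]
    rw [hw, ENNReal.ofReal_zero]
    refine tendsto_const_nhds.congr' ?_
    filter_upwards [tendsto_pnat_coe_atTop.eventually_gt_atTop V.size] with N hN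
    rw [finiteSizeLaw_apply μ N (measurableSet_cyl V n)]
    have : treesIn N (V.cyl n) = ∅ := by
      rw [Finset.eq_empty_iff_forall_notMem]
      intro T hT
      rw [mem_treesIn] at hT
      obtain rfl := eq_of_level_eq_empty he hT.2
      have := hT.1.2
      omega
    rw [this]; simp
  · set T₀ := V.trunc n with hT₀
    have hh : T₀.height = (n + 1 : ℕ) := height_trunc hne
    have hfin := isFinite_trunc V n
    have hlev : T₀.level (n + 1) = V.level (n + 1) := level_trunc le_rfl
    have hball : T₀.ball (n + 1) = V.ball (n + 1) := ball_trunc le_rfl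
    have hK : Fintype.card (T₀.level (n + 1)) = V.cylWidth n := by
      rw [card_level_eq_cylWidth, cylWidth, hlev, cylWidth]
    have hs : T₀.size = V.cylSize n := rfl
    have hK1 : 1 ≤ V.cylWidth n := by
      exact (Set.ncard_pos (V.finite_level _)).2 hne
    have hlt : Real.exp (-μ) < 1 := by rw [Real.exp_lt_one_iff]; linarith
    set K := V.cylWidth n
    set s := V.cylSize n
    -- With `N - s` as running index, the branches have total size `(N - s) + K` and the whole tree
    -- has size `(N - s) + s`.
    have hlim := (isHeightSeries_treeSeries.tendsto_heightSum_div hμ hK1 K s).const_mul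
      (Real.exp (-(n : ℝ) * μ) * (4 ^ K / 4 ^ s))
    have hval : Real.exp (-(n : ℝ) * μ) * (4 ^ K / 4 ^ s) * ((1 / 2) ^ (K - 1) * spinePoly K μ) =
        cylWeight μ V n := by
      rw [cylWeight]
      have : (4 : ℝ) ^ K * (1 / 2) ^ (K - 1) = 2 ^ (K + 1) := by
        obtain ⟨k, hk⟩ := Nat.exists_eq_add_of_le' hK1
        rw [hk, Nat.add_sub_cancel, show (4 : ℝ) = 2 ^ 2 by norm_num, ← pow_mul]
        rw [one_div, inv_pow, mul_inv_eq_iff_eq_mul₀ (by positivity), ← pow_add]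
        congr 1; omega
      change _ = Real.exp (-(n : ℝ) * μ) * ((4 : ℝ) ^ s)⁻¹ * 2 ^ (K + 1) * spinePoly K μ
      rw [← this]; ring
    rw [hval] at hlim
    refine ((ENNReal.tendsto_ofReal hlim).comp ((tendsto_sub_atTop_nat s).comp
      tendsto_pnat_coe_atTop)).congr' ?_
    filter_upwards [tendsto_pnat_coe_atTop.eventually_ge_atTop s] with N hN
    simp only [Function.comp]
    rw [finiteSizeLaw_apply μ N (measurableSet_cyl V n)]
    congr 1
    have hset : V.cyl n = {T | T.ball (n + 1) = T₀.ball (n + 1)} := by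
      rw [hball]; rfl
    have hN1 : (N : ℕ) = (N - s) + s := by omega
    rw [hset, sum_exp_height_treesIn (N' := (N - s) + K) hμ hh hfin (by rw [hK, hs]; omega),
      partitionFunction_eq hμ, hK]
    have hpos := partitionFunction_pos μ N
    rw [partitionFunction_eq hμ] at hpos
    have hne1 : 1 - Real.exp (-μ) ≠ 0 := by linarith
    have hne2 : IsHeightSeries.heightSum treeSeries μ 1 N ≠ 0 := by
      intro h0
      rw [h0] at hpos; simp at hpos
    have e1 : (((n + 1 : ℕ) : ℝ) - 1) = n := by push_cast; ring
    rw [e1]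
    conv_lhs => rw [← hN1]
    conv_rhs => rw [show (4 : ℝ) ^ (N : ℕ) = 4 ^ (N - s : ℕ) * 4 ^ s by rw [← pow_add, ← hN1]]
    rw [pow_add]
    field_simp

/-! ### Cylinder sets -/

theorem mem_cyl_self (T : PlanarTree) (n : ℕ) : T ∈ T.cyl n := rfl

theorem cyl_eq_of_mem {T T' : PlanarTree} {n : ℕ} (h : T' ∈ T.cyl n) : T'.cyl n = T.cyl n := by
  ext S
  exact ⟨fun hS => hS.trans h, fun hS => hS.trans h.symm⟩

theorem cyl_anti (T : PlanarTree) {m n : ℕ} (h : m ≤ n) : T.cyl n ⊆ T.cyl m :=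
  fun _ hT => ball_eq_of_le (by omega) hT

theorem isOpen_cyl (T : PlanarTree) (n : ℕ) : IsOpen (T.cyl n) := by
  refine Metric.isOpen_iff.2 fun T' hT' => ⟨1 / ((n + 1 : ℕ) : ℝ), by positivity, ?_⟩
  rw [← cyl_eq_of_mem hT', ← closedBall_eq_cyl]
  exact Metric.ball_subset_closedBall

theorem cyl_zero (T : PlanarTree) : T.cyl 0 = Set.univ :=
  Set.eq_univ_of_forall fun T' => by rw [mem_cyl, ball_one, ball_one]

theorem cyl_trunc (T : PlanarTree) (n : ℕ) : (T.trunc n).cyl n = T.cyl n :=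
  cyl_eq_of_mem (ball_trunc le_rfl)

/-- The cylinder sets that prescribe a tree at least up to height `m + 1`, and the empty set. -/
def cylinders (m : ℕ) : Set (Set PlanarTree) :=
    insert ∅ {A | ∃ (V : PlanarTree) (n : ℕ), m ≤ n ∧ A = V.cyl n}

/-- The metric is an ultrametric: two cylinders with a common point are nested. -/
theorem isPiSystem_cylinders (m : ℕ) : IsPiSystem (cylinders m) := by
  rintro A (rfl | ⟨V, n, hn, rfl⟩) B (rfl | ⟨W, k, hk, rfl⟩) ⟨S, hSA, hSB⟩
  · exact absurd hSA (Set.notMem_empty _)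
  · exact absurd hSA (Set.notMem_empty _)
  · exact absurd hSB (Set.notMem_empty _)
  · refine Or.inr ?_
    rw [← cyl_eq_of_mem hSA, ← cyl_eq_of_mem hSB]
    rcases le_total n k with h | h
    · exact ⟨S, k, hk, Set.inter_eq_right.2 (cyl_anti S h)⟩
    · exact ⟨S, n, hn, Set.inter_eq_left.2 (cyl_anti S h)⟩

theorem exists_cyl_subset (m : ℕ) {u : Set PlanarTree} (hu : IsOpen u) {T : PlanarTree}
    (hT : T ∈ u) : ∃ n, m ≤ n ∧ T.cyl n ⊆ u := by
  obtain ⟨ε, hε, hsub⟩ := Metric.isOpen_iff.1 hu T hT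
  obtain ⟨n, hn⟩ := exists_nat_one_div_lt hε
  refine ⟨max m n, le_max_left _ _, (T.cyl_anti (le_max_right m n)).trans ?_⟩
  rw [← closedBall_eq_cyl]
  refine (Metric.closedBall_subset_ball ?_).trans hsub
  push_cast
  exact hn

theorem isTopologicalBasis_cylinders (m : ℕ) :
    TopologicalSpace.IsTopologicalBasis (cylinders m) := by
  refine TopologicalSpace.isTopologicalBasis_of_isOpen_of_nhds ?_ fun T u hT hu => ?_
  · rintro A (rfl | ⟨V, n, _, rfl⟩)
    · exact isOpen_empty
    · exact isOpen_cyl V n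
  · obtain ⟨n, hn, hsub⟩ := exists_cyl_subset m hu hT
    exact ⟨T.cyl n, Or.inr ⟨T, n, hn, rfl⟩, T.mem_cyl_self n, hsub⟩

theorem countable_isFinite : {T : PlanarTree | T.IsFinite}.Countable := by
  refine (Set.countable_iUnion fun N : ℕ => (finite_ofSize N).countable).mono fun T hT => ?_
  exact Set.mem_iUnion.2 ⟨T.size, hT, rfl⟩

theorem countable_cylinders (m : ℕ) : (cylinders m).Countable := by
  refine Set.Countable.insert _ ?_
  refine (Set.countable_iUnion fun n : ℕ => countable_isFinite.image fun V => V.cyl n).mono ?_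
  rintro A ⟨V, n, _, rfl⟩
  exact Set.mem_iUnion.2 ⟨n, V.trunc n, isFinite_trunc V n, cyl_trunc V n⟩

instance : SecondCountableTopology PlanarTree :=
  (isTopologicalBasis_cylinders 0).secondCountableTopology (countable_cylinders 0)

theorem generateFrom_cylinders (m : ℕ) :
    (inferInstance : MeasurableSpace PlanarTree) = MeasurableSpace.generateFrom (cylinders m) :=
  (isTopologicalBasis_cylinders m).borel_eq_generateFrom

theorem measurableSet_of_mem_cylinders {m : ℕ} {A : Set PlanarTree} (h : A ∈ cylinders m) :
    MeasurableSet A := by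
  rcases h with rfl | ⟨V, n, _, rfl⟩
  · exact MeasurableSet.empty
  · exact measurableSet_cyl V n

theorem measurable_of_cyl {α : Type*} [MeasurableSpace α] {f : α → PlanarTree}
    (h : ∀ (V : PlanarTree) (n : ℕ), MeasurableSet (f ⁻¹' V.cyl n)) : Measurable f := by
  refine Measurable.mono (measurable_generateFrom (s := cylinders 0) ?_) le_rfl
    (generateFrom_cylinders 0).le
  rintro A (rfl | ⟨V, n, _, rfl⟩)
  · exact MeasurableSet.empty
  · exact h V n

/-! ### Numbers of offspring -/

/-- The number of offspring of `u` in `T`. -/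
noncomputable def offspring (T : PlanarTree) (u : List ℕ) : ℕ := {k | u ++ [k] ∈ T.verts}.ncard

theorem setOf_append_mem (T : PlanarTree) (u : List ℕ) :
    {k | u ++ [k] ∈ T.verts} = Set.Iio (T.offspring u) := by
  have hlow : ∀ j k, j < k → k ∈ {k | u ++ [k] ∈ T.verts} → j ∈ {k | u ++ [k] ∈ T.verts} :=
    fun j k h hk => T.left_mem u j k h hk
  obtain ⟨m, hm⟩ : ∃ m, {k | u ++ [k] ∈ T.verts} = Set.Iio m := by
    by_cases h : ∃ m, m ∉ {k | u ++ [k] ∈ T.verts}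
    · classical
      refine ⟨Nat.find h, Set.ext fun k => ⟨fun hk => ?_, fun hk => ?_⟩⟩
      · by_contra hlt
        rcases (not_lt.1 (show ¬ k < _ from hlt)).lt_or_eq with h1 | h1
        · exact Nat.find_spec h (hlow _ _ h1 hk)
        · exact Nat.find_spec h (h1 ▸ hk)
      · exact not_not.1 (Nat.find_min h hk)
    · push Not at h
      exact absurd (T.finite_offspring u) (by rw [Set.eq_univ_of_forall h]; exact Set.infinite_univ)
  rw [offspring, hm, Set.ncard_Iio_nat]

theorem append_mem_iff {T : PlanarTree} {u : List ℕ} {k : ℕ} :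
    u ++ [k] ∈ T.verts ↔ k < T.offspring u :=
  Set.ext_iff.1 (T.setOf_append_mem u) k

theorem append_mem_ofOffspring {ξ : List ℕ → ℕ} {u : List ℕ} {k : ℕ} :
    u ++ [k] ∈ (ofOffspring ξ).verts ↔ u ∈ (ofOffspring ξ).verts ∧ k < ξ u := by
  refine ⟨fun h => ⟨(ofOffspring ξ).parent_mem _ _ h, h u k List.prefix_rfl⟩, ?_⟩
  rintro ⟨h, hk⟩ v l hv
  rcases List.prefix_concat_iff.1 hv with hv | hv
  · obtain ⟨rfl, hl⟩ := List.append_inj' hv rfl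
    obtain rfl : l = k := by simpa using hl
    exact hk
  · exact h v l hv

theorem offspring_ofOffspring {ξ : List ℕ → ℕ} {u : List ℕ} (h : u ∈ (ofOffspring ξ).verts) :
    (ofOffspring ξ).offspring u = ξ u := by
  have : {k | u ++ [k] ∈ (ofOffspring ξ).verts} = Set.Iio (ξ u) := by
    ext k
    simp [append_mem_ofOffspring, h]
  rw [offspring, this, Set.ncard_Iio_nat]

theorem mem_cyl_succ_iff {T V : PlanarTree} {n : ℕ} : T ∈ V.cyl (n + 1) ↔
    T ∈ V.cyl n ∧ ∀ u ∈ V.level (n + 1), T.offspring u = V.offspring u := by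
  constructor
  · refine fun h => ⟨V.cyl_anti n.le_succ h, fun u hu => ?_⟩
    rw [offspring, offspring]
    congr 1
    ext k
    have := Set.ext_iff.1 h (u ++ [k])
    rw [mem_level_iff] at hu
    simpa [mem_ball_iff, show u.length + 1 ≤ n + 1 by omega] using this
  · rintro ⟨h, hu⟩
    refine Set.ext fun w => ?_
    have hw := Set.ext_iff.1 h
    simp only [mem_ball_iff, and_congr_left_iff] at hw ⊢
    intro hl
    rcases Nat.lt_or_ge (w.length + 1) (n + 2) with h1 | h1
    · exact hw w (by omega)
    · rcases List.eq_nil_or_concat' w with rfl | ⟨u, k, rfl⟩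
      · simp at h1
      · simp only [List.length_append, List.length_singleton] at h1 hl
        have hu' := hw u (by omega)
        by_cases hV : u ∈ V.verts
        · rw [append_mem_iff, append_mem_iff, hu u (mem_level_iff.2 ⟨hV, by omega⟩)]
        · exact ⟨fun hT => absurd (hu'.1 (T.parent_mem _ _ hT)) hV,
            fun hT => absurd (V.parent_mem _ _ hT) hV⟩

theorem ofOffspring_mem_cyl_succ_iff {V : PlanarTree} {ξ : List ℕ → ℕ} {n : ℕ} :
    ofOffspring ξ ∈ V.cyl (n + 1) ↔
      ofOffspring ξ ∈ V.cyl n ∧ ∀ u ∈ V.level (n + 1), ξ u = V.offspring u := by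
  rw [mem_cyl_succ_iff, and_congr_right_iff]
  refine fun h => forall₂_congr fun u hu => ?_
  rw [offspring_ofOffspring]
  rw [← level_eq_of_ball_eq h le_rfl] at hu
  exact hu.1

theorem ball_succ (V : PlanarTree) (n : ℕ) : V.ball (n + 1) = V.ball n ∪ V.level (n + 1) := by
  ext w
  simp only [Set.mem_union, mem_ball_iff, mem_level_iff, ← and_or_left]
  exact and_congr_right fun _ => by omega

theorem disjoint_ball_level (V : PlanarTree) (n : ℕ) : Disjoint (V.ball n) (V.level (n + 1)) :=
  Set.disjoint_left.2 fun w h1 h2 => by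
    have := (mem_ball_iff.1 h1).2
    have := (mem_level_iff.1 h2).2
    omega

theorem ball_zero (V : PlanarTree) : V.ball 0 = ∅ := by
  ext w
  simp [mem_ball_iff]

/-- The tree up to height `n + 1` is fixed by the offspring numbers up to height `n`, so under
independent offspring a cylinder is a finite-dimensional box. -/
theorem ofOffspring_mem_cyl_iff {V : PlanarTree} {ξ : List ℕ → ℕ} {n : ℕ} :
    ofOffspring ξ ∈ V.cyl n ↔ ∀ u ∈ V.ball n, ξ u = V.offspring u := by
  induction n with
  | zero => simp [cyl_zero, ball_zero]
  | succ n ih =>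
    rw [ofOffspring_mem_cyl_succ_iff, ih, ball_succ]
    simp only [Set.mem_union, or_imp, forall_and]

theorem cylSize_succ (V : PlanarTree) (n : ℕ) :
    V.cylSize (n + 1) = V.cylSize n + V.cylWidth (n + 1) := by
  rw [cylSize, ball_succ, Set.ncard_union_eq (disjoint_ball_level V (n + 1)) (V.finite_ball _)
    (V.finite_level _), cylSize, cylWidth]

theorem cylSize_zero (V : PlanarTree) : V.cylSize 0 = 1 := by
  rw [cylSize, ball_one, Set.ncard_singleton]

theorem cylWidth_zero (V : PlanarTree) : V.cylWidth 0 = 1 := by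
  have h := ball_succ V 0
  rw [ball_one, ball_zero, Set.empty_union] at h
  rw [cylWidth, ← h, Set.ncard_singleton]

theorem cylWidth_succ (V : PlanarTree) (n : ℕ) :
    V.cylWidth (n + 1) = ∑ u ∈ (V.finite_level (n + 1)).toFinset, V.offspring u := by
  classical
  have h : V.level (n + 2) = ((V.finite_level (n + 1)).toFinset.biUnion fun u =>
      (Finset.range (V.offspring u)).image fun k => u ++ [k] : Finset (List ℕ)) := by
    ext w
    simp only [Finset.coe_biUnion, Set.Finite.coe_toFinset, Finset.coe_image, Set.mem_iUnion,
      Set.mem_image, Finset.coe_range, Set.mem_Iio]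
    constructor
    · intro hw
      rw [mem_level_iff] at hw
      rcases List.eq_nil_or_concat' w with rfl | ⟨u, k, rfl⟩
      · simp at hw
      · have := hw.2
        simp only [List.length_append, List.length_singleton] at this
        exact ⟨u, mem_level_iff.2 ⟨V.parent_mem _ _ hw.1, by omega⟩, k, append_mem_iff.1 hw.1, rfl⟩
    · rintro ⟨u, hu, k, hk, rfl⟩
      rw [mem_level_iff] at hu ⊢
      exact ⟨append_mem_iff.2 hk, by simp; omega⟩
  rw [cylWidth, h, Set.ncard_coe_finset, Finset.card_biUnion]
  · refine Finset.sum_congr rfl fun u _ => ?_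
    rw [Finset.card_image_of_injective _ fun a b hab => by simpa using hab, Finset.card_range]
  · intro u _ v _ huv
    rw [Function.onFun, Finset.disjoint_left]
    intro w hw hw'
    simp only [Finset.mem_image] at hw hw'
    obtain ⟨a, _, rfl⟩ := hw
    obtain ⟨b, _, hb⟩ := hw'
    exact huv (List.append_inj' hb rfl).1.symm

/-! ### The critical Bienaymé-Galton-Watson tree -/

theorem preimage_ofOffspring_cyl (V : PlanarTree) (n : ℕ) : ofOffspring ⁻¹' V.cyl n =
    Set.pi ((V.finite_ball n).toFinset : Set (List ℕ)) fun u => {V.offspring u} := by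
  ext ξ
  simp [ofOffspring_mem_cyl_iff, Set.mem_pi]

theorem measurable_ofOffspring : Measurable ofOffspring :=
  measurable_of_cyl fun V n => by
    rw [preimage_ofOffspring_cyl]
    exact MeasurableSet.pi (Finset.countable_toSet _) fun _ _ => measurableSet_singleton _

instance (p : PMF ℕ) : IsProbabilityMeasure (bgw p) :=
  Measure.isProbabilityMeasure_map measurable_ofOffspring.aemeasurable

instance : IsProbabilityMeasure rho := inferInstanceAs (IsProbabilityMeasure (bgw _))

theorem bgw_cyl (p : PMF ℕ) (V : PlanarTree) (n : ℕ) :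
    bgw p (V.cyl n) = ∏ u ∈ (V.finite_ball n).toFinset, p (V.offspring u) := by
  rw [bgw, Measure.map_apply measurable_ofOffspring (measurableSet_cyl V n),
    preimage_ofOffspring_cyl, Measure.infinitePi_pi _ fun _ _ => measurableSet_singleton _]
  refine Finset.prod_congr rfl fun u _ => ?_
  rw [PMF.toMeasure_apply_singleton _ _ (measurableSet_singleton _)]

theorem bgw_cyl_succ (p : PMF ℕ) (V : PlanarTree) (n : ℕ) : bgw p (V.cyl (n + 1)) =
    bgw p (V.cyl n) * ∏ u ∈ (V.finite_level (n + 1)).toFinset, p (V.offspring u) := by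
  classical
  rw [bgw_cyl, bgw_cyl, ← Finset.prod_union]
  · refine Finset.prod_congr ?_ fun _ _ => rfl
    ext u
    simp [ball_succ]
  · rw [Set.Finite.disjoint_toFinset]
    exact disjoint_ball_level V n

theorem criticalOffspring_apply (n : ℕ) :
    criticalOffspring n = ENNReal.ofReal ((2⁻¹ : ℝ) ^ (n + 1)) := by
  rw [ENNReal.ofReal_pow (by norm_num), ENNReal.ofReal_inv_of_pos (by norm_num)]
  simp [criticalOffspring]
  rfl

/-- Each vertex with `k` offspring contributes `2^{-(k+1)}`; the `k` add up to the next width and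
the ones to the present width. -/
theorem prod_criticalOffspring (V : PlanarTree) (n : ℕ) :
    ∏ u ∈ (V.finite_level (n + 1)).toFinset, criticalOffspring (V.offspring u) =
      ENNReal.ofReal ((2⁻¹ : ℝ) ^ (V.cylWidth (n + 1) + V.cylWidth n)) := by
  simp_rw [criticalOffspring_apply]
  rw [← ENNReal.ofReal_prod_of_nonneg fun _ _ => by positivity, Finset.prod_pow_eq_pow_sum,
    Finset.sum_add_distrib, ← cylWidth_succ, Finset.sum_const, smul_eq_mul, mul_one,
    ← Set.ncard_eq_toFinset_card _ (V.finite_level (n + 1)), cylWidth, cylWidth]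

/-- The probability that the critical Bienaymé-Galton-Watson tree agrees with `T` up to height
`n + 1`. -/
noncomputable def rhoWeight (T : PlanarTree) (n : ℕ) : ℝ :=
  ((4 : ℝ) ^ T.cylSize n)⁻¹ * 2 ^ (T.cylWidth n + 1)

theorem rhoWeight_nonneg (T : PlanarTree) (n : ℕ) : 0 ≤ rhoWeight T n := by
  unfold rhoWeight; positivity

theorem rhoWeight_zero (T : PlanarTree) : rhoWeight T 0 = 1 := by
  rw [rhoWeight, cylSize_zero, cylWidth_zero]; norm_num

theorem rhoWeight_succ (T : PlanarTree) (n : ℕ) : rhoWeight T (n + 1) =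
    rhoWeight T n * (2⁻¹ : ℝ) ^ (T.cylWidth (n + 1) + T.cylWidth n) := by
  rw [rhoWeight, rhoWeight, cylSize_succ, pow_add, show (4 : ℝ) ^ T.cylWidth (n + 1) =
    2 ^ T.cylWidth (n + 1) * 2 ^ T.cylWidth (n + 1) by rw [← mul_pow]; norm_num]
  simp only [pow_add, inv_pow]
  field_simp

theorem rho_cyl (V : PlanarTree) (n : ℕ) : rho (V.cyl n) = ENNReal.ofReal (rhoWeight V n) := by
  induction n with
  | zero => rw [cyl_zero, measure_univ, rhoWeight_zero, ENNReal.ofReal_one]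
  | succ n ih =>
    rw [rhoWeight_succ, ENNReal.ofReal_mul (rhoWeight_nonneg V n), ← ih, ← prod_criticalOffspring]
    exact bgw_cyl_succ _ V n

/-- This exhibits the limit as an h-transform of `ρ` with density `e^{-nμ} p_W(μ)` up to height `n +
1`. -/
theorem cylWeight_eq (μ : ℝ) (V : PlanarTree) (n : ℕ) : cylWeight μ V n =
    Real.exp (-(n : ℝ) * μ) * spinePoly (V.cylWidth n) μ * rhoWeight V n := by
  rw [cylWeight, rhoWeight]; ring

/-! ### Harmonicity of the polynomials `spinePoly` -/

theorem tsum_half_pow_mul_choose (a : ℕ) :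
    ∑' k : ℕ, criticalOffspring k * (k.choose a : ℝ≥0∞) = 1 := by
  have h1 : HasSum (fun n : ℕ => ((n + a).choose a : ℝ) *
      (2⁻¹ : ℝ) ^ n) (1 / (1 - 2⁻¹) ^ (a + 1)) :=
    hasSum_choose_mul_geometric_of_norm_lt_one a (by norm_num)
  have h2 : HasSum (fun n : ℕ => (2⁻¹ : ℝ) ^ (n + a + 1) * ((n + a).choose a : ℝ)) 1 := by
    have h := h1.mul_left ((2⁻¹ : ℝ) ^ (a + 1))
    rw [show (2⁻¹ : ℝ) ^ (a + 1) * (1 / (1 - 2⁻¹) ^ (a + 1)) = 1 by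
      rw [show (1 - 2⁻¹ : ℝ) = 2⁻¹ by norm_num]; simp] at h
    refine (congrArg (HasSum · 1) (funext fun n => ?_)).mp h
    rw [pow_add, pow_add, pow_succ]; ring
  have h3 : HasSum (fun k : ℕ => (2⁻¹ : ℝ) ^ (k + 1) * (k.choose a : ℝ)) 1 := by
    rw [← hasSum_nat_add_iff' a, Finset.sum_eq_zero, sub_zero]
    · exact h2
    · intro k hk
      rw [Nat.choose_eq_zero_of_lt (Finset.mem_range.1 hk)]; simp
  have h4 := ENNReal.ofReal_tsum_of_nonneg
    (f := fun k : ℕ => (2⁻¹ : ℝ) ^ (k + 1) * (k.choose a : ℝ)) (fun k => by positivity) h3.summable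
  rw [h3.tsum_eq, ENNReal.ofReal_one] at h4
  rw [h4]
  refine tsum_congr fun k => ?_
  rw [criticalOffspring_apply, ENNReal.ofReal_mul (by positivity), ENNReal.ofReal_natCast]

theorem sum_antidiagonal_multichoose (K j : ℕ) :
    ∑ p ∈ Finset.HasAntidiagonal.antidiagonal j, K.multichoose p.2 = (K + 1).multichoose j := by
  induction j with
  | zero => simp
  | succ j ih => rw [Finset.Nat.sum_antidiagonal_succ, ih, Nat.multichoose_succ_succ]

/-- All binomial moments of the geometric law equal `1`. Vandermonde's identity for the sum of `K`
independent copies then counts the ways of writing `j` as a sum of `K` numbers. -/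
theorem tsum_fin_prod_mul_choose (K j : ℕ) :
    ∑' k : Fin K → ℕ, (∏ i, criticalOffspring (k i)) * ((∑ i, k i).choose j : ℝ≥0∞) =
      (K.multichoose j : ℝ≥0∞) := by
  induction K generalizing j with
  | zero =>
    rw [tsum_eq_single (fun i => i.elim0) fun k hk => absurd (Subsingleton.elim _ _) hk]
    cases j <;> simp
  | succ K ih =>
    rw [← (Fin.consEquiv fun _ : Fin (K + 1) => ℕ).tsum_eq]
    simp only [Fin.consEquiv, Equiv.coe_fn_mk, Fin.prod_univ_succ, Fin.sum_univ_succ, Fin.cons_zero,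
      Fin.cons_succ]
    rw [ENNReal.tsum_prod (f := fun (a : ℕ) (k : Fin K → ℕ) => criticalOffspring a *
      (∏ i, criticalOffspring (k i)) * ((a + ∑ i, k i).choose j : ℝ≥0∞))]
    have : ∀ (a : ℕ) (k : Fin K → ℕ), criticalOffspring a * (∏ i, criticalOffspring (k i)) *
        ((a + ∑ i, k i).choose j : ℝ≥0∞) = ∑ p ∈ Finset.HasAntidiagonal.antidiagonal j,
          (criticalOffspring a * (a.choose p.1 : ℝ≥0∞)) *
            ((∏ i, criticalOffspring (k i)) * ((∑ i, k i).choose p.2 : ℝ≥0∞)) := by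
      intro a k
      rw [Nat.add_choose_eq, Nat.cast_sum, Finset.mul_sum]
      refine Finset.sum_congr rfl fun p _ => ?_
      push_cast; ring
    simp_rw [this]
    simp_rw [Summable.tsum_finsetSum fun _ _ => ENNReal.summable, ENNReal.tsum_mul_left, ih,
      ENNReal.tsum_mul_right, tsum_half_pow_mul_choose, one_mul]
    rw [← sum_antidiagonal_multichoose, Nat.cast_sum]

theorem spinePoly_nonneg {μ : ℝ} (hμ : 0 ≤ μ) (L : ℕ) : 0 ≤ spinePoly L μ :=
  Finset.sum_nonneg fun _ _ => by positivity

theorem spinePoly_eq_tsum {μ : ℝ} (hμ : 0 ≤ μ) (L : ℕ) : ENNReal.ofReal (spinePoly L μ) =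
    ∑' j : ℕ, (L.choose (j + 1) : ℝ≥0∞) * ENNReal.ofReal (μ ^ j / (j.factorial : ℝ)) := by
  rw [tsum_eq_sum (s := Finset.range L), spinePoly, ENNReal.ofReal_sum_of_nonneg fun _ _ => by
    positivity]
  · refine Finset.sum_congr rfl fun j _ => ?_
    rw [ENNReal.ofReal_mul (by positivity), ENNReal.ofReal_natCast]
  · intro j hj
    rw [Nat.choose_eq_zero_of_lt (by simpa [Nat.lt_succ_iff] using hj)]
    simp

/-- The Cauchy product of the exponential series with `p_K`, whose coefficients are evaluated by
Vandermonde's identity. -/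
theorem tsum_multichoose_mul {μ : ℝ} (hμ : 0 ≤ μ) (K : ℕ) :
    ∑' j : ℕ, (K.multichoose (j + 1) : ℝ≥0∞) * ENNReal.ofReal (μ ^ j / (j.factorial : ℝ)) =
      ENNReal.ofReal (Real.exp μ * spinePoly K μ) := by
  have hexp : Summable fun n : ℕ => ‖μ ^ n / (n.factorial : ℝ)‖ :=
    NormedSpace.norm_expSeries_div_summable μ
  have hsupp : ∀ j ∉ Finset.range K, (K.choose (j + 1) : ℝ) * (μ ^ j / (j.factorial : ℝ)) = 0 := by
    intro j hj
    rw [Nat.choose_eq_zero_of_lt (by simpa [Nat.lt_succ_iff] using hj)]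
    simp
  have hpoly : Summable fun j : ℕ => ‖(K.choose (j + 1) : ℝ) * (μ ^ j / (j.factorial : ℝ))‖ :=
    summable_of_ne_finset_zero (s := Finset.range K) fun j hj => by rw [hsupp j hj, norm_zero]
  have hprod := tsum_mul_tsum_eq_tsum_sum_antidiagonal_of_summable_norm hexp hpoly
  have hsum := summable_norm_sum_mul_antidiagonal_of_summable_norm hexp hpoly
  have hterm : ∀ n : ℕ, ∑ p ∈ Finset.HasAntidiagonal.antidiagonal n, μ ^ p.1 / (p.1.factorial : ℝ) *
      ((K.choose (p.2 + 1) : ℝ) * (μ ^ p.2 / (p.2.factorial : ℝ))) =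
      (K.multichoose (n + 1) : ℝ) * (μ ^ n / (n.factorial : ℝ)) := by
    intro n
    have h1 : K.multichoose (n + 1) =
        ∑ p ∈ Finset.HasAntidiagonal.antidiagonal n, n.choose p.1 * K.choose (p.2 + 1) := by
      -- Vandermonde runs over pairs of sum `n + 1`; the pair `(n + 1, 0)` drops out because
      -- `n.choose (n + 1) = 0`.
      rw [Nat.multichoose_eq, show K + (n + 1) - 1 = n + K by omega, Nat.add_choose_eq,
        Finset.Nat.sum_antidiagonal_succ']
      simp
    rw [h1, Nat.cast_sum, Finset.sum_mul]
    refine Finset.sum_congr rfl fun p hp => ?_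
    rw [Finset.HasAntidiagonal.mem_antidiagonal] at hp
    subst hp
    have h2 : ((p.1 + p.2).choose p.1 : ℝ) * p.1.factorial * p.2.factorial =
        (p.1 + p.2).factorial := by
      rw [Nat.choose_symm_add]
      exact_mod_cast Nat.add_choose_mul_factorial_mul_factorial p.1 p.2
    push_cast
    rw [← h2, pow_add]
    have := Nat.factorial_ne_zero p.1
    have := Nat.factorial_ne_zero p.2
    have : ((p.1 + p.2).choose p.1 : ℝ) ≠ 0 := by
      exact_mod_cast (Nat.choose_pos (Nat.le_add_right _ _)).ne'
    field_simp
  simp_rw [hterm] at hprod hsum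
  rw [tsum_eq_sum hsupp, ← spinePoly, ← congrFun (NormedSpace.exp_eq_tsum_div (𝔸 := ℝ)) μ,
      ← Real.exp_eq_exp_ℝ] at hprod
  rw [hprod, ENNReal.ofReal_tsum_of_nonneg (fun n => by positivity) hsum.of_norm]
  refine tsum_congr fun j => ?_
  rw [ENNReal.ofReal_mul (by positivity), ENNReal.ofReal_natCast]

/-- Under `ρ` this makes `e^{-nμ} p_W(μ)` a martingale. It is the consistency of the limiting
cylinder weights and supplies the normalisation of `spineLaw`. -/
theorem tsum_prod_mul_spinePoly {κ : Type*} [Fintype κ] {μ : ℝ} (hμ : 0 ≤ μ) :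
    ∑' k : κ → ℕ, (∏ i, criticalOffspring (k i)) * ENNReal.ofReal (spinePoly (∑ i, k i) μ) =
      ENNReal.ofReal (Real.exp μ * spinePoly (Fintype.card κ) μ) := by
  have e := Fintype.equivFin κ
  rw [← (Equiv.arrowCongr e.symm (Equiv.refl ℕ)).tsum_eq, ← tsum_multichoose_mul hμ]
  have hE : ∀ k : Fin (Fintype.card κ) → ℕ,
      (∏ i, criticalOffspring ((Equiv.arrowCongr e.symm (Equiv.refl ℕ)) k i)) *
        ENNReal.ofReal (spinePoly (∑ i, (Equiv.arrowCongr e.symm (Equiv.refl ℕ)) k i) μ) =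
      ∑' j : ℕ, ((∏ i, criticalOffspring (k i)) * ((∑ i, k i).choose (j + 1) : ℝ≥0∞)) *
        ENNReal.ofReal (μ ^ j / (j.factorial : ℝ)) := by
    intro k
    have h1 : ∏ i, criticalOffspring ((Equiv.arrowCongr e.symm (Equiv.refl ℕ)) k i) =
        ∏ i, criticalOffspring (k i) := e.prod_comp fun x => criticalOffspring (k x)
    have h2 : ∑ i, (Equiv.arrowCongr e.symm (Equiv.refl ℕ)) k i = ∑ i, k i :=
      e.sum_comp fun x => k x
    rw [h1, h2, spinePoly_eq_tsum hμ, ← ENNReal.tsum_mul_left]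
    simp_rw [mul_assoc]
  rw [tsum_congr hE, ENNReal.tsum_comm]
  simp_rw [ENNReal.tsum_mul_right, tsum_fin_prod_mul_choose]

/-! ### The local limit as a Markov chain of truncated trees -/

/-- The weight of the numbers `k` of offspring of the vertices at height `n + 1`. -/
noncomputable def spineWeight (μ : ℝ) (T : PlanarTree) (n : ℕ) (k : T.level (n + 1) → ℕ) : ℝ≥0∞ :=
  (∏ i, criticalOffspring (k i)) * ENNReal.ofReal (spinePoly (∑ i, k i) μ)

open scoped Classical in
/-- The law of the numbers of offspring of the vertices at height `n + 1` of a tree that agrees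
with `T` up to that height. -/
noncomputable def spineLaw (μ : ℝ) (T : PlanarTree) (n : ℕ) : PMF (T.level (n + 1) → ℕ) :=
  if h : ∑' k, spineWeight μ T n k ≠ 0 ∧ ∑' k, spineWeight μ T n k ≠ ⊤ then
    PMF.normalize (spineWeight μ T n) h.1 h.2 else PMF.pure 0

theorem spinePoly_pos {μ : ℝ} (hμ : 0 < μ) {L : ℕ} (hL : L ≠ 0) : 0 < spinePoly L μ := by
  refine Finset.sum_pos' (fun _ _ => by positivity) ⟨0, Finset.mem_range.2 (by omega), ?_⟩
  have : (0 : ℝ) < L := by exact_mod_cast Nat.pos_of_ne_zero hL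
  simpa using this

theorem spineLaw_apply {μ : ℝ} (hμ : 0 < μ) {T : PlanarTree} {n : ℕ} (h : T.cylWidth n ≠ 0)
    (k : T.level (n + 1) → ℕ) : spineLaw μ T n k =
      spineWeight μ T n k * (ENNReal.ofReal (Real.exp μ * spinePoly (T.cylWidth n) μ))⁻¹ := by
  have hs : ∑' k, spineWeight μ T n k =
      ENNReal.ofReal (Real.exp μ * spinePoly (T.cylWidth n) μ) := by
    rw [← card_level_eq_cylWidth]
    exact tsum_prod_mul_spinePoly hμ.le
  have hpos : 0 < Real.exp μ * spinePoly (T.cylWidth n) μ :=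
    mul_pos (Real.exp_pos _) (spinePoly_pos hμ h)
  rw [spineLaw, dif_pos, PMF.normalize_apply, hs]
  rw [hs]
  exact ⟨(ENNReal.ofReal_pos.2 hpos).ne', ENNReal.ofReal_ne_top⟩

/-- The law `spineLaw` on functions on all words. -/
noncomputable def spineMeasure (μ : ℝ) (p : PlanarTree × ℕ) : Measure (List ℕ → ℕ) :=
  ((spineLaw μ p.1 p.2).map fun k : p.1.level (p.2 + 1) → ℕ =>
    Function.extend Subtype.val k (0 : List ℕ → ℕ)).toMeasure

instance (μ : ℝ) (p : PlanarTree × ℕ) : IsProbabilityMeasure (spineMeasure μ p) :=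
  PMF.toMeasure.isProbabilityMeasure _

/-- The offspring functions that agree with that of `V` at height `n + 1`. -/
def offspringCyl (V : PlanarTree) (n : ℕ) : Set (List ℕ → ℕ) :=
  {f | ∀ u ∈ V.level (n + 1), f u = V.offspring u}

theorem measurableSet_offspringCyl (V : PlanarTree) (n : ℕ) :
    MeasurableSet (V.offspringCyl n) := by
  have : V.offspringCyl n = Set.pi (V.level (n + 1)) fun u => {V.offspring u} := by
    ext f; simp [offspringCyl, Set.mem_pi]
  rw [this]
  exact MeasurableSet.pi (V.finite_level _).countable fun _ _ => measurableSet_singleton _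

theorem spineMeasure_offspringCyl (μ : ℝ) {T V : PlanarTree} {n : ℕ}
    (h : T.level (n + 1) = V.level (n + 1)) : spineMeasure μ (T, n) (V.offspringCyl n) =
      spineLaw μ T n fun i => V.offspring i := by
  rw [spineMeasure, PMF.toMeasure_apply_eq_toOuterMeasure_apply _ (measurableSet_offspringCyl V n),
    PMF.toOuterMeasure_map_apply, ← PMF.toOuterMeasure_apply_singleton]
  congr 1
  ext k
  simp only [Set.mem_preimage, offspringCyl, Set.mem_ofPred_eq, Set.mem_singleton_iff, ← h]
  constructor
  · intro hk
    funext i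
    rw [← hk i.1 i.2, Subtype.val_injective.extend_apply]
  · rintro rfl u hu
    exact Subtype.val_injective.extend_apply _ _ (⟨u, hu⟩ : T.level (n + 1))

theorem spineMeasure_trunc_offspringCyl {μ : ℝ} (hμ : 0 < μ) {V : PlanarTree} {n : ℕ}
    (h : V.cylWidth n ≠ 0) : spineMeasure μ (V.trunc n, n) (V.offspringCyl n) =
      ENNReal.ofReal ((2⁻¹ : ℝ) ^ (V.cylWidth (n + 1) + V.cylWidth n) *
        spinePoly (V.cylWidth (n + 1)) μ * (Real.exp μ * spinePoly (V.cylWidth n) μ)⁻¹) := by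
  have hlev : (V.trunc n).level (n + 1) = V.level (n + 1) := level_trunc le_rfl
  have hw : (V.trunc n).cylWidth n = V.cylWidth n := by rw [cylWidth, hlev, cylWidth]
  have hpos : 0 < Real.exp μ * spinePoly (V.cylWidth n) μ :=
    mul_pos (Real.exp_pos _) (spinePoly_pos hμ h)
  rw [spineMeasure_offspringCyl μ hlev, spineLaw_apply hμ (hw ▸ h), hw, spineWeight,
    ENNReal.ofReal_mul (q := (Real.exp μ * spinePoly (V.cylWidth n) μ)⁻¹)
      (mul_nonneg (by positivity) (spinePoly_nonneg hμ.le _)),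
    ENNReal.ofReal_mul (p := (2⁻¹ : ℝ) ^ _) (by positivity), ← prod_criticalOffspring,
    ENNReal.ofReal_inv_of_pos hpos, cylWidth_succ V n]
  have hmem : ∀ u, u ∈ (V.finite_level (n + 1)).toFinset ↔ u ∈ (V.trunc n).level (n + 1) := by
    intro u; rw [hlev]; exact Set.Finite.mem_toFinset _
  rw [Finset.prod_subtype _ hmem, Finset.sum_subtype _ hmem]

/-- The numbers of offspring of the vertices of height at most `n`, where the numbers at height
`j + 1` are `ω (T, j)`, `T` being the tree up to height `j + 1`. -/
def growOffspring (ω : PlanarTree × ℕ → List ℕ → ℕ) : ℕ → List ℕ → ℕ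
  | 0 => 0
  | n + 1 => fun u =>
    if u.length = n then ω (ofOffspring (growOffspring ω n), n) u else growOffspring ω n u

/-- The numbers of offspring of all vertices, grown by `growOffspring`. -/
def limitOffspring (ω : PlanarTree × ℕ → List ℕ → ℕ) (u : List ℕ) : ℕ :=
  growOffspring ω (u.length + 1) u

theorem limitOffspring_eq (ω : PlanarTree × ℕ → List ℕ → ℕ) (u : List ℕ) :
    limitOffspring ω u = ω (ofOffspring (growOffspring ω u.length), u.length) u := by
  simp [limitOffspring, growOffspring]

theorem growOffspring_eq (ω : PlanarTree × ℕ → List ℕ → ℕ) (n : ℕ) (u : List ℕ) :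
    growOffspring ω n u = if u.length < n then limitOffspring ω u else 0 := by
  induction n with
  | zero => simp [growOffspring]
  | succ n ih =>
    rw [show growOffspring ω (n + 1) u = if u.length = n then
      ω (ofOffspring (growOffspring ω n), n) u else growOffspring ω n u from rfl]
    split_ifs with h1 h2 h2
    · subst h1; rw [limitOffspring_eq]
    · omega
    · rw [ih, if_pos (by omega)]
    · rw [ih, if_neg (by omega)]

theorem ofOffspring_growOffspring (ω : PlanarTree × ℕ → List ℕ → ℕ) (n : ℕ) :
    ofOffspring (growOffspring ω n) = (ofOffspring (limitOffspring ω)).trunc n := by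
  ext w
  induction w using List.reverseRecOn with
  | nil => exact iff_of_true (nil_mem _) (nil_mem _)
  | append_singleton w k ih =>
    rw [append_mem_ofOffspring, ih, mem_trunc, mem_trunc, append_mem_ofOffspring, growOffspring_eq]
    simp only [List.length_append, List.length_singleton]
    by_cases h : w.length < n
    · rw [if_pos h]
      exact ⟨fun h' => ⟨⟨h'.1.1, h'.2⟩, by omega⟩, fun h' => ⟨⟨h'.1.1, by omega⟩, h'.1.2⟩⟩
    · rw [if_neg h]
      exact ⟨fun h' => absurd h'.2 (Nat.not_lt_zero _), fun h' => absurd h'.2 (by omega)⟩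

/-- The Markov chain is driven by independent variables indexed by all possible states. On this
event the states visited are the truncations of `V`, so the event is a box in finitely many fixed,
distinct coordinates. -/
theorem ofOffspring_limitOffspring_mem_cyl_iff {ω : PlanarTree × ℕ → List ℕ → ℕ} {V : PlanarTree}
    {n : ℕ} : ofOffspring (limitOffspring ω) ∈ V.cyl n ↔
      ∀ j < n, ω (V.trunc j, j) ∈ V.offspringCyl j := by
  induction n with
  | zero => simp [cyl_zero]
  | succ n ih =>
    rw [Nat.forall_lt_succ_right, ← ih, ofOffspring_mem_cyl_succ_iff]
    refine and_congr_right fun h => forall₂_congr fun u hu => ?_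
    have hlen : u.length = n := by have := (mem_level_iff.1 hu).2; omega
    rw [limitOffspring_eq, ofOffspring_growOffspring, hlen, trunc_eq_iff.2 h]

theorem preimage_ofOffspring_limitOffspring_cyl (V : PlanarTree) (n : ℕ) [DecidableEq PlanarTree] :
    (fun ω => ofOffspring (limitOffspring ω)) ⁻¹' V.cyl n =
      Set.pi ((Finset.range n).image fun j => (V.trunc j, j) : Finset (PlanarTree × ℕ))
        fun p => V.offspringCyl p.2 := by
  ext ω
  simp [ofOffspring_limitOffspring_mem_cyl_iff, Set.mem_pi]

theorem measurable_ofOffspring_limitOffspring :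
    Measurable fun ω => ofOffspring (limitOffspring ω) :=
  measurable_of_cyl fun V n => by
    classical
    rw [preimage_ofOffspring_limitOffspring_cyl]
    exact MeasurableSet.pi (Finset.countable_toSet _) fun _ _ => measurableSet_offspringCyl _ _

/-- The law of the tree whose truncations grow by `spineMeasure`. -/
noncomputable def spineTreeLaw (μ : ℝ) : Measure PlanarTree :=
  (Measure.infinitePi (spineMeasure μ)).map fun ω => ofOffspring (limitOffspring ω)

instance (μ : ℝ) : IsProbabilityMeasure (spineTreeLaw μ) :=
  Measure.isProbabilityMeasure_map measurable_ofOffspring_limitOffspring.aemeasurable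

theorem spineTreeLaw_cyl_eq_prod (μ : ℝ) (V : PlanarTree) (n : ℕ) :
    spineTreeLaw μ (V.cyl n) =
      ∏ j ∈ Finset.range n, spineMeasure μ (V.trunc j, j) (V.offspringCyl j) := by
  classical
  rw [spineTreeLaw, Measure.map_apply measurable_ofOffspring_limitOffspring (measurableSet_cyl V n),
    preimage_ofOffspring_limitOffspring_cyl,
    Measure.infinitePi_pi _ fun _ _ => measurableSet_offspringCyl _ _, Finset.prod_image]
  exact fun i _ j _ h => congrArg Prod.snd h

theorem cylWeight_nonneg {μ : ℝ} (hμ : 0 ≤ μ) (V : PlanarTree) (n : ℕ) : 0 ≤ cylWeight μ V n := by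
  rw [cylWeight_eq]
  have := spinePoly_nonneg hμ (V.cylWidth n)
  have := rhoWeight_nonneg V n
  positivity

theorem cylWidth_succ_eq_zero {V : PlanarTree} {n : ℕ} (h : V.cylWidth n = 0) :
    V.cylWidth (n + 1) = 0 := by
  rw [cylWidth_succ]
  rw [cylWidth, Set.ncard_eq_zero (V.finite_level _)] at h
  simp [h]

/-- Each transition contributes the critical offspring probabilities times `p_{W'}(μ) / (e^μ
p_W(μ))`, and the quotients telescope. After extinction both sides are `0`, whatever value
`spineLaw` then has. -/
theorem spineTreeLaw_cyl {μ : ℝ} (hμ : 0 < μ) (V : PlanarTree) (n : ℕ) :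
    spineTreeLaw μ (V.cyl n) = ENNReal.ofReal (cylWeight μ V n) := by
  induction n with
  | zero =>
    rw [cyl_zero, measure_univ, cylWeight_eq, rhoWeight_zero, cylWidth_zero]
    simp [spinePoly]
  | succ n ih =>
    rw [spineTreeLaw_cyl_eq_prod, Finset.prod_range_succ, ← spineTreeLaw_cyl_eq_prod, ih]
    by_cases h : V.cylWidth n = 0
    · have h0 : ∀ m, V.cylWidth m = 0 → cylWeight μ V m = 0 := fun m hm => by
        rw [cylWeight_eq, hm]; simp [spinePoly]
      rw [h0 _ h, h0 _ (cylWidth_succ_eq_zero h)]; simp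
    · rw [spineMeasure_trunc_offspringCyl hμ h, ← ENNReal.ofReal_mul (cylWeight_nonneg hμ.le V n)]
      congr 1
      have := (spinePoly_pos hμ h).ne'
      rw [cylWeight_eq, cylWeight_eq, rhoWeight_succ, mul_inv, ← Real.exp_neg,
        show (-((n + 1 : ℕ) : ℝ) * μ) = -n * μ + -μ by push_cast; ring, Real.exp_add]
      field_simp

/-- Convergence on a π-system containing a neighbourhood base suffices, as the candidate limit is
already known to be a probability measure. -/
theorem tendsto_finiteSizeLaw {μ : ℝ} (hμ : 0 < μ) : Tendsto (finiteSizeLaw μ) atTop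
    (𝓝 (⟨spineTreeLaw μ, inferInstance⟩ : ProbabilityMeasure PlanarTree)) := by
  refine (isPiSystem_cylinders 0).tendsto_probabilityMeasure_of_tendsto_of_mem
    (fun s => measurableSet_of_mem_cylinders) (fun u hu T hT => ?_) ?_
  · obtain ⟨n, hn, hsub⟩ := exists_cyl_subset 0 hu hT
    exact ⟨T.cyl n, Or.inr ⟨T, n, hn, rfl⟩, (isOpen_cyl T n).mem_nhds (T.mem_cyl_self n), hsub⟩
  · rintro s (rfl | ⟨V, n, _, rfl⟩)
    · simp
    · have h := tendsto_finiteSizeLaw_cyl hμ V n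
      rw [← spineTreeLaw_cyl hμ] at h
      exact (ENNReal.tendsto_toNNReal (measure_ne_top (spineTreeLaw μ) _)).comp h

theorem localLimit_eq {μ : ℝ} (hμ : 0 < μ) : localLimit μ = ⟨spineTreeLaw μ, inferInstance⟩ :=
  (tendsto_finiteSizeLaw hμ).limUnder_eq

theorem tendsto_localLimit {μ : ℝ} (hμ : 0 < μ) :
    Tendsto (finiteSizeLaw μ) atTop (𝓝 (localLimit μ)) := by
  rw [localLimit_eq hμ]
  exact tendsto_finiteSizeLaw hμ

theorem localLimit_cyl {μ : ℝ} (hμ : 0 < μ) (V : PlanarTree) (n : ℕ) :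
    (localLimit μ : Measure PlanarTree) (V.cyl n) = ENNReal.ofReal (cylWeight μ V n) := by
  rw [localLimit_eq hμ]
  exact spineTreeLaw_cyl hμ V n

/-! ### The simplex measure in coordinates -/

/-- The parametrisation of the hyperplane `∑ m_i = μ` by all coordinates but the last. -/
def chart (d : ℕ) (μ : ℝ) (x : Fin d → ℝ) : Fin (d + 1) → ℝ :=
    Fin.snoc (α := fun _ => ℝ) x (μ - ∑ i, x i)

@[simp] theorem chart_castSucc {d : ℕ} (μ : ℝ) (x : Fin d → ℝ) (i : Fin d) :
    chart d μ x i.castSucc = x i := Fin.snoc_castSucc ..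

@[simp] theorem chart_last {d : ℕ} (μ : ℝ) (x : Fin d → ℝ) :
    chart d μ x (Fin.last d) = μ - ∑ i, x i := Fin.snoc_last ..

/-- The domain of the parametrisation `chart` of the open simplex. -/
def solidSimplex (d : ℕ) (μ : ℝ) : Set (Fin d → ℝ) := {x | (∀ i, 0 < x i) ∧ ∑ i, x i < μ}

theorem antilipschitzWith_chart (d : ℕ) (μ : ℝ) : AntilipschitzWith 1 (chart d μ) := fun x y => by
  rw [ENNReal.coe_one, one_mul, edist_pi_le_iff]
  intro i
  simpa using edist_le_pi_edist (chart d μ x) (chart d μ y) i.castSucc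

theorem lipschitzWith_chart (d : ℕ) (μ : ℝ) : LipschitzWith (d + 1) (chart d μ) := by
  refine LipschitzWith.of_dist_le_mul fun x y => ?_
  have hd : (0 : ℝ) ≤ d * dist x y := by positivity
  push_cast
  rw [dist_pi_le_iff (by positivity)]
  intro i
  refine Fin.lastCases ?_ (fun i => ?_) i
  · rw [chart_last, chart_last, Real.dist_eq,
      show μ - ∑ i, x i - (μ - ∑ i, y i) = ∑ i, (y i - x i) by rw [Finset.sum_sub_distrib]; ring]
    refine (Finset.abs_sum_le_sum_abs _ _).trans ?_
    refine (Finset.sum_le_card_nsmul _ _ (dist x y) fun i _ => ?_).trans ?_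
    · rw [abs_sub_comm, ← Real.dist_eq]
      exact dist_le_pi_dist x y i
    · rw [Finset.card_univ, Fintype.card_fin, nsmul_eq_mul]
      nlinarith [dist_nonneg (x := x) (y := y)]
  · rw [chart_castSucc, chart_castSucc]
    nlinarith [dist_le_pi_dist x y i]

theorem measurableEmbedding_chart (d : ℕ) (μ : ℝ) : MeasurableEmbedding (chart d μ) :=
  ((antilipschitzWith_chart d μ).isClosedEmbedding
    (lipschitzWith_chart d μ).uniformContinuous).measurableEmbedding

theorem chart_add (d : ℕ) (μ : ℝ) (x y : Fin d → ℝ) : chart d μ (x + y) = chart d 0 x +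
    chart d μ y := by
  funext i
  refine Fin.lastCases ?_ (fun i => ?_) i
  · simp [Finset.sum_add_distrib]; ring
  · simp

theorem image_chart_solidSimplex (d : ℕ) (μ : ℝ) :
    chart d μ '' solidSimplex d μ = simplex (Fin (d + 1)) μ := by
  ext m
  constructor
  · rintro ⟨x, ⟨hx, hs⟩, rfl⟩
    refine ⟨by simp [Fin.sum_univ_castSucc], fun i => ?_⟩
    refine Fin.lastCases ?_ (fun i => ?_) i
    · rw [chart_last]; linarith
    · rw [chart_castSucc]; exact hx i
  · rintro ⟨hs, hm⟩
    rw [Fin.sum_univ_castSucc] at hs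
    refine ⟨fun i => m i.castSucc, ⟨fun i => hm _, by have := hm (Fin.last d); linarith⟩, ?_⟩
    funext i
    refine Fin.lastCases ?_ (fun i => ?_) i
    · rw [chart_last]; linarith
    · rw [chart_castSucc]

theorem hausdorffMeasure_fin (d : ℕ) : (Measure.hausdorffMeasure (d : ℝ) : Measure (Fin d → ℝ)) =
    volume := by
  have := hausdorffMeasure_pi_real (ι := Fin d)
  rwa [Fintype.card_fin] at this

/-- Translations of the coordinates act as translations of the hyperplane, so the pulled back
Hausdorff measure is translation invariant. It is finite on compact sets since `chart` is Lipschitz,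
and nonzero since `chart` is antilipschitz. Uniqueness of Haar measure applies, and normalisation
later removes `c`. -/
theorem exists_comap_chart (d : ℕ) (μ : ℝ) : ∃ c : ℝ≥0∞, c ≠ 0 ∧ c ≠ ⊤ ∧
    Measure.comap (chart d μ) (Measure.hausdorffMeasure (d : ℝ)) = c • volume := by
  set ν : Measure (Fin d → ℝ) := Measure.comap (chart d μ) (Measure.hausdorffMeasure (d : ℝ)) with
      hν
  have happ : ∀ A, ν A = Measure.hausdorffMeasure (d : ℝ) (chart d μ '' A) :=
    (measurableEmbedding_chart d μ).comap_apply _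
  have hle : ∀ A, ν A ≤ ((d + 1 : NNReal) : ℝ≥0∞) ^ (d : ℝ) * volume A := fun A => by
    rw [happ, ← hausdorffMeasure_fin]
    exact (lipschitzWith_chart d μ).hausdorffMeasure_image_le (Nat.cast_nonneg _) A
  have hge : ∀ A, volume A ≤ ν A := fun A => by
    have := (antilipschitzWith_chart d μ).le_hausdorffMeasure_image (Nat.cast_nonneg d) A
    rwa [ENNReal.coe_one, ENNReal.one_rpow, one_mul, ← happ, hausdorffMeasure_fin] at this
  have hinv : ν.IsAddLeftInvariant := by
    refine (forall_measure_preimage_add_iff ν).1 fun g A _ => ?_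
    rw [happ, happ]
    have : chart d μ '' A = (IsometryEquiv.addLeft (chart d 0 g)) ''
        (chart d μ '' ((fun h => g + h) ⁻¹' A)) := by
      rw [Set.image_image]
      have h1 : ∀ x, (IsometryEquiv.addLeft (chart d 0 g)) (chart d μ x) = chart d μ (g + x) :=
        fun x => (chart_add d μ g x).symm
      simp_rw [h1]
      rw [← Set.image_image (chart d μ) (fun x => g + x),
        Set.image_preimage_eq _ (add_left_surjective g)]
    rw [this, IsometryEquiv.hausdorffMeasure_image]
  have hfin : IsFiniteMeasureOnCompacts ν := ⟨fun K hK =>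
    (hle K).trans_lt (ENNReal.mul_lt_top (ENNReal.rpow_lt_top_of_nonneg (Nat.cast_nonneg _)
      ENNReal.coe_ne_top) hK.measure_lt_top)⟩
  have h := Measure.isAddLeftInvariant_eq_smul ν volume
  refine ⟨ν.addHaarScalarFactor volume, fun h0 => ?_, ENNReal.coe_ne_top, ?_⟩
  · have h1 := hge (Set.univ.pi fun _ => Set.Ioo 0 1)
    rw [h, Measure.smul_apply, ENNReal.smul_def, h0, zero_smul, Real.volume_pi_Ioo] at h1
    simp at h1
  · exact h

theorem measurableSet_solidSimplex (d : ℕ) (μ : ℝ) : MeasurableSet (solidSimplex d μ) := by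
  have h1 : MeasurableSet {x : Fin d → ℝ | ∀ i, 0 < x i} := by
    rw [Set.ofPred_forall]
    exact MeasurableSet.iInter fun i => measurableSet_lt measurable_const (measurable_pi_apply i)
  exact h1.inter (measurableSet_lt (f := fun x : Fin d → ℝ => ∑ i, x i) (by fun_prop)
    measurable_const)

/-- In the coordinates of `chart`, the simplex measure is the normalised Lebesgue measure. -/
theorem simplexMeasure_fin (d : ℕ) (μ : ℝ) : simplexMeasure (Fin (d + 1)) μ =
    (volume (solidSimplex d μ))⁻¹ • (volume.restrict (solidSimplex d μ)).map (chart d μ) := by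
  obtain ⟨c, hc0, hctop, hc⟩ := exists_comap_chart d μ
  have hemb := measurableEmbedding_chart d μ
  have hcard : (Fintype.card (Fin (d + 1)) : ℝ) - 1 = d := by
    rw [Fintype.card_fin]; push_cast; ring
  have hS : Measure.hausdorffMeasure (d : ℝ) (simplex (Fin (d + 1)) μ) =
      c * volume (solidSimplex d μ) := by
    rw [← image_chart_solidSimplex, ← hemb.comap_apply, hc, Measure.smul_apply, smul_eq_mul]
  have hR : (Measure.hausdorffMeasure (d : ℝ)).restrict (simplex (Fin (d + 1)) μ) =
      c • (volume.restrict (solidSimplex d μ)).map (chart d μ) := by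
    rw [← Measure.map_smul, ← Measure.restrict_smul, ← hc, hemb.restrict_comap,
      hemb.map_comap, Measure.restrict_restrict hemb.measurableSet_range,
      Set.inter_eq_right.2 (Set.image_subset_range _ _), image_chart_solidSimplex]
  rw [simplexMeasure, ProbabilityTheory.cond, hcard, hS, hR, smul_smul,
      ENNReal.mul_inv (Or.inl hc0) (Or.inl hctop),
    mul_right_comm, ENNReal.inv_mul_cancel hc0 hctop, one_mul]

/-- Fubini in the first coordinate: once it equals `t`, the others range over the simplex of size `μ
- t`. -/
theorem lintegral_solidSimplex_succ (d : ℕ) (μ : ℝ) {f : (Fin (d + 1) → ℝ) → ℝ≥0∞}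
    (hf : Measurable f) : ∫⁻ x in solidSimplex (d + 1) μ, f x =
      ∫⁻ t in Set.Ioo 0 μ, ∫⁻ x in solidSimplex d (μ - t), f (Fin.cons t x) := by
  have hmp := (volume_preserving_piFinSuccAbove (fun _ : Fin (d + 1) => ℝ) 0).symm
  have hmeas := (hf.indicator (measurableSet_solidSimplex (d + 1) μ)).comp hmp.measurable
  rw [← lintegral_indicator (measurableSet_solidSimplex _ _),
    ← hmp.lintegral_comp (hf.indicator (measurableSet_solidSimplex _ _)),
    Measure.volume_eq_prod, lintegral_prod (fun p => (solidSimplex (d + 1) μ).indicator f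
      ((MeasurableEquiv.piFinSuccAbove (fun _ => ℝ) 0).symm p)) hmeas.aemeasurable,
    ← lintegral_indicator measurableSet_Ioo]
  refine lintegral_congr fun t => ?_
  have hcons : ∀ x : Fin d → ℝ, (MeasurableEquiv.piFinSuccAbove (fun _ : Fin (d + 1) => ℝ) 0).symm
      (t, x) = Fin.cons t x := fun x => by
    simp [MeasurableEquiv.piFinSuccAbove, Fin.insertNthEquiv]
  simp only [hcons]
  have hmem : ∀ x : Fin d → ℝ, (Fin.cons t x : Fin (d + 1) → ℝ) ∈ solidSimplex (d + 1) μ ↔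
      t ∈ Set.Ioo 0 μ ∧ x ∈ solidSimplex d (μ - t) := by
    intro x
    simp only [solidSimplex, Set.mem_ofPred_eq, Fin.forall_fin_succ, Fin.cons_zero, Fin.cons_succ,
      Fin.sum_univ_succ, Set.mem_Ioo]
    constructor
    · rintro ⟨⟨h0, hx⟩, hs⟩
      have := Finset.sum_nonneg fun i (_ : i ∈ Finset.univ) => (hx i).le
      exact ⟨⟨h0, by linarith⟩, hx, by linarith⟩
    · rintro ⟨⟨h0, _⟩, hx, hs⟩
      exact ⟨⟨h0, hx⟩, by linarith⟩
  by_cases ht : t ∈ Set.Ioo 0 μ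
  · rw [Set.indicator_of_mem ht, ← lintegral_indicator (measurableSet_solidSimplex _ _)]
    refine lintegral_congr fun x => ?_
    by_cases hx : x ∈ solidSimplex d (μ - t)
    · rw [Set.indicator_of_mem hx, Set.indicator_of_mem ((hmem x).2 ⟨ht, hx⟩)]
    · rw [Set.indicator_of_notMem hx, Set.indicator_of_notMem fun h => hx ((hmem x).1 h).2]
  · rw [Set.indicator_of_notMem ht]
    simp_rw [fun x => Set.indicator_of_notMem (f := f) fun h => ht ((hmem x).1 h).1]
    simp

/-- The integral `∫ ∏ g_i(m_i)` over the open simplex with respect to Lebesgue measure. -/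
noncomputable def simplexIntegral (d : ℕ) (g : Fin (d + 1) → ℝ → ℝ≥0∞) (μ : ℝ) : ℝ≥0∞ :=
  ∫⁻ x in solidSimplex d μ, ∏ i, g i (chart d μ x i)

theorem chart_cons (d : ℕ) (μ t : ℝ) (x : Fin d → ℝ) :
    chart (d + 1) μ (Fin.cons t x) = Fin.cons t (chart d (μ - t) x) := by
  funext i
  refine Fin.lastCases ?_ (fun i => ?_) i
  · rw [chart_last, ← Fin.succ_last, Fin.cons_succ, chart_last, Fin.sum_univ_succ]
    simp; ring
  · rw [chart_castSucc]
    refine Fin.cases rfl (fun i => ?_) i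
    rw [Fin.cons_succ, ← Fin.succ_castSucc, Fin.cons_succ, chart_castSucc]

theorem simplexIntegral_succ (d : ℕ) {g : Fin (d + 2) → ℝ → ℝ≥0∞} (hg : ∀ i, Measurable (g i))
    (μ : ℝ) : simplexIntegral (d + 1) g μ =
      ∫⁻ t in Set.Ioo 0 μ, g 0 t * simplexIntegral d (fun i => g i.succ) (μ - t) := by
  have hm : ∀ (e : ℕ) (ν : ℝ), Measurable (chart e ν) := fun e ν =>
    (measurableEmbedding_chart e ν).measurable
  have hmeas : ∀ (e : ℕ) (ν : ℝ) (g : Fin (e + 1) → ℝ → ℝ≥0∞), (∀ i, Measurable (g i)) →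
      Measurable fun x => ∏ i, g i (chart e ν x i) := fun e ν g hg =>
    Finset.measurable_prod _ fun i _ => (hg i).comp ((measurable_pi_apply i).comp (hm e ν))
  rw [simplexIntegral, lintegral_solidSimplex_succ _ _ (hmeas _ _ g hg)]
  refine lintegral_congr fun t => ?_
  rw [simplexIntegral, ← lintegral_const_mul _ (hmeas _ _ _ fun i => hg i.succ)]
  refine lintegral_congr fun x => ?_
  rw [chart_cons, Fin.prod_univ_succ]
  simp

theorem simplexIntegral_zero (g : Fin 1 → ℝ → ℝ≥0∞) {μ : ℝ} (hμ : 0 < μ) :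
    simplexIntegral 0 g μ = g 0 μ := by
  have h : solidSimplex 0 μ = Set.univ := Set.eq_univ_of_forall fun x =>
      ⟨fun i => i.elim0, by simpa⟩
  rw [simplexIntegral, h, Measure.restrict_univ, Measure.volume_pi_eq_dirac, lintegral_dirac]
  rw [Fin.prod_univ_one, show (0 : Fin 1) = Fin.last 0 from rfl, chart_last]
  simp

theorem lintegral_sub_pow {μ : ℝ} (hμ : 0 ≤ μ) (d : ℕ) :
    ∫⁻ t in Set.Ioo 0 μ, ENNReal.ofReal ((μ - t) ^ d / (d.factorial : ℝ)) =
      ENNReal.ofReal (μ ^ (d + 1) / ((d + 1).factorial : ℝ)) := by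
  have hint : ∫ t in (0 : ℝ)..μ, (μ - t) ^ d / (d.factorial : ℝ) =
      μ ^ (d + 1) / ((d + 1).factorial : ℝ) := by
    rw [intervalIntegral.integral_div, intervalIntegral.integral_comp_sub_left fun t => t ^ d]
    rw [sub_self, sub_zero, integral_pow, Nat.factorial_succ]
    push_cast
    field_simp
    simp
  rw [← hint, intervalIntegral.integral_of_le hμ, ofReal_integral_eq_lintegral_ofReal]
  · rw [restrict_Ioo_eq_restrict_Ioc]
  · exact (Continuous.integrableOn_Icc (by fun_prop)).mono_set Set.Ioc_subset_Icc_self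
  · refine (ae_restrict_iff' measurableSet_Ioc).2 (ae_of_all _ fun t ht => ?_)
    have : 0 ≤ μ - t := by linarith [ht.2]
    positivity

theorem volume_solidSimplex (d : ℕ) {μ : ℝ} (hμ : 0 < μ) :
    volume (solidSimplex d μ) = ENNReal.ofReal (μ ^ d / (d.factorial : ℝ)) := by
  have h : ∀ ν, volume (solidSimplex d ν) = simplexIntegral d (fun _ _ => 1) ν := fun ν => by
    simp [simplexIntegral]
  rw [h]; clear h
  induction d generalizing μ with
  | zero => rw [simplexIntegral_zero _ hμ]; simp
  | succ d ih =>
    rw [simplexIntegral_succ _ fun _ => measurable_const, ← lintegral_sub_pow hμ.le]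
    refine setLIntegral_congr_fun measurableSet_Ioo fun t ht => ?_
    rw [Set.mem_Ioo] at ht
    simp only [one_mul]
    exact ih (by linarith)

/-- The coefficient `μ^d / d!` of the theorem is the volume of the solid simplex and undoes the
normalisation of `dω`. -/
theorem lintegral_simplexMeasure_fin (d : ℕ) {μ : ℝ} (hμ : 0 < μ) {g : Fin (d + 1) → ℝ → ℝ≥0∞} :
    ENNReal.ofReal (μ ^ d / (d.factorial : ℝ)) *
      ∫⁻ m, ∏ i, g i (m i) ∂simplexMeasure (Fin (d + 1)) μ = simplexIntegral d g μ := by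
  have hpos : ENNReal.ofReal (μ ^ d / (d.factorial : ℝ)) ≠ 0 :=
    (ENNReal.ofReal_pos.2 (by positivity)).ne'
  rw [simplexMeasure_fin, lintegral_smul_measure, (measurableEmbedding_chart d μ).lintegral_map,
    volume_solidSimplex d hμ, smul_eq_mul, ← mul_assoc,
    ENNReal.mul_inv_cancel hpos ENNReal.ofReal_ne_top, one_mul, simplexIntegral]

theorem map_simplexMeasure {ι κ : Type*} [Fintype ι] [Fintype κ] (e : ι ≃ κ) (μ : ℝ) :
    (simplexMeasure ι μ).map (MeasurableEquiv.piCongrLeft (fun _ => ℝ) e) = simplexMeasure κ μ := by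
  set E := MeasurableEquiv.piCongrLeft (fun _ : κ => ℝ) e
  have hcoe : ∀ m i, E m (e i) = m i := fun m i => Equiv.piCongrLeft_apply_apply ..
  have hS : E ⁻¹' simplex κ μ = simplex ι μ := by
    ext m
    rw [Set.mem_preimage, simplex, simplex, Set.mem_ofPred_eq, Set.mem_ofPred_eq,
      ← e.sum_comp fun i => E m i]
    simp only [← e.forall_congr_right (q := fun i => 0 < E m i), hcoe]
  have hH : ∀ d : ℝ, (Measure.hausdorffMeasure d).map E = Measure.hausdorffMeasure d := fun d =>
    (IsometryEquiv.piCongrLeft (Y := fun _ : κ => ℝ) e).map_hausdorffMeasure d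
  rw [simplexMeasure, simplexMeasure, ProbabilityTheory.cond, ProbabilityTheory.cond,
    Measure.map_smul, ← hS, ← E.restrict_map, ← E.map_apply, hH, Fintype.card_congr e]

theorem lintegral_simplexMeasure {κ : Type*} [Fintype κ] {d : ℕ} (e : Fin (d + 1) ≃ κ) {μ : ℝ}
    (hμ : 0 < μ) (g : κ → ℝ → ℝ≥0∞) : ENNReal.ofReal (μ ^ d / (d.factorial : ℝ)) *
      ∫⁻ m, ∏ i, g i (m i) ∂simplexMeasure κ μ = simplexIntegral d (fun i => g (e i)) μ := by
  rw [← lintegral_simplexMeasure_fin d hμ, ← map_simplexMeasure e, lintegral_map_equiv]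
  congr 1
  refine lintegral_congr fun m => ?_
  rw [← e.prod_comp]
  refine Finset.prod_congr rfl fun i _ => ?_
  rw [show MeasurableEquiv.piCongrLeft (fun _ : κ => ℝ) e m (e i) = m i from
    Equiv.piCongrLeft_apply_apply ..]

theorem ae_mem_simplex (ι : Type*) [Fintype ι] (μ : ℝ) :
    ∀ᵐ m ∂simplexMeasure ι μ, m ∈ simplex ι μ := by
  have hS : MeasurableSet (simplex ι μ) := by
    have h1 : MeasurableSet {x : ι → ℝ | ∀ i, 0 < x i} := by
      rw [Set.ofPred_forall]
      exact MeasurableSet.iInter fun i => measurableSet_lt measurable_const (measurable_pi_apply i)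
    exact (measurableSet_eq_fun (f := fun x : ι → ℝ => ∑ i, x i) (by fun_prop)
      measurable_const).inter h1
  exact Measure.ae_smul_measure (ae_restrict_mem hS) _

/-! ### The Dirichlet integrals -/

theorem integral_pow_mul_sub_pow (μ : ℝ) (i j : ℕ) :
    ∫ t in (0 : ℝ)..μ, t ^ i / (i.factorial : ℝ) * ((μ - t) ^ j / (j.factorial : ℝ)) =
      μ ^ (i + j + 1) / ((i + j + 1).factorial : ℝ) := by
  induction i generalizing j with
  | zero =>
    simp only [pow_zero, Nat.factorial_zero, Nat.cast_one, div_one, one_mul, zero_add]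
    rw [intervalIntegral.integral_div, intervalIntegral.integral_comp_sub_left fun t => t ^ j]
    rw [sub_self, sub_zero, integral_pow, Nat.factorial_succ]
    push_cast
    field_simp
    simp
  | succ i ih =>
    have hder : ∀ t ∈ Set.uIcc 0 μ, HasDerivAt (fun t : ℝ => t ^ (i + 1) / ((i + 1).factorial : ℝ) *
        ((μ - t) ^ (j + 1) / ((j + 1).factorial : ℝ)))
        (t ^ i / (i.factorial : ℝ) * ((μ - t) ^ (j + 1) / ((j + 1).factorial : ℝ)) -
          t ^ (i + 1) / ((i + 1).factorial : ℝ) * ((μ - t) ^ j / (j.factorial : ℝ))) t := by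
      intro t _
      have h1 := ((hasDerivAt_id t).pow (i + 1)).div_const ((i + 1).factorial : ℝ)
      have h2 := (((hasDerivAt_id t).const_sub μ).pow (j + 1)).div_const ((j + 1).factorial : ℝ)
      refine (h1.mul h2).congr_deriv ?_
      simp only [id, Nat.factorial_succ, Nat.cast_mul, Pi.pow_apply]
      push_cast
      have := Nat.factorial_ne_zero i
      have := Nat.factorial_ne_zero j
      have : (i : ℝ) + 1 ≠ 0 := by positivity
      have : (j : ℝ) + 1 ≠ 0 := by positivity
      field_simp
      ring
    have hc1 : IntervalIntegrable (fun t : ℝ => t ^ i / (i.factorial : ℝ) *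
        ((μ - t) ^ (j + 1) / ((j + 1).factorial : ℝ))) volume 0 μ :=
      Continuous.intervalIntegrable (by fun_prop) _ _
    have hc2 : IntervalIntegrable (fun t : ℝ => t ^ (i + 1) / ((i + 1).factorial : ℝ) *
        ((μ - t) ^ j / (j.factorial : ℝ))) volume 0 μ :=
      Continuous.intervalIntegrable (by fun_prop) _ _
    have h := intervalIntegral.integral_eq_sub_of_hasDerivAt hder (hc1.sub hc2)
    rw [intervalIntegral.integral_sub hc1 hc2, ih] at h
    simp only [sub_self, ne_eq, Nat.add_eq_zero_iff, one_ne_zero, and_false, not_false_eq_true,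
      zero_pow, zero_div, mul_zero, zero_mul] at h
    rw [← sub_eq_zero.1 h, show i + (j + 1) + 1 = i + 1 + j + 1 by ring]

theorem lintegral_pow_mul_sub_pow {μ : ℝ} (hμ : 0 ≤ μ) (i j : ℕ) :
    ∫⁻ t in Set.Ioo 0 μ, ENNReal.ofReal (t ^ i / (i.factorial : ℝ)) *
      ENNReal.ofReal ((μ - t) ^ j / (j.factorial : ℝ)) =
      ENNReal.ofReal (μ ^ (i + j + 1) / ((i + j + 1).factorial : ℝ)) := by
  rw [← integral_pow_mul_sub_pow μ i j, intervalIntegral.integral_of_le hμ,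
    ofReal_integral_eq_lintegral_ofReal]
  · rw [restrict_Ioo_eq_restrict_Ioc]
    refine setLIntegral_congr_fun measurableSet_Ioc fun t ht => ?_
    have := ht.1.le
    exact (ENNReal.ofReal_mul (by positivity)).symm
  · exact (Continuous.integrableOn_Icc (by fun_prop)).mono_set Set.Ioc_subset_Icc_self
  · refine (ae_restrict_iff' measurableSet_Ioc).2 (ae_of_all _ fun t ht => ?_)
    have : 0 ≤ μ - t := by linarith [ht.2]
    have := ht.1.le
    positivity

theorem ENNReal_tsum_prod_antidiagonal (f : ℕ → ℕ → ℝ≥0∞) :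
    ∑' (i : ℕ) (j : ℕ), f i j = ∑' n : ℕ, ∑ p ∈ Finset.HasAntidiagonal.antidiagonal n,
        f p.1 p.2 := by
  rw [← ENNReal.tsum_prod, ← Finset.HasAntidiagonal.sigmaAntidiagonalEquivProd.tsum_eq,
      ENNReal.tsum_sigma']
  refine tsum_congr fun n => ?_
  rw [← Finset.tsum_subtype]
  rfl

theorem choose_add_two (L M n : ℕ) : (L + M).choose (n + 2) = L.choose (n + 2) + M.choose (n + 2) +
    ∑ p ∈ Finset.HasAntidiagonal.antidiagonal n, L.choose (p.1 + 1) * M.choose (p.2 + 1) := by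
  rw [Nat.add_choose_eq, Finset.Nat.sum_antidiagonal_succ, Finset.Nat.sum_antidiagonal_succ']
  simp
  ring

/-- Vandermonde's identity in disguise: convolution sends `t^i/i!` and `t^j/j!` to
`μ^{i+j+1}/(i+j+1)!`. The mixed terms of `(L+M).choose (n+2)` thus form the integral, and the two
pure ones form `p_L` and `p_M`. -/
theorem ofReal_spinePoly_add {μ : ℝ} (hμ : 0 ≤ μ) (L M : ℕ) :
    ENNReal.ofReal (spinePoly (L + M) μ) =
      ENNReal.ofReal (spinePoly L μ) + ENNReal.ofReal (spinePoly M μ) +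
        ∫⁻ t in Set.Ioo 0 μ, ENNReal.ofReal (spinePoly L t) *
            ENNReal.ofReal (spinePoly M (μ - t)) := by
  have hconv : ∫⁻ t in Set.Ioo 0 μ, ENNReal.ofReal (spinePoly L t) *
      ENNReal.ofReal (spinePoly M (μ - t)) = ∑' n : ℕ,
        (∑ p ∈ Finset.HasAntidiagonal.antidiagonal n,
          (L.choose (p.1 + 1) : ℝ≥0∞) * (M.choose (p.2 + 1) : ℝ≥0∞)) *
          ENNReal.ofReal (μ ^ (n + 1) / ((n + 1).factorial : ℝ)) := by
    have h1 : ∫⁻ t in Set.Ioo 0 μ, ENNReal.ofReal (spinePoly L t) *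
        ENNReal.ofReal (spinePoly M (μ - t)) = ∫⁻ t in Set.Ioo 0 μ, ∑' (i : ℕ) (j : ℕ),
          ((L.choose (i + 1) : ℝ≥0∞) * (M.choose (j + 1) : ℝ≥0∞)) *
          (ENNReal.ofReal (t ^ i / (i.factorial : ℝ)) *
            ENNReal.ofReal ((μ - t) ^ j / (j.factorial : ℝ))) := by
      refine setLIntegral_congr_fun measurableSet_Ioo fun t ht => ?_
      rw [spinePoly_eq_tsum ht.1.le, spinePoly_eq_tsum (by linarith [ht.2]),
        ← ENNReal.tsum_mul_right]
      refine tsum_congr fun i => ?_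
      rw [← ENNReal.tsum_mul_left]
      exact tsum_congr fun j => by ring
    have hm : ∀ i j : ℕ, Measurable fun t : ℝ =>
        ENNReal.ofReal (t ^ i / (i.factorial : ℝ)) *
            ENNReal.ofReal ((μ - t) ^ j / (j.factorial : ℝ)) := fun i j => by fun_prop
    rw [h1, lintegral_tsum fun i => (Measurable.tsum fun j => (hm i j).const_mul _).aemeasurable]
    simp_rw [lintegral_tsum fun j => ((hm _ j).const_mul _).aemeasurable,
      lintegral_const_mul _ (hm _ _), lintegral_pow_mul_sub_pow hμ]
    rw [ENNReal_tsum_prod_antidiagonal]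
    refine tsum_congr fun n => ?_
    rw [Finset.sum_mul]
    refine Finset.sum_congr rfl fun p hp => ?_
    rw [Finset.HasAntidiagonal.mem_antidiagonal.1 hp]
  rw [hconv]
  simp_rw [spinePoly_eq_tsum hμ]
  have hz : ∀ f : ℕ → ℝ≥0∞, ∑' n, f n = f 0 + ∑' n, f (n + 1) := fun f =>
    tsum_eq_zero_add' ENNReal.summable
  rw [hz, hz fun n => (L.choose (n + 1) : ℝ≥0∞) * _, hz fun n => (M.choose (n + 1) : ℝ≥0∞) * _]
  simp_rw [choose_add_two]
  push_cast
  simp_rw [add_mul, ENNReal.tsum_add]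
  simp only [Nat.choose_one_right]
  push_cast
  ring

theorem measurable_simplexIntegral {d : ℕ} {g : Fin (d + 1) → ℝ → ℝ≥0∞}
    (hg : ∀ i, Measurable (g i)) : Measurable (simplexIntegral d g) := by
  have hS : MeasurableSet {p : ℝ × (Fin d → ℝ) | p.2 ∈ solidSimplex d p.1} := by
    have h1 : MeasurableSet {p : ℝ × (Fin d → ℝ) | ∀ i, 0 < p.2 i} := by
      rw [Set.ofPred_forall]
      exact MeasurableSet.iInter fun i => measurableSet_lt measurable_const (by fun_prop)
    exact h1.inter (measurableSet_lt (f := fun p : ℝ × (Fin d → ℝ) => ∑ i, p.2 i) (by fun_prop)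
      measurable_fst)
  have hc : ∀ i, Measurable fun p : ℝ × (Fin d → ℝ) => chart d p.1 p.2 i := by
    intro i
    refine Fin.lastCases ?_ (fun i => ?_) i
    · simp only [chart_last]; fun_prop
    · simp only [chart_castSucc]; fun_prop
  have hm : Measurable fun p : ℝ × (Fin d → ℝ) => ∏ i, g i (chart d p.1 p.2 i) :=
    Finset.measurable_prod _ fun i _ => (hg i).comp (hc i)
  have := (hm.indicator hS).lintegral_prod_right' (ν := (volume : Measure (Fin d → ℝ)))
  convert this using 2 with ν
  rw [simplexIntegral, ← lintegral_indicator (measurableSet_solidSimplex _ _)]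
  rfl

/-! ### Expansion of `spinePoly` over subsets -/

section SubsetSum

variable {κ : Type*} {g : κ → ℝ → ℝ≥0∞}

open scoped Classical in
/-- The integral `∫ ∏_{i ∈ D} g_i(m_i)` over the open simplex with respect to Lebesgue measure. -/
noncomputable def subsetIntegral (g : κ → ℝ → ℝ≥0∞) (D : Finset κ) (μ : ℝ) : ℝ≥0∞ :=
  if D.Nonempty then ENNReal.ofReal (μ ^ (D.card - 1) / ((D.card - 1).factorial : ℝ)) *
    ∫⁻ m, ∏ i : {i // i ∈ D}, g i (m i) ∂simplexMeasure {i // i ∈ D} μ else 0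

theorem subsetIntegral_eq {D : Finset κ} {d : ℕ} (e : Fin (d + 1) ≃ {i // i ∈ D}) {μ : ℝ}
    (hμ : 0 < μ) : subsetIntegral g D μ = simplexIntegral d (fun i => g (e i)) μ := by
  have hcard : D.card = d + 1 := by
    rw [← Fintype.card_coe, ← Fintype.card_congr e, Fintype.card_fin]
  rw [subsetIntegral, if_pos (Finset.card_pos.1 (by omega)), hcard, Nat.add_sub_cancel]
  exact lintegral_simplexMeasure e hμ fun i => g i

theorem exists_equiv_of_nonempty {D : Finset κ} (hD : D.Nonempty) :
    ∃ d, Nonempty (Fin (d + 1) ≃ {i // i ∈ D}) := by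
  refine ⟨D.card - 1, ⟨(finCongr ?_).trans D.equivFin.symm⟩⟩
  have := hD.card_pos
  omega

/-- Integration over the coordinate of `a` first. For `D = ∅` the simplex is the point `μ`, and the
convolution vanishes because the empty set has integral `0` by convention. -/
theorem subsetIntegral_insert [DecidableEq κ] (hg : ∀ i, Measurable (g i)) {D : Finset κ} {a :
    κ} (ha : a ∉ D)
    {μ : ℝ} (hμ : 0 < μ) : subsetIntegral g (insert a D) μ = (if D = ∅ then g a μ else 0) +
      ∫⁻ t in Set.Ioo 0 μ, g a t * subsetIntegral g D (μ - t) := by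
  rcases D.eq_empty_or_nonempty with rfl | hD
  · have e : Fin (0 + 1) ≃ {i // i ∈ insert a (∅ : Finset κ)} :=
      ⟨fun _ => ⟨a, by simp⟩, fun _ => 0, fun i => Subsingleton.elim (α := Fin 1) _ _,
        fun i => Subtype.ext (by have := i.2; simp at this; exact this.symm)⟩
    rw [subsetIntegral_eq e hμ, simplexIntegral_zero _ hμ, if_pos rfl]
    have : (e 0).1 = a := by exact Finset.mem_singleton.1 (e 0).2
    rw [this]
    simp [subsetIntegral]
  · obtain ⟨d, ⟨e⟩⟩ := exists_equiv_of_nonempty hD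
    set e' : Fin (d + 1 + 1) ≃ {i // i ∈ insert a D} :=
      ((finSuccEquiv (d + 1)).trans e.optionCongr).trans (Finset.subtypeInsertEquivOption ha).symm
      with he'
    have h0 : (e' 0).1 = a := by simp [he', Finset.subtypeInsertEquivOption]
    have hs : ∀ i : Fin (d + 1), (e' i.succ).1 = (e i).1 := fun i => by
      simp [he', Finset.subtypeInsertEquivOption]
    rw [subsetIntegral_eq e' hμ, simplexIntegral_succ _ fun i => hg _, if_neg hD.ne_empty, zero_add]
    refine setLIntegral_congr_fun measurableSet_Ioo fun t ht => ?_
    rw [subsetIntegral_eq e (by linarith [ht.2]), h0]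
    simp_rw [hs]

theorem aemeasurable_subsetIntegral (hg : ∀ i, Measurable (g i)) (D : Finset κ) (μ : ℝ) :
    AEMeasurable (fun t => subsetIntegral g D (μ - t)) (volume.restrict (Set.Ioo 0 μ)) := by
  rcases D.eq_empty_or_nonempty with rfl | hD
  · simp [subsetIntegral]
  · obtain ⟨d, ⟨e⟩⟩ := exists_equiv_of_nonempty hD
    refine AEMeasurable.congr (f := fun t => simplexIntegral d (fun i => g (e i)) (μ - t))
      ((measurable_simplexIntegral fun i => hg _).comp
        (measurable_const.sub measurable_id)).aemeasurable ?_
    refine (ae_restrict_iff' measurableSet_Ioo).2 (ae_of_all _ fun t ht => ?_)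
    exact (subsetIntegral_eq e (by linarith [ht.2])).symm

theorem measurable_ofReal_spinePoly (L : ℕ) :
    Measurable fun t => ENNReal.ofReal (spinePoly L t) := by
  unfold spinePoly
  fun_prop

/-- In the convolution algebra this is the expansion of `∏ (δ + p_{l_i}) - δ`, obtained by iterating
`ofReal_spinePoly_add`. -/
theorem sum_subsetIntegral [DecidableEq κ] (l : κ → ℕ) (s : Finset κ) {μ : ℝ} (hμ : 0 < μ) :
    ∑ D ∈ s.powerset, subsetIntegral (fun i t => ENNReal.ofReal (spinePoly (l i) t)) D μ =
      ENNReal.ofReal (spinePoly (∑ i ∈ s, l i) μ) := by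
  have hg : ∀ i, Measurable fun t => ENNReal.ofReal (spinePoly (l i) t) :=
    fun i => measurable_ofReal_spinePoly _
  induction s using Finset.induction_on generalizing μ with
  | empty => simp [subsetIntegral, spinePoly]
  | insert a s ha ih =>
    rw [Finset.sum_powerset_insert ha, ih hμ, Finset.sum_insert ha, ofReal_spinePoly_add hμ.le]
    have h1 : ∀ D ∈ s.powerset,
        subsetIntegral (fun i t => ENNReal.ofReal (spinePoly (l i) t)) (insert a D) μ =
        (if D = ∅ then ENNReal.ofReal (spinePoly (l a) μ) else 0) +
      ∫⁻ t in Set.Ioo 0 μ, ENNReal.ofReal (spinePoly (l a) t) *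
        subsetIntegral (fun i t => ENNReal.ofReal (spinePoly (l i) t)) D (μ - t) := fun D hD =>
      subsetIntegral_insert hg (fun h => ha (Finset.mem_powerset.1 hD h)) hμ
    rw [Finset.sum_congr rfl h1, Finset.sum_add_distrib, Finset.sum_ite_eq',
      if_pos (Finset.empty_mem_powerset s), ← add_assoc,
      add_comm (ENNReal.ofReal (spinePoly (∑ i ∈ s, l i) μ))]
    congr 1
    refine (lintegral_finsetSum' _ fun D _ =>
      (hg a).aemeasurable.mul (aemeasurable_subsetIntegral hg D μ)).symm.trans ?_
    refine setLIntegral_congr_fun measurableSet_Ioo fun t ht => ?_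
    simp only [Pi.mul_apply]
    rw [← Finset.mul_sum, ih (by linarith [ht.2])]

end SubsetSum

/-! ### The mixtures on boxes of cylinder sets -/

theorem measurable_spineTreeLaw :
    Measurable fun m : ℝ => spineTreeLaw (if 0 < m then m else 1) := by
  refine Measurable.measure_of_isPiSystem_of_isProbabilityMeasure (generateFrom_cylinders 0)
    (isPiSystem_cylinders 0) ?_
  rintro A (rfl | ⟨V, n, _, rfl⟩)
  · simp
  · have h : ∀ m : ℝ, 0 < (if 0 < m then m else 1) := fun m => by split_ifs with h <;> simp [h]
    simp_rw [fun m => spineTreeLaw_cyl (h m) V n]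
    have h1 : Measurable fun m : ℝ => cylWeight m V n := by
      unfold cylWeight spinePoly; fun_prop
    exact (h1.comp (Measurable.ite measurableSet_Ioi measurable_id measurable_const)).ennreal_ofReal

theorem measurable_measure_pi {ι α Ω : Type*} [Fintype ι] [MeasurableSpace α] [MeasurableSpace Ω]
    {P : ι → α → Measure Ω} [∀ i a, IsProbabilityMeasure (P i a)] (hP : ∀ i, Measurable (P i)) :
    Measurable fun a => Measure.pi fun i => P i a := by
  refine Measurable.measure_of_isPiSystem_of_isProbabilityMeasure generateFrom_pi.symm
    isPiSystem_pi ?_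
  rintro _ ⟨s, hs, rfl⟩
  simp_rw [Measure.pi_pi]
  exact Finset.measurable_prod _ fun i _ =>
    (Measure.measurable_coe (hs i (Set.mem_univ i))).comp (hP i)

/-- `localLimit` is known only for positive parameters. Off the simplex, a null set, it is replaced
by `spineTreeLaw` with nonpositive parameters reset to `1`. -/
theorem aemeasurable_pi_localLimit (ι : Type*) [Fintype ι] (μ : ℝ) :
    AEMeasurable (fun m : ι → ℝ => Measure.pi fun i => (localLimit (m i) : Measure PlanarTree))
      (simplexMeasure ι μ) := by
  refine ⟨fun m => Measure.pi fun i => spineTreeLaw (if 0 < m i then m i else 1),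
    measurable_measure_pi fun i => measurable_spineTreeLaw.comp (measurable_pi_apply i), ?_⟩
  filter_upwards [ae_mem_simplex ι μ] with m hm
  congr 1
  funext i
  rw [localLimit_eq (hm.2 i), if_pos (hm.2 i)]
  rfl

/-- As the coordinates sum to `μ`, the factors `e^{-s m_i}` multiply to a constant, and only the
polynomials remain under the integral. -/
theorem simplexMixture_pi_cyl {ι : Type*} [Fintype ι] (μ : ℝ) (S : ι → PlanarTree) (s : ℕ) :
    simplexMixture ι μ (Set.univ.pi fun i => (S i).cyl s) =
      ENNReal.ofReal (Real.exp (-(s : ℝ) * μ)) * (∏ i, ENNReal.ofReal (rhoWeight (S i) s)) *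
        ∫⁻ m, ∏ i, ENNReal.ofReal (spinePoly ((S i).cylWidth s) (m i)) ∂simplexMeasure ι μ := by
  rw [simplexMixture, Measure.bind_apply (MeasurableSet.univ_pi fun i => measurableSet_cyl _ _)
    (aemeasurable_pi_localLimit ι μ), ← lintegral_const_mul']
  · refine lintegral_congr_ae ?_
    filter_upwards [ae_mem_simplex ι μ] with m hm
    rw [Measure.pi_pi, ← hm.1, Finset.mul_sum, Real.exp_sum,
      ENNReal.ofReal_prod_of_nonneg fun _ _ => (Real.exp_pos _).le, ← Finset.prod_mul_distrib,
      ← Finset.prod_mul_distrib]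
    refine Finset.prod_congr rfl fun i _ => ?_
    have := spinePoly_nonneg (hm.2 i).le ((S i).cylWidth s)
    rw [localLimit_cyl (hm.2 i), cylWeight_eq, ENNReal.ofReal_mul (by positivity),
      ENNReal.ofReal_mul (by positivity)]
    ring
  · exact ENNReal.mul_ne_top ENNReal.ofReal_ne_top
      (ENNReal.prod_ne_top fun _ _ => ENNReal.ofReal_ne_top)

theorem component_pi_cyl {ι : Type*} [Fintype ι] (μ : ℝ) (D : Finset ι) (S : ι → PlanarTree)
    (s : ℕ) : component μ D (Set.univ.pi fun i => (S i).cyl s) =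
      ENNReal.ofReal (Real.exp (-(s : ℝ) * μ)) * (∏ i, ENNReal.ofReal (rhoWeight (S i) s)) *
        ∫⁻ m, ∏ i : {i // i ∈ D}, ENNReal.ofReal (spinePoly ((S i).cylWidth s) (m i))
          ∂simplexMeasure {i // i ∈ D} μ := by
  classical
  rw [component, MeasurableEquiv.map_apply]
  have hpre : (MeasurableEquiv.piEquivPiSubtypeProd (fun _ : ι => PlanarTree) (· ∈ D)).symm ⁻¹'
      (Set.univ.pi fun i => (S i).cyl s) =
      (Set.univ.pi fun i : {i // i ∈ D} => (S i).cyl s) ×ˢ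
        (Set.univ.pi fun i : {i // i ∉ D} => (S i).cyl s) := by
    ext p
    simp only [Set.mem_preimage, Set.mem_pi, Set.mem_univ, true_imp_iff, Set.mem_prod]
    constructor
    · intro h
      refine ⟨fun i => ?_, fun i => ?_⟩
      · have := h i
        simpa [MeasurableEquiv.piEquivPiSubtypeProd, Equiv.piEquivPiSubtypeProd, i.2] using this
      · have := h i
        simpa [MeasurableEquiv.piEquivPiSubtypeProd, Equiv.piEquivPiSubtypeProd, i.2] using this
    · rintro ⟨h1, h2⟩ i
      by_cases hi : i ∈ D
      · simpa [MeasurableEquiv.piEquivPiSubtypeProd, Equiv.piEquivPiSubtypeProd, hi] using h1 ⟨i,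
            hi⟩
      · simpa [MeasurableEquiv.piEquivPiSubtypeProd, Equiv.piEquivPiSubtypeProd, hi] using h2 ⟨i,
            hi⟩
  have hp : (∏ i : {i // i ∈ D}, ENNReal.ofReal (rhoWeight (S i) s)) *
      ∏ i : {i // i ∉ D}, ENNReal.ofReal (rhoWeight (S i) s) =
      ∏ i, ENNReal.ofReal (rhoWeight (S i) s) := by
    convert Fintype.prod_subtype_mul_prod_subtype (· ∈ D) fun i =>
        ENNReal.ofReal (rhoWeight (S i) s)
  refine (congrArg _ hpre).trans ?_
  rw [Measure.prod_prod, simplexMixture_pi_cyl, Measure.pi_pi, ← hp]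
  simp_rw [rho_cyl]
  ring

theorem sum_component_pi_cyl {ι : Type*} [Fintype ι] {μ : ℝ} (hμ : 0 < μ) (S : ι → PlanarTree)
    (s : ℕ) : (∑ D : Finset ι with D.Nonempty,
      ENNReal.ofReal (μ ^ (D.card - 1) / ((D.card - 1).factorial : ℝ)) • component μ D)
        (Set.univ.pi fun i => (S i).cyl s) =
      ENNReal.ofReal (Real.exp (-(s : ℝ) * μ) * (∏ i, rhoWeight (S i) s) *
        spinePoly (∑ i, (S i).cylWidth s) μ) := by
  classical
  have hr : 0 ≤ ∏ i, rhoWeight (S i) s := Finset.prod_nonneg fun i _ => rhoWeight_nonneg _ _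
  rw [ENNReal.ofReal_mul (by positivity), ENNReal.ofReal_mul (by positivity),
    ENNReal.ofReal_prod_of_nonneg fun _ _ => rhoWeight_nonneg _ _,
    ← sum_subsetIntegral (fun i => (S i).cylWidth s) Finset.univ hμ, Finset.powerset_univ,
    Measure.finsetSum_apply, Finset.sum_filter, Finset.mul_sum]
  refine Finset.sum_congr rfl fun D _ => ?_
  rw [subsetIntegral]
  split_ifs with hD
  · rw [Measure.smul_apply, component_pi_cyl, smul_eq_mul]
    ring
  · rw [mul_zero]

/-! ### The restriction of the local limit to a ball -/

section Grafting

variable {T₀ : PlanarTree} {q : ℕ}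

theorem graft_mem_cyl (S : T₀.level (q + 1) → PlanarTree) : T₀.graft (q + 1) S ∈ T₀.cyl q :=
  ball_graft_self S

theorem exists_graft_eq (hT₀ : T₀.height = (q + 1 : ℕ)) {T : PlanarTree} (h : T ∈ T₀.cyl q) :
    ∃ S, T₀.graft (q + 1) S = T :=
  ⟨branches h, graft_branches h hT₀⟩

/-- Deep cylinders pull back to boxes of cylinders of one common depth, so such boxes are the only
sets on which the mixtures need to be evaluated. -/
theorem preimage_graft_cyl (hT₀ : T₀.height = (q + 1 : ℕ)) (S : T₀.level (q + 1) → PlanarTree)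
    (s : ℕ) : T₀.graft (q + 1) ⁻¹' (T₀.graft (q + 1) S).cyl (q + s) =
      Set.univ.pi fun i => (S i).cyl s := by
  ext S'
  simp only [Set.mem_preimage, Set.mem_pi, Set.mem_univ, true_imp_iff, mem_cyl]
  rw [show q + s + 1 = q + 1 + s by ring]
  constructor
  · intro h i
    ext w
    simp only [mem_ball_iff, and_congr_left_iff]
    intro hw
    have hi := (mem_level_iff.1 i.2).2
    have := Set.ext_iff.1 h (i.1 ++ w)
    simp only [mem_ball_iff, append_mem_graft hT₀, List.length_append,
      show i.1.length + w.length + 1 ≤ q + 1 + s by omega, and_true] at this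
    exact this
  · intro h
    rw [ball_graft hT₀, ball_graft hT₀]
    simp_rw [h]

theorem preimage_graft_cyl_eq_empty {T : PlanarTree} (h : T ∉ T₀.cyl q) {n : ℕ} (hn : q ≤ n) :
    T₀.graft (q + 1) ⁻¹' T.cyl n = ∅ := by
  refine Set.eq_empty_of_forall_notMem fun S hS => h ?_
  exact (T.cyl_anti hn hS).symm.trans (graft_mem_cyl S)

theorem measurable_graft (hT₀ : T₀.height = (q + 1 : ℕ)) : Measurable (T₀.graft (q + 1)) := by
  refine Measurable.mono (measurable_generateFrom (s := cylinders q) ?_) le_rfl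
    (generateFrom_cylinders q).le
  rintro A (rfl | ⟨T, n, hn, rfl⟩)
  · exact MeasurableSet.empty
  · by_cases h : T ∈ T₀.cyl q
    · obtain ⟨S, rfl⟩ := exists_graft_eq hT₀ h
      obtain ⟨s, rfl⟩ := Nat.exists_eq_add_of_le hn
      rw [preimage_graft_cyl hT₀]
      exact MeasurableSet.univ_pi fun i => measurableSet_cyl _ _
    · rw [preimage_graft_cyl_eq_empty h hn]
      exact MeasurableSet.empty

theorem cylWidth_graft (hT₀ : T₀.height = (q + 1 : ℕ)) (S : T₀.level (q + 1) → PlanarTree)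
    (s : ℕ) : (T₀.graft (q + 1) S).cylWidth (q + s) = ∑ i, (S i).cylWidth s := by
  rw [cylWidth, show q + s + 1 = q + 1 + s by ring, level_graft hT₀,
    ncard_iUnion_append _ fun i => (S i).finite_level _]
  rfl

theorem cylSize_graft (hT₀ : T₀.height = (q + 1 : ℕ)) (hfin : T₀.IsFinite)
    (S : T₀.level (q + 1) → PlanarTree) (s : ℕ) :
    (T₀.graft (q + 1) S).cylSize (q + s) + Fintype.card (T₀.level (q + 1)) =
      T₀.size + ∑ i, (S i).cylSize s := by
  rw [cylSize, show q + s + 1 = q + 1 + s by ring, ball_graft hT₀,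
    ncard_union_append hT₀ hfin _ (fun i => (S i).finite_ball _)
      fun i => mem_ball_iff.2 ⟨(S i).nil_mem, by simp⟩]
  rfl

theorem rhoWeight_graft (hT₀ : T₀.height = (q + 1 : ℕ)) (hfin : T₀.IsFinite)
    (S : T₀.level (q + 1) → PlanarTree) (s : ℕ) :
    rhoWeight (T₀.graft (q + 1) S) (q + s) = ((4 : ℝ) ^ T₀.size)⁻¹ *
      2 ^ (Fintype.card (T₀.level (q + 1)) + 1) * ∏ i, rhoWeight (S i) s := by
  have h := congrArg (fun n => (4 : ℝ) ^ n) (cylSize_graft hT₀ hfin S s)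
  simp only [pow_add] at h
  simp only [rhoWeight]
  rw [cylWidth_graft hT₀, Finset.prod_mul_distrib, Finset.prod_inv_distrib,
    Finset.prod_pow_eq_pow_sum, Finset.prod_pow_eq_pow_sum, Finset.sum_add_distrib,
        Finset.sum_const,
    smul_eq_mul, mul_one, Finset.card_univ]
  set K := Fintype.card (T₀.level (q + 1))
  have h4 : (4 : ℝ) ^ K = 2 ^ K * 2 ^ K := by rw [← mul_pow]; norm_num
  rw [h4] at h
  simp only [pow_add, pow_one]
  field_simp
  linear_combination -h

end Grafting

/-- Cylinders of depth at least `q` are disjoint from `T₀.cyl q` or contained in it. In the second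
case both sides reduce to the same product of `ρ`-weights, exponentials and `spinePoly` of the total
width `∑ i, (S i).cylWidth s`. -/
theorem restrict_localLimit_closedBall {μ : ℝ} (hμ : 0 < μ) {T₀ : PlanarTree} {q : ℕ}
    (hfin : T₀.IsFinite) (hT₀ : T₀.height = (q + 1 : ℕ)) :
    (localLimit μ : Measure PlanarTree).restrict (T₀.cyl q) =
      (ENNReal.ofReal (Real.exp (-(q : ℝ) * μ) * ((4 : ℝ) ^ T₀.size)⁻¹ *
          2 ^ (Fintype.card (T₀.level (q + 1)) + 1)) •
        ∑ D : Finset (T₀.level (q + 1)) with D.Nonempty,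
          ENNReal.ofReal (μ ^ (D.card - 1) / ((D.card - 1).factorial : ℝ)) •
            component μ D).map (T₀.graft (q + 1)) := by
  have hcyl : ∀ (T : PlanarTree) (n : ℕ), q ≤ n →
      (localLimit μ : Measure PlanarTree).restrict (T₀.cyl q) (T.cyl n) =
      (ENNReal.ofReal (Real.exp (-(q : ℝ) * μ) * ((4 : ℝ) ^ T₀.size)⁻¹ *
          2 ^ (Fintype.card (T₀.level (q + 1)) + 1)) •
        ∑ D : Finset (T₀.level (q + 1)) with D.Nonempty,
          ENNReal.ofReal (μ ^ (D.card - 1) / ((D.card - 1).factorial : ℝ)) •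
            component μ D).map (T₀.graft (q + 1)) (T.cyl n) := by
    intro T n hn
    rw [Measure.restrict_apply (measurableSet_cyl T n),
      Measure.map_apply (measurable_graft hT₀) (measurableSet_cyl T n), Measure.smul_apply]
    by_cases h : T ∈ T₀.cyl q
    · obtain ⟨S, rfl⟩ := exists_graft_eq hT₀ h
      obtain ⟨s, rfl⟩ := Nat.exists_eq_add_of_le hn
      rw [preimage_graft_cyl hT₀, sum_component_pi_cyl hμ, smul_eq_mul,
        ← ENNReal.ofReal_mul (by positivity), Set.inter_eq_left.2, localLimit_cyl hμ, cylWeight_eq,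
        cylWidth_graft hT₀, rhoWeight_graft hT₀ hfin]
      · congr 1
        rw [show -((q + s : ℕ) : ℝ) * μ = -(q : ℝ) * μ + -(s : ℝ) * μ by push_cast; ring,
          Real.exp_add]
        ring
      · rw [← cyl_eq_of_mem h]
        exact cyl_anti _ hn
    · rw [preimage_graft_cyl_eq_empty h hn, measure_empty, smul_zero]
      rw [show T.cyl n ∩ T₀.cyl q = ∅ from Set.eq_empty_of_forall_notMem fun T' hT' =>
        h ((T.cyl_anti hn hT'.1).symm.trans hT'.2), measure_empty]
  refine ext_of_generate_finite _ (generateFrom_cylinders q) (isPiSystem_cylinders q) ?_ ?_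
  · rintro A (rfl | ⟨T, n, hn, rfl⟩)
    · simp
    · exact hcyl T n hn
  -- Equality of the total masses is the case of the cylinder `T₀.cyl q`, which carries both
  -- measures.
  · have h1 := hcyl T₀ q le_rfl
    rw [Measure.map_apply (measurable_graft hT₀) (measurableSet_cyl T₀ q),
      show T₀.graft (q + 1) ⁻¹' T₀.cyl q = Set.univ from
        Set.eq_univ_of_forall fun S => graft_mem_cyl S] at h1
    rw [Measure.map_apply (measurable_graft hT₀) MeasurableSet.univ, Set.preimage_univ, ← h1,
      Measure.restrict_apply_self, Measure.restrict_apply_univ]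

end PlanarTree

theorem mainTheorem5 (μ : ℝ) (hμ : 0 < μ) :
    Tendsto (PlanarTree.finiteSizeLaw μ) atTop (𝓝 (PlanarTree.localLimit μ)) ∧
    ∀ (T₀ : PlanarTree) (r : ℕ), T₀.IsFinite → T₀.height = r →
      (PlanarTree.localLimit μ : Measure PlanarTree).restrict
          (Metric.closedBall T₀ (1 / (r : ℝ))) =
        (ENNReal.ofReal (Real.exp (-((r : ℝ) - 1) * μ) * ((4 : ℝ) ^ T₀.size)⁻¹ *
            2 ^ (Fintype.card (T₀.level r) + 1)) •
          ∑ D : Finset (T₀.level r) with D.Nonempty,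
            ENNReal.ofReal (μ ^ (D.card - 1) / ((D.card - 1).factorial : ℝ)) •
              PlanarTree.component μ D).map
          (T₀.graft r) := by
  refine ⟨PlanarTree.tendsto_localLimit hμ, fun T₀ r hfin hT₀ => ?_⟩
  obtain ⟨q, rfl⟩ := Nat.exists_eq_add_of_le' (PlanarTree.one_le_of_height_eq hT₀)
  rw [PlanarTree.closedBall_eq_cyl, PlanarTree.restrict_localLimit_closedBall hμ hfin hT₀,
    show (((q + 1 : ℕ) : ℝ) - 1) = q by push_cast; ring]
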